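/- Let $R$ be a nonzero commutative ring. A sequence $(m_1,\dots,m_n)$ of elements of an $R$-module $M$ is unimodular if the canonical map $R^n\to M$, $(c_1,\dots,c_n)\mapsto\sum_i c_i m_i$, is a split injection; a vector $x$ is unimodular if the one-term sequence $(x)$ is. The stable rank $sr(R)$ is the smallest $n$ such that for every unimodular vector $(r_0,\dots,r_n)\in R^{n+1}$ there are $t_0,\dots,t_{n-1}\in R$ for which $(r_0+t_0r_n,\dots,r_{n-1}+t_{n-1}r_n)\in R^n$ is unimodular, and $sr(R)=\infty$ if there is no such $n$. Assume $sr(R)<\infty$. Let $M$ be a finitely generated free $R$-module, $N\le M$ a submodule and $m\in M$. Let $r(M,N)$ be the largest rank of a free submodule $L\subseteq N$ that is a direct summand of $M$. Let $\mathbb{U}(M,m+N)$ be the poset of non-empty finite unimodular sequences in $M$ all of whose entries lie in $m+N=\{m+n: n\in N\}$, where $s\le t$ if $s$ is a subsequence of $t$. For $(v_1,\dots,v_k)\in\mathbb{U}(M,m+N)$, let $\mathbb{U}(M,m+N)_{(v_1,\dots,v_k)}$ be the poset, with the same order, of non-empty sequences $(w_1,\dots,w_l)$ such that $(w_1,\dots,w_l,v_1,\dots,v_k)\in\mathbb{U}(M,m+N)$.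 For an integer $n$, a poset is called $n$-connected if its geometric realization $X$ is, i.e. if for every natural number $j\le n+1$ every continuous map from the boundary sphere $S^{j-1}$ of the unit ball of $\mathbb{R}^j$ to $X$ extends to the ball (so $(-1)$-connected means non-empty, and every poset is $n$-connected for $n\le -2$). Then: (1) $\mathbb{U}(M,m+N)$ is $(r(M,N)-sr(R)-1)$-connected; (2) for every $(v_1,\dots,v_k)\in\mathbb{U}(M,m+N)$, the poset $\mathbb{U}(M,m+N)_{(v_1,\dots,v_k)}$ is $(r(M,N)-sr(R)-k-1)$-connected. -/

import Mathlib

noncomputable section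

/-! ### Unimodular vectors and sequences, stable rank, relative rank -/

/-- A sequence `(m₁, …, mₙ)` of vectors of `M` is unimodular if the canonical map
`Rⁿ → M`, `(c₁, …, cₙ) ↦ ∑ cᵢ mᵢ`, is a split injection, i.e. has a linear retraction. -/
def IsUnimodularSeq (R : Type*) {M : Type*} [CommRing R] [AddCommGroup M] [Module R M]
    (s : List M) : Prop :=
  ∃ g : M →ₗ[R] (Fin s.length → R),
    g ∘ₗ Fintype.linearCombination R (fun i : Fin s.length => s.get i) = LinearMap.id

/-- A vector is unimodular if it spans a free direct summand of rank one, i.e. if the sequence of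
length one that it forms is unimodular. -/
def IsUnimodularVector (R : Type*) {M : Type*} [CommRing R] [AddCommGroup M] [Module R M]
    (x : M) : Prop :=
  IsUnimodularSeq R [x]

/-- The stable range condition `(Sₙ)`: every unimodular vector `(r₀, …, rₙ)` of `Rⁿ⁺¹` can be
shortened to a unimodular vector `(r₀ + t₀ rₙ, …, rₙ₋₁ + tₙ₋₁ rₙ)` of `Rⁿ`. -/
def StableRangeCondition (R : Type*) [CommRing R] (n : ℕ) : Prop :=
  ∀ r : Fin (n + 1) → R, IsUnimodularVector R r →
    ∃ t : Fin n → R,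
      IsUnimodularVector R (fun i : Fin n => r i.castSucc + t i * r (Fin.last n))

/-- The stable rank `sr(R)`: the smallest `n` with `(Sₙ)`, and `⊤` if there is none. -/
def stableRank (R : Type*) [CommRing R] : ℕ∞ :=
  ⨅ (n : ℕ) (_ : StableRangeCondition R n), (n : ℕ∞)

/-- The ranks of the free submodules `L ≤ N` which are direct summands of `M`. -/
def summandRanks (R : Type*) {M : Type*} [CommRing R] [AddCommGroup M] [Module R M]
    (N : Submodule R M) : Set ℕ :=
  {k | ∃ L : Submodule R M, L ≤ N ∧ (∃ L' : Submodule R M, IsCompl L L') ∧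
    Module.Free R L ∧ Module.finrank R L = k}

/-- The relative rank `r(M, N)`: the largest rank of a free direct summand of `M` that is
contained in `N`. -/
def relativeRank (R : Type*) {M : Type*} [CommRing R] [AddCommGroup M] [Module R M]
    (N : Submodule R M) : ℕ :=
  sSup (summandRanks R N)

/-- The maximum in the definition of `r(M, N)` is attained. -/
theorem relativeRank_isGreatest {R M : Type*} [CommRing R] [Nontrivial R] [AddCommGroup M]
    [Module R M] [Module.Finite R M] (N : Submodule R M) :
    IsGreatest (summandRanks R N) (relativeRank R N) := by
  have hne : (summandRanks R N).Nonempty :=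
    ⟨0, ⊥, bot_le, ⟨⊤, isCompl_bot_top⟩, inferInstance, finrank_bot R M⟩
  have hbdd : BddAbove (summandRanks R N) := by
    refine ⟨Module.finrank R M, ?_⟩
    rintro k ⟨L, -, -, -, rfl⟩
    exact Submodule.finrank_le L
  exact ⟨Nat.sSup_mem hne hbdd, fun k hk => le_csSup hbdd hk⟩

/-! ### Posets of sequences -/

/-- The set of non-empty finite sequences of elements of `X` that belong to `F`. -/
structure SeqPoset {X : Type*} (F : Set (List X)) where
  seq : List X
  ne_nil : seq ≠ []
  mem : seq ∈ F

/-- Sequences are ordered by refinement: `s ≤ t` if `s` is a subsequence of `t`. -/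
instance SeqPoset.instPartialOrder {X : Type*} (F : Set (List X)) : PartialOrder (SeqPoset F) where
  le s t := s.seq.Sublist t.seq
  le_refl s := List.Sublist.refl s.seq
  le_trans _ _ _ h₁ h₂ := List.Sublist.trans h₁ h₂
  le_antisymm s t h₁ h₂ := by
    cases s
    cases t
    simpa using List.Sublist.antisymm h₁ h₂

/-- The unimodular sequences in `M` all of whose entries lie in `m + N`. -/
def unimodularSeqs (R : Type*) {M : Type*} [CommRing R] [AddCommGroup M] [Module R M]
    (m : M) (N : Submodule R M) : Set (List M) :=
  {s | IsUnimodularSeq R s ∧ ∀ x ∈ s, ∃ n ∈ N, x = m + n}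

/-- The poset `𝕌(M, m + N)` of non-empty unimodular sequences in `M` with entries in `m + N`. -/
abbrev UnimodularPoset (R : Type*) {M : Type*} [CommRing R] [AddCommGroup M] [Module R M]
    (m : M) (N : Submodule R M) : Type _ :=
  SeqPoset (unimodularSeqs R m N)

/-- The poset `𝕌(M, m + N)_v` of non-empty sequences `w` such that the concatenation `(w, v)`
belongs to `𝕌(M, m + N)`. -/
abbrev UnimodularPosetEnding (R : Type*) {M : Type*} [CommRing R] [AddCommGroup M] [Module R M]
    (m : M) (N : Submodule R M) (v : List M) : Type _ :=
  SeqPoset {w : List M | w ++ v ∈ unimodularSeqs R m N}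

/-! ### Geometric realization of a poset, and connectivity -/

/-- The geometric realization (of the order complex, equivalently of the nerve) of a poset `P`:
its points are the finitely supported functions `P → [0, 1]` with sum `1` whose support is a
chain. -/
def PosetRealization (P : Type*) [PartialOrder P] : Type _ :=
  {x : P →₀ ℝ // (∀ p, 0 ≤ x p) ∧ (x.sum fun _ a => a) = 1 ∧
    IsChain (· ≤ ·) (x.support : Set P)}

/-- The characteristic map of the simplex spanned by a finite chain `σ` of `P`: it extends
barycentric coordinates by zero. -/
def PosetRealization.simplexMap {P : Type*} [PartialOrder P] (σ : Finset P)
    (hσ : IsChain (· ≤ ·) (σ : Set P)) (t : stdSimplex ℝ σ) : PosetRealization P :=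
  ⟨(Finsupp.equivFunOnFinite.symm (t : σ → ℝ)).embDomain (Function.Embedding.subtype _), by
    refine ⟨?_, ?_, ?_⟩
    · intro p
      by_cases hp : p ∈ Set.range (Function.Embedding.subtype (· ∈ σ))
      · obtain ⟨q, rfl⟩ := hp
        rw [Finsupp.embDomain_apply_self]
        exact t.2.1 q
      · rw [Finsupp.embDomain_of_notMem_range _ _ _ hp]
    · rw [Finsupp.sum_embDomain, Finsupp.sum_fintype _ _ (fun _ => rfl)]
      exact t.2.2
    · refine hσ.mono ?_
      intro p hp
      rw [Finsupp.support_embDomain] at hp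
      simp only [Finset.coe_map, Set.mem_image] at hp
      obtain ⟨q, -, rfl⟩ := hp
      exact q.2⟩

/-- The weak topology: a set is open if and only if its preimage in each closed simplex is open. -/
instance PosetRealization.instTopologicalSpace (P : Type*) [PartialOrder P] :
    TopologicalSpace (PosetRealization P) :=
  ⨆ (σ : Finset P) (hσ : IsChain (· ≤ ·) (σ : Set P)),
    TopologicalSpace.coinduced (PosetRealization.simplexMap σ hσ) inferInstance

/-- A space `X` is `n`-connected (`n` an integer) if for every natural number `j ≤ n + 1` every
continuous map from the sphere `S^(j-1)`, the boundary of the unit ball of `ℝʲ`, to `X` extends to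
the ball. The case `j = 0` (empty sphere) says that `X` is non-empty, `j = 1` that `X` is
path-connected, and `j ≥ 2` that the homotopy groups `π_(j-1)` vanish at all base points. Every
space is `n`-connected for `n ≤ -2`. -/
def IsNConnectedSpace (n : ℤ) (X : Type*) [TopologicalSpace X] : Prop :=
  ∀ j : ℕ, (j : ℤ) ≤ n + 1 →
    ∀ f : C(Metric.sphere (0 : EuclideanSpace ℝ (Fin j)) 1, X),
      ∃ g : C(Metric.closedBall (0 : EuclideanSpace ℝ (Fin j)) 1, X),
        ∀ x : Metric.sphere (0 : EuclideanSpace ℝ (Fin j)) 1,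
          g ⟨x.1, Metric.sphere_subset_closedBall x.2⟩ = f x

/-- A poset is `n`-connected if its geometric realization is. -/
def IsNConnectedPoset (n : ℤ) (P : Type*) [PartialOrder P] : Prop :=
  IsNConnectedSpace n (PosetRealization P)

end

/-!
# Connectivity of the posets of unimodular sequences

Let `X = m + N`. Up to order of the entries, an element of the poset `𝕌(M, m + N)_v` is a simplex of
the complex of the finite sets of vectors in `X`, disjoint from `v`, whose union with the entries of
`v` is unimodular. The links of simplices in such a complex are complexes of the same kind, for
larger `v`. By `conn_orderedFaces`, it is therefore enough to prove, for all `v` at once, that these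
complexes are `(r(M, N) - sr(R) - |v| - 1)`-connected: the mapping cylinder of the map which forgets
the order of a sequence retracts to the complex, and the simplices `σ` can be removed from it again,
since their links are joins of posets of injective words on `σ`, which are highly connected
(`conn_injWords`), with links in the complex.

The connectivity of the complexes is proved by induction on the number `n` of vectors `e i` in `N`
which have dual linear forms, `X` being invariant under translation by the `e i`. There are two
statements, `ConnInvariant` for `X` itself and `ConnTranslate` for the union of a set
`X` in the kernel of a linear form `φ` with a translate `X + a`, where `φ a = 1`. The tool is
`conn_faces`: a complex is highly connected if a full subcomplex is and if the simplices disjoint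
from it have links that meet it in highly connected complexes.

* If `v` is empty, `X` contains the union of its intersection with the kernel of the last form and
  the translate of this intersection by the last vector (`ConnInvariant.succ`), and a union
  `X ∪ (X + a)` contains the cone on the complex for `X` with apex in `X + a`
  (`HighlyConnected.conn_withTranslate`).
* If `v` contains a vector `x`, the stable range condition allows to change the dual system so that
  one of the forms takes the value `1` at `x` (`IsDualSystem.exists_eq_one`). On the kernel of this
  form `x` can be dropped from `v`, after modifying the other vectors in `v`
  (`exists_reduction`), and the vectors of `X` in this kernel are invariant under the remaining
  `n - 1` vectors. This loses one vector of the system and one element of `v`.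

The topology is elementary. `Conn c W` says that all maps from realizations of finite posets of
dimension at most `c - 2` to the subcomplex spanned by the vertices in `W` are null-homotopic there;
since spheres are retracts of boundaries of cross-polytopes, it implies the connectivity in terms of
maps from spheres (`Conn.isNConnectedPoset`). By simplicial approximation
(`exists_simplicial_approximation`) such maps are induced by monotone functions on subdivisions, and
such a map can be extended or changed one vertex at a time (`exists_carried_extension`,
`homotopicIn_of_replacement`). This gives the behaviour of `Conn` under comparisons of monotone
functions (`Conn.of_dominated`), under attaching and removing elements with highly connected links
(`Conn.attach`, `Conn.detach`) and under joins (`Conn.join`).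
-/

open scoped Topology

namespace PosetRealization

section Posets

variable {P Q : Type*} [PartialOrder P] [PartialOrder Q]

/-! ### The geometric realization of a poset -/

/-- The barycentric coordinates of a point of the geometric realization. -/
def wt (x : PosetRealization P) : P →₀ ℝ := x.1

theorem wt_injective : Function.Injective (wt : PosetRealization P → P →₀ ℝ) :=
  Subtype.val_injective

theorem ext_wt {x y : PosetRealization P} (h : ∀ p, x.wt p = y.wt p) : x = y :=
  wt_injective (Finsupp.ext h)

theorem wt_nonneg (x : PosetRealization P) (p : P) : 0 ≤ x.wt p := x.2.1 p

theorem wt_chain (x : PosetRealization P) {p q : P} (hp : x.wt p ≠ 0) (hq : x.wt q ≠ 0) :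
    p ≤ q ∨ q ≤ p :=
  x.2.2.2.total (Finsupp.mem_support_iff.2 hp) (Finsupp.mem_support_iff.2 hq)

theorem sum_wt (x : PosetRealization P) (S : Finset P) (hS : ∀ p, x.wt p ≠ 0 → p ∈ S) :
    ∑ p ∈ S, x.wt p = 1 := by
  have h : ∑ p ∈ x.wt.support, x.wt p = 1 := x.2.2.1
  rw [← h]
  symm
  refine Finset.sum_subset (fun p hp => hS p (Finsupp.mem_support_iff.1 hp)) ?_
  intro p _ hp
  simpa using hp

theorem sum_wt_univ [Fintype P] (x : PosetRealization P) : ∑ p, x.wt p = 1 :=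
  x.sum_wt _ fun _ _ => Finset.mem_univ _

theorem wt_le_one (x : PosetRealization P) (p : P) : x.wt p ≤ 1 := by
  classical
  by_cases hp : x.wt p = 0
  · rw [hp]; exact zero_le_one
  · rw [← x.sum_wt x.wt.support (fun p hp => Finsupp.mem_support_iff.2 hp)]
    exact Finset.single_le_sum (f := fun p => x.wt p) (fun q _ => x.wt_nonneg q)
      (Finsupp.mem_support_iff.2 hp)

theorem exists_wt_ne_zero (x : PosetRealization P) : ∃ p, x.wt p ≠ 0 := by
  by_contra! h
  have := x.sum_wt ∅ (fun p hp => absurd (h p) hp)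
  simp at this

theorem exists_point (w : P → ℝ) (S : Finset P) (hS : ∀ p, w p ≠ 0 → p ∈ S)
    (h0 : ∀ p, 0 ≤ w p) (h1 : ∑ p ∈ S, w p = 1)
    (hc : ∀ p q, w p ≠ 0 → w q ≠ 0 → p ≤ q ∨ q ≤ p) :
    ∃ x : PosetRealization P, ∀ p, x.wt p = w p := by
  classical
  refine ⟨⟨Finsupp.onFinset S w hS, h0, ?_, ?_⟩, fun p => rfl⟩
  · rw [Finsupp.onFinset_sum _ (fun _ => rfl)]
    exact h1
  · intro p hp q hq _
    refine hc p q ?_ ?_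
    · simpa using hp
    · simpa using hq

theorem wt_simplexMap (σ : Finset P) (hσ : IsChain (· ≤ ·) (σ : Set P)) (t : stdSimplex ℝ σ)
    (q : σ) : (simplexMap σ hσ t).wt q = t.1 q :=
  Finsupp.embDomain_apply_self (Function.Embedding.subtype _) _ q

theorem wt_simplexMap_of_notMem (σ : Finset P) (hσ : IsChain (· ≤ ·) (σ : Set P))
    (t : stdSimplex ℝ σ) {p : P} (hp : p ∉ σ) : (simplexMap σ hσ t).wt p = 0 := by
  refine Finsupp.embDomain_of_notMem_range _ _ _ ?_
  rintro ⟨q, rfl⟩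
  exact hp q.2

theorem continuous_simplexMap (σ : Finset P) (hσ : IsChain (· ≤ ·) (σ : Set P)) :
    Continuous (simplexMap σ hσ) := by
  rw [continuous_iff_coinduced_le]
  exact le_iSup₂ (f := fun (σ : Finset P) (hσ : IsChain (· ≤ ·) (σ : Set P)) =>
    TopologicalSpace.coinduced (PosetRealization.simplexMap σ hσ) inferInstance) σ hσ

theorem continuous_wt (p : P) : Continuous fun x : PosetRealization P => x.wt p := by
  refine continuous_iSup_dom.2 fun σ => continuous_iSup_dom.2 fun hσ =>
    continuous_coinduced_dom.2 ?_
  by_cases hp : p ∈ σ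
  · have : (fun x : PosetRealization P => x.wt p) ∘ simplexMap σ hσ =
        fun t => t.1 ⟨p, hp⟩ := by
      funext t
      exact wt_simplexMap σ hσ t ⟨p, hp⟩
    rw [this]
    exact (continuous_apply _).comp continuous_subtype_val
  · have : (fun x : PosetRealization P => x.wt p) ∘ simplexMap σ hσ = fun t => 0 := by
      funext t
      exact wt_simplexMap_of_notMem σ hσ t hp
    rw [this]
    exact continuous_const

/-- A map into a realization is continuous as soon as its coordinates are continuous and it meets
only finitely many vertices: its source is then covered by finitely many closed pieces, each of
which is mapped into one closed simplex. -/
theorem continuous_of_wt {Z : Type*} [TopologicalSpace Z] (f : Z → PosetRealization P)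
    (S : Finset P) (hS : ∀ z p, (f z).wt p ≠ 0 → p ∈ S)
    (hc : ∀ p, Continuous fun z => (f z).wt p) : Continuous f := by
  classical
  let C : {σ : Finset P // σ ∈ S.powerset ∧ IsChain (· ≤ ·) (σ : Set P)} → Set Z :=
    fun σ => {z | ∀ p, p ∉ σ.1 → (f z).wt p = 0}
  have : Finite {σ : Finset P // σ ∈ S.powerset ∧ IsChain (· ≤ ·) (σ : Set P)} :=
    Set.Finite.subset (S.powerset.finite_toSet) (fun σ h => h.1)
  refine LocallyFinite.continuous (f := C) (locallyFinite_of_finite _) ?_ ?_ ?_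
  · refine Set.eq_univ_of_forall fun z => Set.mem_iUnion.2 ⟨⟨(f z).wt.support, ?_, ?_⟩, ?_⟩
    · exact Finset.mem_powerset.2 fun p hp => hS z p (Finsupp.mem_support_iff.1 hp)
    · exact (f z).2.2.2
    · intro p hp
      simpa using hp
  · intro σ
    simp only [C, Set.ofPred_forall]
    exact isClosed_iInter fun p => isClosed_iInter fun _ => isClosed_eq (hc p) continuous_const
  · rintro ⟨σ, hσS, hσ⟩
    rw [continuousOn_iff_continuous_domRestrict]
    let u : C ⟨σ, hσS, hσ⟩ → stdSimplex ℝ σ := fun z => ⟨fun p => (f z.1).wt p.1,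
      fun p => wt_nonneg _ _, by
        have h := (f z.1).sum_wt σ (fun p hp => by
          by_contra h
          exact hp (z.2 p h))
        rw [← h]
        exact Finset.sum_coe_sort σ fun p => (f z.1).wt p⟩
    have hu : Continuous u := by
      refine Continuous.subtype_mk (continuous_pi fun p => ?_) _
      exact (hc p.1).comp continuous_subtype_val
    have : (C ⟨σ, hσS, hσ⟩).domRestrict f = simplexMap σ hσ ∘ u := by
      funext z
      refine ext_wt fun p => ?_
      by_cases hp : p ∈ σ
      · exact (wt_simplexMap σ hσ (u z) ⟨p, hp⟩).symm
      · exact (z.2 p hp).trans (wt_simplexMap_of_notMem σ hσ (u z) hp).symm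
    rw [this]
    exact (continuous_simplexMap σ hσ).comp hu

/-- Continuous maps into a realization are constructed from their coordinates. -/
theorem exists_continuousMap {Z : Type*} [TopologicalSpace Z] (w : Z → P → ℝ) (S : Finset P)
    (hS : ∀ z p, w z p ≠ 0 → p ∈ S) (h0 : ∀ z p, 0 ≤ w z p) (h1 : ∀ z, ∑ p ∈ S, w z p = 1)
    (hc : ∀ z p q, w z p ≠ 0 → w z q ≠ 0 → p ≤ q ∨ q ≤ p)
    (hw : ∀ p, Continuous fun z => w z p) :
    ∃ f : C(Z, PosetRealization P), ∀ z p, (f z).wt p = w z p := by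
  choose f hf using fun z => exists_point (w z) S (hS z) (h0 z) (h1 z) (hc z)
  refine ⟨⟨f, continuous_of_wt f S (fun z p hp => hS z p (hf z p ▸ hp)) fun p => ?_⟩, hf⟩
  simpa only [hf] using hw p

/-- A compact subset of a realization meets only finitely many open stars of vertices. -/
theorem exists_finset_of_compact {Z : Type*} [TopologicalSpace Z] [CompactSpace Z]
    (f : C(Z, PosetRealization P)) : ∃ S : Finset P, ∀ z p, (f z).wt p ≠ 0 → p ∈ S := by
  classical
  set U : Set P := {p | ∃ z, (f z).wt p ≠ 0} with hU
  by_cases hfin : U.Finite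
  · exact ⟨hfin.toFinset, fun z p hp => hfin.mem_toFinset.2 ⟨z, hp⟩⟩
  exfalso
  have : Nonempty Z := by
    by_contra h
    have hU0 : U = ∅ := Set.eq_empty_of_forall_notMem fun p ⟨z, _⟩ => h ⟨z⟩
    exact hfin (hU0 ▸ Set.finite_empty)
  choose! g hg using fun p (hp : p ∈ U) => hp
  set D : Set (PosetRealization P) := (fun p => f (g p)) '' U with hD
  -- every subset of `D` meets each closed simplex in a finite set, so it is closed
  have hclosed : ∀ D' ⊆ D, IsClosed D' := by
    intro D' hD'
    refine isClosed_iSup_iff.2 fun σ => isClosed_iSup_iff.2 fun hσ => isClosed_coinduced.2 ?_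
    refine Set.Finite.isClosed ?_
    have hinj : Function.Injective (simplexMap σ hσ) := by
      intro s t h
      refine Subtype.ext (funext fun q => ?_)
      rw [← wt_simplexMap σ hσ s q, h, wt_simplexMap σ hσ t q]
    refine Set.Finite.preimage hinj.injOn ?_ |>.subset
      (s := simplexMap σ hσ ⁻¹' (D' ∩ Set.range (simplexMap σ hσ))) ?_
    · refine (σ.finite_toSet.image fun p => f (g p)).subset ?_
      rintro _ ⟨hx, t, rfl⟩
      obtain ⟨p, hp, hpx⟩ := hD' hx
      refine ⟨p, ?_, hpx⟩
      by_contra hpσ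
      refine hg p hp ?_
      rw [show f (g p) = _ from hpx]
      exact wt_simplexMap_of_notMem σ hσ t hpσ
    · exact fun t ht => ⟨ht, t, rfl⟩
  have hDinf : D.Infinite := by
    intro hDf
    refine hfin ((hDf.biUnion fun x _ => (x.wt.support.finite_toSet)).subset ?_)
    intro p hp
    simp only [Set.mem_iUnion]
    exact ⟨f (g p), ⟨p, hp, rfl⟩, by simpa using hg p hp⟩
  obtain ⟨x, -, hx⟩ := hDinf.exists_accPt_of_subset_isCompact (isCompact_range f.continuous)
    (by rintro _ ⟨p, _, rfl⟩; exact ⟨_, rfl⟩)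
  rw [accPt_principal_iff_clusterPt, ← mem_closure_iff_clusterPt,
    (hclosed (D \ {x}) Set.sdiff_subset).closure_eq] at hx
  exact hx.2 rfl

instance [Finite P] : CompactSpace (PosetRealization P) := by
  classical
  have := Fintype.ofFinite P
  refine ⟨?_⟩
  have : (Set.univ : Set (PosetRealization P)) =
      ⋃ σ : {σ : Finset P // IsChain (· ≤ ·) (σ : Set P)}, Set.range (simplexMap σ.1 σ.2) := by
    symm
    refine Set.eq_univ_of_forall fun x => Set.mem_iUnion.2 ⟨⟨x.wt.support, x.2.2.2⟩, ?_⟩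
    refine ⟨⟨fun p => x.wt p, fun p => wt_nonneg _ _, ?_⟩, ?_⟩
    · exact (Finset.sum_coe_sort x.wt.support fun p => x.wt p).trans
        (x.sum_wt x.wt.support (fun p hp => Finsupp.mem_support_iff.2 hp))
    · refine ext_wt fun p => ?_
      by_cases hp : p ∈ x.wt.support
      · exact wt_simplexMap _ _ _ ⟨p, hp⟩
      · exact (wt_simplexMap_of_notMem _ _ _ hp).trans (Finsupp.notMem_support_iff.1 hp).symm
  rw [this]
  have : Finite {σ : Finset P // IsChain (· ≤ ·) (σ : Set P)} := Subtype.finite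
  refine isCompact_iUnion fun σ => ?_
  have : CompactSpace (stdSimplex ℝ σ.1) := isCompact_iff_compactSpace.1 (isCompact_stdSimplex ℝ _)
  exact isCompact_range (continuous_simplexMap σ.1 σ.2)

/-- Convex combinations `m α + (1 - m) β` of maps into a realization. They need to be continuous
only where their weight is positive, as coordinates are bounded. -/
theorem exists_comb {Z : Type*} [TopologicalSpace Z] (m : Z → ℝ) (hm : Continuous m)
    (hm0 : ∀ z, 0 ≤ m z) (hm1 : ∀ z, m z ≤ 1) (α β : Z → PosetRealization P)
    (hα : ContinuousOn α {z | 0 < m z}) (hβ : ContinuousOn β {z | m z < 1})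
    (S : Finset P) (hSα : ∀ z p, 0 < m z → (α z).wt p ≠ 0 → p ∈ S)
    (hSβ : ∀ z p, m z < 1 → (β z).wt p ≠ 0 → p ∈ S)
    (hc : ∀ z, 0 < m z → m z < 1 → ∀ p q, (α z).wt p ≠ 0 → (β z).wt q ≠ 0 → p ≤ q ∨ q ≤ p) :
    ∃ f : C(Z, PosetRealization P), ∀ z p,
      (f z).wt p = m z * (α z).wt p + (1 - m z) * (β z).wt p := by
  have key : ∀ (m : Z → ℝ) (_ : Continuous m) (_ : ∀ z, 0 ≤ m z) (α : Z → PosetRealization P)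
      (_ : ContinuousOn α {z | 0 < m z}) (p : P), Continuous fun z => m z * (α z).wt p := by
    intro m hm hm0 α hα p
    rw [continuous_iff_continuousAt]
    intro z
    rcases (hm0 z).lt_or_eq with h | h
    · refine hm.continuousAt.mul ?_
      exact (continuous_wt p).continuousAt.comp
        ((hα z h).continuousAt ((isOpen_lt continuous_const hm).mem_nhds h))
    · have hz : Filter.Tendsto m (𝓝 z) (𝓝 0) := by
        rw [h]; exact hm.continuousAt
      rw [ContinuousAt, ← h, zero_mul]
      refine squeeze_zero (fun y => mul_nonneg (hm0 y) (wt_nonneg _ _)) (fun y => ?_) hz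
      exact mul_le_of_le_one_right (hm0 y) (wt_le_one _ _)
  have hS' : ∀ z p, m z * (α z).wt p + (1 - m z) * (β z).wt p ≠ 0 →
      (0 < m z ∧ (α z).wt p ≠ 0) ∨ (m z < 1 ∧ (β z).wt p ≠ 0) := by
    intro z p h
    by_contra! h'
    refine h ?_
    have e1 : m z * (α z).wt p = 0 := by
      rcases (hm0 z).lt_or_eq with h | h
      · rw [h'.1 h, mul_zero]
      · rw [← h, zero_mul]
    have e2 : (1 - m z) * (β z).wt p = 0 := by
      rcases (hm1 z).lt_or_eq with h | h
      · rw [h'.2 h, mul_zero]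
      · rw [h, sub_self, zero_mul]
    rw [e1, e2, add_zero]
  refine exists_continuousMap _ S ?_ ?_ ?_ ?_ ?_
  · intro z p h
    rcases hS' z p h with ⟨h1, h2⟩ | ⟨h1, h2⟩
    · exact hSα z p h1 h2
    · exact hSβ z p h1 h2
  · intro z p
    exact add_nonneg (mul_nonneg (hm0 z) (wt_nonneg _ _))
      (mul_nonneg (sub_nonneg.2 (hm1 z)) (wt_nonneg _ _))
  · intro z
    rw [Finset.sum_add_distrib, ← Finset.mul_sum, ← Finset.mul_sum]
    have e1 : m z * ∑ p ∈ S, (α z).wt p = m z := by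
      rcases (hm0 z).lt_or_eq with h | h
      · rw [sum_wt _ S (fun p => hSα z p h), mul_one]
      · rw [← h, zero_mul]
    have e2 : (1 - m z) * ∑ p ∈ S, (β z).wt p = 1 - m z := by
      rcases (hm1 z).lt_or_eq with h | h
      · rw [sum_wt _ S (fun p => hSβ z p h), mul_one]
      · rw [h, sub_self, zero_mul]
    rw [e1, e2, add_sub_cancel]
  · intro z p q hp hq
    rcases hS' z p hp with ⟨h1, h2⟩ | ⟨h1, h2⟩ <;> rcases hS' z q hq with ⟨h3, h4⟩ | ⟨h3, h4⟩
    · exact (α z).wt_chain h2 h4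
    · exact hc z h1 h3 p q h2 h4
    · exact (hc z h3 h1 q p h4 h2).symm
    · exact (β z).wt_chain h2 h4
  · intro p
    refine (key m hm hm0 α hα p).add (key (fun z => 1 - m z) (continuous_const.sub hm)
      (fun z => sub_nonneg.2 (hm1 z)) β ?_ p)
    simpa only [sub_pos] using hβ

/-- The map `f` has all its values in the subcomplex spanned by `W`. -/
def MapsInto {Z : Type*} [TopologicalSpace Z] (W : Set P) (f : C(Z, PosetRealization P)) : Prop :=
  ∀ z p, (f z).wt p ≠ 0 → p ∈ W

/-- `f` and `g` are homotopic inside the subcomplex spanned by `W`. -/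
abbrev HomotopicIn {Z : Type*} [TopologicalSpace Z] (W : Set P)
    (f g : C(Z, PosetRealization P)) : Prop :=
  ContinuousMap.HomotopicWith f g (MapsInto W)

theorem HomotopicIn.mono {Z : Type*} [TopologicalSpace Z] {W W' : Set P} (h : W ⊆ W')
    {f g : C(Z, PosetRealization P)} (H : HomotopicIn W f g) : HomotopicIn W' f g := by
  obtain ⟨H⟩ := H
  exact ⟨⟨H.toHomotopy, fun t z p hp => h (H.prop' t z p hp)⟩⟩

theorem HomotopicIn.comp {Y Z : Type*} [TopologicalSpace Y] [TopologicalSpace Z] {W : Set P}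
    {f g : C(Z, PosetRealization P)} (H : HomotopicIn W f g) (h : C(Y, Z)) :
    HomotopicIn W (f.comp h) (g.comp h) := by
  obtain ⟨H⟩ := H
  refine ⟨⟨⟨⟨fun x => H (x.1, h x.2), by fun_prop⟩, ?_, ?_⟩, ?_⟩⟩
  · intro x; simp
  · intro x; simp
  · intro t z p hp
    exact H.prop' t (h z) p hp

theorem HomotopicIn.comp_left {Y Z : Type*} [TopologicalSpace Y] [TopologicalSpace Z]
    {W : Set P} {f g : C(Y, Z)} (H : f.Homotopic g) (h : C(Z, PosetRealization P))
    (hh : MapsInto W h) : HomotopicIn W (h.comp f) (h.comp g) := by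
  obtain ⟨H⟩ := H
  refine ⟨⟨⟨⟨fun x => h (H x), by fun_prop⟩, ?_, ?_⟩, ?_⟩⟩
  · intro x; simp
  · intro x; simp
  · intro t z p hp
    exact hh _ p hp

/-- The straight line homotopy between maps whose values always lie in a common simplex. -/
theorem homotopicIn_of_chain {Z : Type*} [TopologicalSpace Z] [CompactSpace Z] {W : Set P}
    (f g : C(Z, PosetRealization P)) (hf : MapsInto W f) (hg : MapsInto W g)
    (hc : ∀ z p q, (f z).wt p ≠ 0 → (g z).wt q ≠ 0 → p ≤ q ∨ q ≤ p) : HomotopicIn W f g := by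
  classical
  obtain ⟨S, hS⟩ := exists_finset_of_compact f
  obtain ⟨T, hT⟩ := exists_finset_of_compact g
  obtain ⟨H, hH⟩ := exists_comb (Z := unitInterval × Z) (fun x => (x.1 : ℝ)) (by fun_prop)
    (fun x => x.1.2.1) (fun x => x.1.2.2) (fun x => g x.2) (fun x => f x.2)
    (by fun_prop) (by fun_prop) (S ∪ T)
    (fun z p _ h => Finset.mem_union_right _ (hT z.2 p h))
    (fun z p _ h => Finset.mem_union_left _ (hS z.2 p h))
    (fun z _ _ p q hp hq => (hc z.2 q p hq hp).symm)
  refine ⟨⟨⟨H, fun z => ext_wt fun p => ?_, fun z => ext_wt fun p => ?_⟩, ?_⟩⟩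
  · exact (hH _ _).trans (by simp)
  · exact (hH _ _).trans (by simp)
  · intro t z p hp
    by_contra hpW
    refine hp ?_
    have e1 : (g z).wt p = 0 := by
      by_contra h; exact hpW (hg z p h)
    have e2 : (f z).wt p = 0 := by
      by_contra h; exact hpW (hf z p h)
    change (H (t, z)).wt p = 0
    rw [hH, e1, e2, mul_zero, mul_zero, add_zero]

/-- The map induced by a function that is monotone on the vertices that occur. -/
theorem exists_push {Z : Type*} [TopologicalSpace Z] [CompactSpace Z] {W : Set P} (u : P → Q)
    (hu : MonotoneOn u W) (f : C(Z, PosetRealization P)) (hf : MapsInto W f) :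
    ∃ g : C(Z, PosetRealization Q), ∀ z, (g z).wt = (f z).wt.mapDomain u := by
  classical
  obtain ⟨S, hS⟩ := exists_finset_of_compact f
  have hw : ∀ z q, (f z).wt.mapDomain u q = ∑ p ∈ S, if u p = q then (f z).wt p else 0 := by
    intro z q
    rw [Finsupp.mapDomain, Finsupp.sum, Finsupp.finsetSum_apply]
    rw [Finset.sum_subset (s₂ := S) (fun p hp => hS z p (Finsupp.mem_support_iff.1 hp))]
    · exact Finset.sum_congr rfl fun p _ => by rw [Finsupp.single_apply]
    · intro p _ hp
      rw [Finsupp.notMem_support_iff.1 hp, Finsupp.single_zero, Finsupp.zero_apply]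
  have hne : ∀ z q, (f z).wt.mapDomain u q ≠ 0 → ∃ p, (f z).wt p ≠ 0 ∧ u p = q := by
    intro z q h
    have := Finsupp.mapDomain_support (Finsupp.mem_support_iff.2 h)
    obtain ⟨p, hp, rfl⟩ := Finset.mem_image.1 this
    exact ⟨p, Finsupp.mem_support_iff.1 hp, rfl⟩
  suffices h : ∃ g : C(Z, PosetRealization Q), ∀ z q, (g z).wt q = (f z).wt.mapDomain u q from
    h.imp fun g hg z => Finsupp.ext (hg z)
  refine exists_continuousMap _ (S.image u) ?_ ?_ ?_ ?_ ?_
  · intro z q h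
    obtain ⟨p, hp, rfl⟩ := hne z q h
    exact Finset.mem_image_of_mem u (hS z p hp)
  · intro z q
    simp only [hw]
    refine Finset.sum_nonneg fun p _ => ?_
    split_ifs
    · exact wt_nonneg _ _
    · exact le_rfl
  · intro z
    simp only [hw]
    rw [Finset.sum_comm, ← (f z).sum_wt S (hS z)]
    refine Finset.sum_congr rfl fun p hp => ?_
    rw [Finset.sum_ite_eq, if_pos (Finset.mem_image_of_mem u hp)]
  · intro z q q' h h'
    obtain ⟨p, hp, rfl⟩ := hne z q h
    obtain ⟨p', hp', rfl⟩ := hne z q' h'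
    rcases (f z).wt_chain hp hp' with h | h
    · exact Or.inl (hu (hf z p hp) (hf z p' hp') h)
    · exact Or.inr (hu (hf z p' hp') (hf z p hp) h)
  · intro q
    simp only [hw]
    refine continuous_finsetSum _ fun p _ => ?_
    split_ifs
    · exact (continuous_wt p).comp f.continuous
    · exact continuous_const

theorem exists_of_wt_mapDomain_ne_zero {u : P → Q} {x : PosetRealization P}
    {y : PosetRealization Q} (h : y.wt = x.wt.mapDomain u) {q : Q} (hq : y.wt q ≠ 0) :
    ∃ p, x.wt p ≠ 0 ∧ u p = q := by
  classical
  rw [h] at hq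
  have := Finsupp.mapDomain_support (Finsupp.mem_support_iff.2 hq)
  obtain ⟨p, hp, rfl⟩ := Finset.mem_image.1 this
  exact ⟨p, Finsupp.mem_support_iff.1 hp, rfl⟩

theorem HomotopicIn.push {Z : Type*} [TopologicalSpace Z] [CompactSpace Z] {W : Set P}
    {W' : Set Q} {f f' : C(Z, PosetRealization P)} (H : HomotopicIn W f f') (u : P → Q)
    (hu : MonotoneOn u W) (huW : Set.MapsTo u W W') {g g' : C(Z, PosetRealization Q)}
    (hg : ∀ z, (g z).wt = (f z).wt.mapDomain u) (hg' : ∀ z, (g' z).wt = (f' z).wt.mapDomain u) :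
    HomotopicIn W' g g' := by
  obtain ⟨H⟩ := H
  obtain ⟨G, hG⟩ := exists_push u hu (H.toContinuousMap) (fun z p hp => H.prop' z.1 z.2 p hp)
  refine ⟨⟨⟨G, fun z => wt_injective ?_, fun z => wt_injective ?_⟩, ?_⟩⟩
  · refine (hG _).trans ?_
    rw [hg]
    congr 2
    exact H.apply_zero z
  · refine (hG _).trans ?_
    rw [hg']
    congr 2
    exact H.apply_one z
  · intro t z q hq
    obtain ⟨p, hp, rfl⟩ := exists_of_wt_mapDomain_ne_zero (hG (t, z)) hq
    exact huW (H.prop' t z p hp)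

/-- Pointwise comparable functions of posets induce homotopic maps. In the description of points as
step functions from the unit interval to the poset, the homotopy uses the smaller function on the
initial segment of length `1 - t` and the larger one on the rest. -/
theorem homotopicIn_of_le {Z : Type*} [TopologicalSpace Z] [CompactSpace Z] {W : Set P}
    {W' : Set Q} {f : C(Z, PosetRealization P)} (hf : MapsInto W f) (u v : P → Q)
    (hu : MonotoneOn u W) (hv : MonotoneOn v W) (huW : Set.MapsTo u W W')
    (hvW : Set.MapsTo v W W') (huv : ∀ p ∈ W, u p ≤ v p) {g g' : C(Z, PosetRealization Q)}
    (hg : ∀ z, (g z).wt = (f z).wt.mapDomain u) (hg' : ∀ z, (g' z).wt = (f z).wt.mapDomain v) :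
    HomotopicIn W' g g' := by
  classical
  obtain ⟨S, hS⟩ := exists_finset_of_compact f
  -- `c z p` is the mass of the vertices strictly below `p`
  let c : Z → P → ℝ := fun z p => ∑ p' ∈ S, if p' < p then (f z).wt p' else 0
  have hcc : ∀ p, Continuous fun z => c z p := by
    intro p
    refine continuous_finsetSum _ fun p' _ => ?_
    split_ifs
    · exact (continuous_wt p').comp f.continuous
    · exact continuous_const
  have hc0 : ∀ z p, 0 ≤ c z p := fun z p => Finset.sum_nonneg fun p' _ => by
    split_ifs
    · exact wt_nonneg _ _
    · exact le_rfl
  have hc1 : ∀ z p, p ∈ S → c z p + (f z).wt p ≤ 1 := by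
    intro z p hp
    have e : c z p + (f z).wt p =
        ∑ p' ∈ S, ((if p' < p then (f z).wt p' else 0) + if p' = p then (f z).wt p' else 0) := by
      rw [Finset.sum_add_distrib, Finset.sum_ite_eq' S p, if_pos hp]
    rw [e, ← (f z).sum_wt S (hS z)]
    refine Finset.sum_le_sum fun p' _ => ?_
    by_cases h : p' = p
    · subst h; simp
    · rw [if_neg h, add_zero]
      split_ifs
      · exact le_rfl
      · exact wt_nonneg _ _
  have hcmono : ∀ z p q, p ∈ S → p < q → c z p + (f z).wt p ≤ c z q := by
    intro z p q hp hpq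
    have e : c z p + (f z).wt p =
        ∑ p' ∈ S, ((if p' < p then (f z).wt p' else 0) + if p' = p then (f z).wt p' else 0) := by
      rw [Finset.sum_add_distrib, Finset.sum_ite_eq' S p, if_pos hp]
    rw [e]
    refine Finset.sum_le_sum fun p' _ => ?_
    by_cases h : p' = p
    · subst h; simp [hpq]
    · rw [if_neg h, add_zero]
      by_cases h1 : p' < p
      · rw [if_pos h1, if_pos (h1.trans hpq)]
      · rw [if_neg h1]
        split_ifs
        · exact wt_nonneg _ _
        · exact le_rfl
  let a : unitInterval × Z → P → ℝ := fun x p =>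
    min (c x.2 p + (f x.2).wt p) (1 - x.1) - min (c x.2 p) (1 - x.1)
  have ha0 : ∀ x p, 0 ≤ a x p := fun x p =>
    sub_nonneg.2 (min_le_min_right _ (le_add_of_nonneg_right (wt_nonneg _ _)))
  have ha1 : ∀ x p, a x p ≤ (f x.2).wt p := by
    intro x p
    have := wt_nonneg (f x.2) p
    simp only [a]
    rcases le_total (c x.2 p) (1 - x.1 : ℝ) with h | h
    · rw [min_eq_left h]
      linarith [min_le_left (c x.2 p + (f x.2).wt p) (1 - x.1 : ℝ)]
    · rw [min_eq_right h, min_eq_right (by linarith)]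
      linarith
  let w : unitInterval × Z → P × Bool → ℝ := fun x p => if p.2 then (f x.2).wt p.1 - a x p.1 else a x p.1
  have hwne : ∀ x p, w x p ≠ 0 → (f x.2).wt p.1 ≠ 0 := by
    rintro x ⟨p, i⟩ h h0
    have : a x p = 0 := le_antisymm (h0 ▸ ha1 x p) (ha0 x p)
    refine h ?_
    simp only [w]
    split_ifs
    · rw [h0, this, sub_zero]
    · exact this
  -- mass at level `0` of `q` and at level `1` of `p` forces `q ≤ p`
  have hkey : ∀ x p q, w x (p, true) ≠ 0 → w x (q, false) ≠ 0 → q ≤ p := by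
    intro x p q hp hq
    have hp' := hwne x _ hp
    have hq' := hwne x _ hq
    rcases (f x.2).wt_chain hp' hq' with h | h
    · rcases h.lt_or_eq with h | h
      · exfalso
        have h1 := hcmono x.2 p q (hS _ _ hp') h
        have h2 : c x.2 q < 1 - x.1 := by
          by_contra! h2
          refine hq ?_
          simp only [w, a, Bool.false_eq_true, if_false]
          rw [min_eq_right h2, min_eq_right (h2.trans (le_add_of_nonneg_right (wt_nonneg _ _))),
            sub_self]
        refine hp ?_
        simp only [w, a, if_true]
        rw [min_eq_left (h1.trans h2.le),
          min_eq_left ((le_add_of_nonneg_right (wt_nonneg _ _)).trans (h1.trans h2.le))]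
        ring
      · exact h.ge
    · exact h
  obtain ⟨F, hF⟩ := exists_continuousMap w (S ×ˢ Finset.univ)
    (fun x p h => Finset.mem_product.2 ⟨hS _ _ (hwne x p h), Finset.mem_univ _⟩)
    (fun x p => by
      simp only [w]
      split_ifs
      · exact sub_nonneg.2 (ha1 _ _)
      · exact ha0 _ _)
    (fun x => by
      rw [Finset.sum_product, ← (f x.2).sum_wt S (hS _)]
      refine Finset.sum_congr rfl fun p _ => ?_
      simp [w])
    (by
      rintro x ⟨p, i⟩ ⟨q, j⟩ hp hq
      have hpq := (f x.2).wt_chain (hwne x _ hp) (hwne x _ hq)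
      rcases i with _ | _ <;> rcases j with _ | _
      · simpa using hpq
      · exact Or.inl ⟨hkey x _ _ hq hp, Bool.false_le _⟩
      · exact Or.inr ⟨hkey x _ _ hp hq, Bool.false_le _⟩
      · simpa using hpq)
    (by
      rintro ⟨p, i⟩
      have h1 : Continuous fun x : unitInterval × Z => (f x.2).wt p :=
        (continuous_wt p).comp (f.continuous.comp continuous_snd)
      have h2 : Continuous fun x : unitInterval × Z => c x.2 p := (hcc p).comp continuous_snd
      have h3 : Continuous fun x : unitInterval × Z => a x p := by fun_prop
      rcases i with _ | _
      · simpa [w] using h3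
      · simp only [w, if_true]
        exact h1.sub h3)
  let U : P × Bool → Q := fun p => if p.2 then v p.1 else u p.1
  have hFW : MapsInto {p : P × Bool | p.1 ∈ W} F := by
    intro x p hp
    rw [hF] at hp
    exact hf _ _ (hwne x p hp)
  obtain ⟨H, hH⟩ := exists_push (W := {p : P × Bool | p.1 ∈ W}) U (by
    rintro ⟨p, i⟩ hp ⟨q, j⟩ hq ⟨h1, h2⟩
    rcases i with _ | _ <;> rcases j with _ | _
    · exact hu hp hq h1
    · exact (hu hp hq h1).trans (huv q hq)
    · exact absurd (h2 rfl) (by simp)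
    · exact hv hp hq h1) F hFW
  have hmap : ∀ (x : unitInterval × Z) (b : Bool), (∀ p, w x (p, b) = (f x.2).wt p) →
      (∀ p, w x (p, !b) = 0) → (H x).wt = (f x.2).wt.mapDomain fun p => U (p, b) := by
    intro x b h1 h2
    have : (F x).wt = (f x.2).wt.mapDomain fun p => (p, b) := by
      ext ⟨p, i⟩
      rw [hF]
      by_cases hi : i = b
      · subst hi
        rw [h1]
        exact (Finsupp.mapDomain_apply (f := fun p : P => (p, i))
          (fun p q h => (Prod.ext_iff.1 h).1) _ p).symm
      · have hi' : i = !b := by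
          rcases i with _ | _ <;> rcases b with _ | _ <;> simp_all
        rw [hi', h2, Finsupp.mapDomain_of_notMem_range]
        rintro ⟨q, hq⟩
        have := (Prod.ext_iff.1 hq).2
        simp at this
    rw [hH, this, ← Finsupp.mapDomain_comp]
    rfl
  have e0 : ∀ z p, a ((0 : unitInterval), z) p = (f z).wt p := by
    intro z p
    by_cases hp : p ∈ S
    · have h1 := hc1 z p hp
      have h2 := wt_nonneg (f z) p
      simp only [a, Set.Icc.coe_zero, sub_zero]
      rw [min_eq_left h1, min_eq_left (by linarith)]
      ring
    · have h0 : (f z).wt p = 0 := by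
        by_contra h; exact hp (hS z p h)
      simp only [a, h0, add_zero, sub_self]
  have e1 : ∀ z p, a ((1 : unitInterval), z) p = 0 := by
    intro z p
    have h1 := hc0 z p
    have h2 := wt_nonneg (f z) p
    simp only [a, Set.Icc.coe_one, sub_self]
    rw [min_eq_right h1, min_eq_right (by linarith), sub_self]
  refine ⟨⟨⟨H, fun z => wt_injective ?_, fun z => wt_injective ?_⟩, ?_⟩⟩
  · rw [hg]
    exact hmap (0, z) false (fun p => by simpa [w] using e0 z p)
      (fun p => by simpa [w, sub_eq_zero] using (e0 z p).symm)
  · rw [hg']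
    exact hmap (1, z) true (fun p => by simp [w, e1 z p]) (fun p => by simp [w, e1 z p])
  · intro t z q hq
    obtain ⟨⟨p, i⟩, hp, rfl⟩ := exists_of_wt_mapDomain_ne_zero (hH (t, z)) hq
    rcases i with _ | _
    · exact huW (hFW _ _ hp)
    · exact hvW (hFW _ _ hp)

/-! ### Simplicial approximation -/

/-- The poset `K` has a strictly monotone rank function with values in `{0, …, d - 1}`, so its
realization has dimension at most `d - 1`. -/
def RankLT (K : Type*) [PartialOrder K] (d : ℕ) : Prop :=
  ∃ ρ : K → ℕ, StrictMono ρ ∧ ∀ k, ρ k < d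

/-- The simplices, ordered by inclusion, of the full subdivided source that are met by the values of
`s`: the non-empty sets of vertices on which some value of `s` has no zero coordinate. -/
def Bary {Z K : Type*} [TopologicalSpace Z] [PartialOrder K] (s : C(Z, PosetRealization K)) :
    Type _ :=
  {σ : Finset K // σ.Nonempty ∧ ∃ z, ∀ k ∈ σ, (s z).wt k ≠ 0}

instance {Z K : Type*} [TopologicalSpace Z] [PartialOrder K] (s : C(Z, PosetRealization K)) :
    PartialOrder (Bary s) :=
  inferInstanceAs (PartialOrder {σ : Finset K // σ.Nonempty ∧ ∃ z, ∀ k ∈ σ, (s z).wt k ≠ 0})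

noncomputable instance instFintypeBary {Z K : Type*} [TopologicalSpace Z] [PartialOrder K]
    [Fintype K]
    (s : C(Z, PosetRealization K)) : Fintype (Bary s) :=
  have : Finite (Bary s) := Subtype.finite
  Fintype.ofFinite _

theorem Bary.chain {Z K : Type*} [TopologicalSpace Z] [PartialOrder K]
    {s : C(Z, PosetRealization K)} (σ : Bary s) {v w : K} (hv : v ∈ σ.1) (hw : w ∈ σ.1) :
    v ≤ w ∨ w ≤ v := by
  obtain ⟨z, hz⟩ := σ.2.2
  exact (s z).wt_chain (hz v hv) (hz w hw)

theorem Bary.card_le {Z K : Type*} [TopologicalSpace Z] [PartialOrder K]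
    {s : C(Z, PosetRealization K)} {d : ℕ} (hK : RankLT K d) (σ : Bary s) : σ.1.card ≤ d := by
  obtain ⟨ρ, hρ, hρd⟩ := hK
  rw [← Finset.card_range d]
  refine Finset.card_le_card_of_injOn ρ (fun k _ => by simpa using hρd k) ?_
  intro v hv w hw h
  rcases σ.chain hv hw with h' | h' <;> rcases h'.lt_or_eq with h'' | h''
  · exact absurd h (hρ h'').ne
  · exact h''
  · exact absurd h (hρ h'').ne'
  · exact h''.symm

theorem Bary.rankLT {Z K : Type*} [TopologicalSpace Z] [PartialOrder K]
    (s : C(Z, PosetRealization K)) {d : ℕ} (hK : RankLT K d) : RankLT (Bary s) d := by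
  refine ⟨fun σ => σ.1.card - 1, fun σ τ h => ?_, fun σ => ?_⟩
  · have h1 : σ.1.card < τ.1.card := Finset.card_lt_card h
    have h2 := σ.2.1.card_pos
    change σ.1.card - 1 < τ.1.card - 1
    omega
  · have h1 := σ.card_le hK
    have h2 := σ.2.1.card_pos
    change σ.1.card - 1 < d
    omega

/-- Barycentric subdivision. The coordinate of the vertex `σ` is `|σ|` times the length of the set
of those `t ≥ 0` for which `σ` is the set of vertices with coordinate larger than `t`. -/
theorem exists_barycentric {Z K : Type*} [TopologicalSpace Z] [PartialOrder K] [Fintype K]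
    [DecidableEq K] (s : C(Z, PosetRealization K)) :
    ∃ h : C(Z, PosetRealization (Bary s)),
      (∀ z σ, (h z).wt σ ≠ 0 → ∀ k ∈ σ.1, (s z).wt k ≠ 0) ∧
      ∀ z k, ∑ σ : Bary s, (h z).wt σ * (if k ∈ σ.1 then (σ.1.card : ℝ)⁻¹ else 0) =
        (s z).wt k := by
  classical
  let A : Z → Finset K → Set ℝ := fun z σ => {t | 0 ≤ t ∧ ∀ k, k ∈ σ ↔ t < (s z).wt k}
  let a : Z → (σ : Finset K) → σ.Nonempty → ℝ := fun z σ hσ =>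
    Finset.univ.sup' ⟨hσ.choose, Finset.mem_univ _⟩
      (fun k => if k ∈ σ then 0 else (s z).wt k)
  let b : Z → (σ : Finset K) → σ.Nonempty → ℝ := fun z σ hσ => σ.inf' hσ fun k => (s z).wt k
  have hA : ∀ z σ (hσ : σ.Nonempty), A z σ = Set.Ico (a z σ hσ) (b z σ hσ) := by
    intro z σ hσ
    ext t
    have ha : a z σ hσ ≤ t ↔ ∀ k, (if k ∈ σ then 0 else (s z).wt k) ≤ t :=
      (Finset.sup'_le_iff _ _).trans (by simp only [Finset.mem_univ, forall_true_left])
    simp only [A, b, Set.mem_Ico, ha, Finset.lt_inf'_iff, Set.mem_ofPred_eq]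
    constructor
    · rintro ⟨h0, h⟩
      refine ⟨fun k => ?_, fun k hk => (h k).1 hk⟩
      split_ifs with hk
      · exact h0
      · exact not_lt.1 fun h' => hk ((h k).2 h')
    · rintro ⟨h1, h2⟩
      refine ⟨?_, fun k => ⟨h2 k, fun h => ?_⟩⟩
      · have := h1 hσ.choose
        rwa [if_pos hσ.choose_spec] at this
      · by_contra hk
        have := h1 k
        rw [if_neg hk] at this
        exact absurd h this.not_gt
  let V : Z → Finset K → ℝ := fun z σ => MeasureTheory.volume.real (A z σ)
  have hV : ∀ z σ (hσ : σ.Nonempty), V z σ = max (b z σ hσ - a z σ hσ) 0 := by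
    intro z σ hσ
    simp only [V]
    rw [hA z σ hσ, Real.volume_real_Ico]
  have hV0 : ∀ z σ, 0 ≤ V z σ := fun z σ => MeasureTheory.measureReal_nonneg
  have hVne : ∀ z σ, V z σ ≠ 0 → ∃ t, t ∈ A z σ := by
    intro z σ h
    by_contra! h'
    refine h ?_
    simp only [V]
    rw [Set.eq_empty_of_forall_notMem h', MeasureTheory.measureReal_empty]
  have hVs : ∀ z σ, V z σ ≠ 0 → ∀ k ∈ σ, (s z).wt k ≠ 0 := by
    intro z σ h k hk
    obtain ⟨t, ht0, ht⟩ := hVne z σ h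
    exact (ht0.trans_lt ((ht k).1 hk)).ne'
  have hVc : ∀ σ, σ.Nonempty → Continuous fun z => V z σ := by
    intro σ hσ
    have hwt : ∀ k, Continuous fun z => (s z).wt k := fun k => (continuous_wt k).comp s.continuous
    have e : (fun z => V z σ) = fun z => max (b z σ hσ - a z σ hσ) 0 :=
      funext fun z => hV z σ hσ
    rw [e]
    refine Continuous.max (Continuous.sub ?_ ?_) continuous_const
    · exact Continuous.finset_inf'_apply _ fun k _ => hwt k
    · refine Continuous.finset_sup'_apply _ fun k _ => ?_
      split_ifs
      · exact continuous_const
      · exact hwt k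
  -- layer cake formula for the coordinate at `k`
  have hlayer : ∀ z k, ∑ σ : Finset K, (if k ∈ σ then V z σ else 0) = (s z).wt k := by
    intro z k
    rw [← Finset.sum_filter]
    simp only [V]
    rw [← MeasureTheory.measureReal_biUnion_finset (h := fun σ hσ => by
      rw [hA z σ ⟨k, (Finset.mem_filter.1 hσ).2⟩]
      exact measure_Ico_lt_top.ne)]
    · have : (⋃ σ ∈ Finset.univ.filter (fun σ : Finset K => k ∈ σ), A z σ) =
          Set.Ico 0 ((s z).wt k) := by
        ext t
        simp only [Set.mem_iUnion, Finset.mem_filter, Finset.mem_univ, true_and, Set.mem_Ico,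
          exists_prop]
        constructor
        · rintro ⟨σ, hk, h0, h⟩
          exact ⟨h0, (h k).1 hk⟩
        · rintro ⟨h0, h⟩
          exact ⟨Finset.univ.filter fun k => t < (s z).wt k, by simpa using h, h0, by simp⟩
      rw [this, Real.volume_real_Ico, sub_zero, max_eq_left (wt_nonneg _ _)]
    · intro σ _ τ _ hne
      refine Set.disjoint_left.2 fun t h1 h2 => hne ?_
      ext k
      exact (h1.2 k).trans (h2.2 k).symm
    · intro σ hσ
      rw [hA z σ ⟨k, (Finset.mem_filter.1 hσ).2⟩]
      exact measurableSet_Ico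
  have hsub : ∀ (F : Finset K → ℝ) (z : Z), (∀ σ, V z σ = 0 → F σ = 0) → F ∅ = 0 →
      ∑ σ : Bary s, F σ.1 = ∑ σ : Finset K, F σ := by
    intro F z hF h0
    let T : Finset (Finset K) :=
      Finset.univ.filter fun σ => σ.Nonempty ∧ ∃ z, ∀ k ∈ σ, (s z).wt k ≠ 0
    rw [← Finset.sum_subset (Finset.subset_univ T)]
    · exact (@Finset.sum_subtype (Finset K) ℝ _
        (fun σ => σ.Nonempty ∧ ∃ z, ∀ k ∈ σ, (s z).wt k ≠ 0) (instFintypeBary s) T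
        (by simp [T]) F).symm
    · intro σ _ hσ
      rcases σ.eq_empty_or_nonempty with h | h
      · rw [h, h0]
      · refine hF σ ?_
        by_contra hV
        exact hσ (by simpa [T] using ⟨h, z, hVs z σ hV⟩)
  obtain ⟨h, hh⟩ := exists_continuousMap (P := Bary s) (fun z σ => (σ.1.card : ℝ) * V z σ.1)
    Finset.univ (fun _ _ _ => Finset.mem_univ _)
    (fun z σ => mul_nonneg (Nat.cast_nonneg _) (hV0 z _))
    (by
      intro z
      rw [hsub (fun σ => (σ.card : ℝ) * V z σ) z (fun σ h => by simp only [h, mul_zero])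
        (by simp)]
      rw [← (s z).sum_wt_univ, Finset.sum_congr rfl fun k _ => (hlayer z k).symm,
        Finset.sum_comm]
      refine Finset.sum_congr rfl fun σ _ => ?_
      rw [← Finset.sum_filter, Finset.sum_const, nsmul_eq_mul]
      simp)
    (by
      intro z σ τ hσ hτ
      obtain ⟨t, ht⟩ := hVne z σ.1 (right_ne_zero_of_mul hσ)
      obtain ⟨t', ht'⟩ := hVne z τ.1 (right_ne_zero_of_mul hτ)
      rcases le_total t t' with h | h
      · exact Or.inr fun k hk => (ht.2 k).2 (h.trans_lt ((ht'.2 k).1 hk))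
      · exact Or.inl fun k hk => (ht'.2 k).2 (h.trans_lt ((ht.2 k).1 hk)))
    (fun σ => continuous_const.mul (hVc σ.1 σ.2.1))
  refine ⟨h, fun z σ hσ => hVs z σ.1 (right_ne_zero_of_mul (hh z σ ▸ hσ)), fun z k => ?_⟩
  rw [← hlayer z k, ← hsub (fun σ => if k ∈ σ then V z σ else 0) z (fun σ h => by simp [h])
    (by simp)]
  refine Finset.sum_congr rfl fun σ _ => ?_
  rw [hh]
  have := σ.2.1.card_pos
  split_ifs
  · field_simp
  · rw [mul_zero]

/-- Iterated barycentric subdivision: the realization of `K` is subdivided, by a map `s` to the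
realization of `K'`, into simplices that are small with respect to the positions `g v` of the
vertices `v` of `K'`. -/
theorem exists_subdivision (K : Type) [PartialOrder K] [Fintype K] {d : ℕ} (hK : RankLT K d)
    (N : ℕ) : ∃ (K' : Type) (_ : PartialOrder K') (_ : Fintype K')
      (s : C(PosetRealization K, PosetRealization K')) (g : K' → K → ℝ), RankLT K' d ∧
      (∀ v w, v ≤ w → ∀ k, |g v k - g w k| ≤ (1 - ((d : ℝ) + 1)⁻¹) ^ N) ∧
      ∀ x k, ∑ v, (s x).wt v * g v k = x.wt k := by
  classical
  have hd : (0 : ℝ) < (d : ℝ) + 1 := by positivity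
  induction N with
  | zero =>
    refine ⟨K, inferInstance, inferInstance, ContinuousMap.id _, fun v k => if k = v then 1 else 0, hK, ?_, ?_⟩
    · intro v w _ k
      simp only [pow_zero]
      split_ifs <;> norm_num
    · intro x k
      simp
  | succ N ih =>
    obtain ⟨K', _, _, s, g, hK', hmesh, hs⟩ := ih
    obtain ⟨h, h1, h2⟩ := exists_barycentric s
    have hr0 : 0 ≤ (1 - ((d : ℝ) + 1)⁻¹) := by
      rw [sub_nonneg]
      exact inv_le_one_of_one_le₀ (by linarith [Nat.cast_nonneg (α := ℝ) d])
    refine ⟨Bary s, inferInstance, inferInstance, h,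
      fun σ k => ∑ v ∈ σ.1, (σ.1.card : ℝ)⁻¹ * g v k, Bary.rankLT s hK', ?_, ?_⟩
    · intro σ τ hστ k
      have hσ : (0 : ℝ) < σ.1.card := Nat.cast_pos.2 σ.2.1.card_pos
      have hτ : (0 : ℝ) < τ.1.card := Nat.cast_pos.2 τ.2.1.card_pos
      have hτd : (τ.1.card : ℝ) ≤ d := Nat.cast_le.2 (τ.card_le hK')
      set r := (1 - ((d : ℝ) + 1)⁻¹) with hr
      -- a difference of averages is an average of differences, and at least the fraction
      -- `1 / |τ|` of them vanishes
      have e : ∑ v ∈ σ.1, (σ.1.card : ℝ)⁻¹ * g v k - ∑ v ∈ τ.1, (τ.1.card : ℝ)⁻¹ * g v k =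
          (σ.1.card : ℝ)⁻¹ * (τ.1.card : ℝ)⁻¹ * ∑ v ∈ σ.1, ∑ w ∈ τ.1, (g v k - g w k) := by
        simp only [Finset.sum_sub_distrib, Finset.sum_const, nsmul_eq_mul, ← Finset.mul_sum]
        field_simp
      have hin : ∀ v ∈ σ.1, |∑ w ∈ τ.1, (g v k - g w k)| ≤ (τ.1.card - 1) * r ^ N := by
        intro v hv
        have hvτ : v ∈ τ.1 := hστ hv
        rw [← Finset.sum_erase_add _ _ hvτ, sub_self, add_zero]
        refine (Finset.abs_sum_le_sum_abs _ _).trans ?_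
        refine (Finset.sum_le_card_nsmul _ _ (r ^ N) fun w hw => ?_).trans_eq ?_
        · rcases τ.chain hvτ (Finset.mem_of_mem_erase hw) with h | h
          · exact hmesh v w h k
          · rw [abs_sub_comm]
            exact hmesh w v h k
        · rw [nsmul_eq_mul, Finset.card_erase_of_mem hvτ, Nat.cast_sub τ.2.1.card_pos, Nat.cast_one]
      rw [e, abs_mul, abs_of_pos (by positivity)]
      have h3 : |∑ v ∈ σ.1, ∑ w ∈ τ.1, (g v k - g w k)| ≤
          σ.1.card * ((τ.1.card - 1) * r ^ N) := by
        refine (Finset.abs_sum_le_sum_abs _ _).trans ?_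
        refine (Finset.sum_le_card_nsmul _ _ _ hin).trans_eq ?_
        rw [nsmul_eq_mul]
      calc (σ.1.card : ℝ)⁻¹ * (τ.1.card : ℝ)⁻¹ * |∑ v ∈ σ.1, ∑ w ∈ τ.1, (g v k - g w k)|
          ≤ (σ.1.card : ℝ)⁻¹ * (τ.1.card : ℝ)⁻¹ * (σ.1.card * ((τ.1.card - 1) * r ^ N)) := by
            gcongr
        _ = (1 - (τ.1.card : ℝ)⁻¹) * r ^ N := by field_simp
        _ ≤ r * r ^ N := by
            gcongr
            rw [hr]
            gcongr
            linarith
        _ = r ^ (N + 1) := (pow_succ' r N).symm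
    · intro x k
      rw [← hs x k]
      simp only [← h2 x, Finset.mul_sum, Finset.sum_mul]
      rw [Finset.sum_comm]
      refine Finset.sum_congr rfl fun σ _ => ?_
      rw [← Finset.sum_subset (Finset.subset_univ σ.1)]
      · refine Finset.sum_congr rfl fun v hv => ?_
        rw [if_pos hv]
        ring
      · intro v _ hv
        rw [if_neg hv]
        ring

/-- Simplicial approximation: a map `f` from the realization of a finite poset is contiguous to a
map induced by a monotone function `φ` on a subdivision. -/
theorem exists_simplicial_approximation {K : Type} [PartialOrder K] [Fintype K] {d : ℕ}
    (hK : RankLT K d) (f : C(PosetRealization K, PosetRealization P)) :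
    ∃ (K' : Type) (_ : PartialOrder K') (_ : Fintype K') (φ : K' → P)
      (h : C(PosetRealization K, PosetRealization K')), RankLT K' d ∧ Monotone φ ∧
      (∀ k, ∃ x, (f x).wt (φ k) ≠ 0) ∧ ∀ x k, (h x).wt k ≠ 0 → (f x).wt (φ k) ≠ 0 := by
  classical
  -- a Lebesgue number for the cover by the preimages of the open stars of the vertices of `P`
  let ι : PosetRealization K → K → ℝ := fun x k => x.wt k
  have hι : Topology.IsClosedEmbedding ι := by
    refine Continuous.isClosedEmbedding (continuous_pi fun k => continuous_wt k) ?_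
    exact fun x y h => ext_wt fun k => congrFun h k
  have hopen : ∀ p, IsOpen {x | (f x).wt p ≠ 0} := fun p =>
    isOpen_ne_fun ((continuous_wt p).comp f.continuous) continuous_const
  choose U hU hUf using fun p => hι.isInducing.isOpen_iff.1 (hopen p)
  have hmemU : ∀ p x, ι x ∈ U p ↔ (f x).wt p ≠ 0 := fun p x => by
    change x ∈ ι ⁻¹' U p ↔ _
    rw [hUf]
    rfl
  obtain ⟨δ, hδ, hδU⟩ := lebesgue_number_lemma_of_metric (c := U)
    (isCompact_range hι.continuous) hU (by
      rintro _ ⟨x, rfl⟩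
      obtain ⟨p, hp⟩ := (f x).exists_wt_ne_zero
      exact Set.mem_iUnion.2 ⟨p, (hmemU p x).2 hp⟩)
  have hr1 : (1 - ((d : ℝ) + 1)⁻¹) < 1 := by
    rw [sub_lt_self_iff]
    positivity
  obtain ⟨N, hN⟩ := exists_pow_lt_of_lt_one (half_pos hδ) hr1
  obtain ⟨K', _, _, s, g, hK', hmesh, hs⟩ := exists_subdivision K hK N
  -- a vertex of the subdivision is close to all points whose carrier contains it
  have hclose : ∀ x v, (s x).wt v ≠ 0 → ∀ k, |g v k - x.wt k| < δ / 2 := by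
    intro x v hv k
    have e : g v k - x.wt k = ∑ w, (s x).wt w * (g v k - g w k) := by
      simp only [mul_sub, Finset.sum_sub_distrib, ← Finset.sum_mul, hs, sum_wt_univ, one_mul]
    rw [e]
    refine lt_of_le_of_lt ?_ hN
    refine (Finset.abs_sum_le_sum_abs _ _).trans ?_
    have e' : (1 - ((d : ℝ) + 1)⁻¹) ^ N = ∑ w, (s x).wt w * (1 - ((d : ℝ) + 1)⁻¹) ^ N := by
      rw [← Finset.sum_mul, sum_wt_univ, one_mul]
    rw [e']
    refine Finset.sum_le_sum fun w _ => ?_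
    rw [abs_mul, abs_of_nonneg (wt_nonneg _ _)]
    by_cases hw : (s x).wt w = 0
    · rw [hw, zero_mul, zero_mul]
    · refine mul_le_mul_of_nonneg_left ?_ (wt_nonneg _ _)
      rcases (s x).wt_chain hv hw with h | h
      · exact hmesh v w h k
      · rw [abs_sub_comm]
        exact hmesh w v h k
  have hp : ∀ v, (∃ x, (s x).wt v ≠ 0) → ∃ p, ∀ x, (s x).wt v ≠ 0 → (f x).wt p ≠ 0 := by
    rintro v ⟨x₀, hx₀⟩
    obtain ⟨p, hp⟩ := hδU (ι x₀) ⟨x₀, rfl⟩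
    refine ⟨p, fun x hx => (hmemU p x).1 (hp ?_)⟩
    rw [Metric.mem_ball, dist_pi_lt_iff hδ]
    intro k
    have h1 := hclose x v hx k
    have h2 := hclose x₀ v hx₀ k
    rw [Real.dist_eq]
    change |x.wt k - x₀.wt k| < δ
    rw [abs_lt] at *
    constructor <;> linarith [h1.1, h1.2, h2.1, h2.2]
  choose p hp using hp
  obtain ⟨h, h1, -⟩ := exists_barycentric s
  have hex : ∀ (σ : Bary s) (v : K'), v ∈ σ.1 → ∃ x, (s x).wt v ≠ 0 := fun σ v hv =>
    σ.2.2.imp fun z hz => hz v hv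
  have hmax : ∀ σ : Bary s, ∃ m, ∃ hm : m ∈ σ.1, ∀ v (hv : v ∈ σ.1),
      p v (hex σ v hv) ≤ p m (hex σ m hm) := by
    intro σ
    obtain ⟨z, hz⟩ := σ.2.2
    obtain ⟨q, hq⟩ := (σ.1.attach.image fun v : {v // v ∈ σ.1} => p v.1 (hex σ v.1 v.2)).exists_maximal
      ((Finset.attach_nonempty_iff.2 σ.2.1).image _)
    obtain ⟨m, -, rfl⟩ := Finset.mem_image.1 hq.1
    refine ⟨m.1, m.2, fun v hv => ?_⟩
    rcases (f z).wt_chain (hp v (hex σ v hv) z (hz v hv)) (hp m.1 (hex σ m.1 m.2) z (hz m.1 m.2))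
      with h | h
    · exact h
    · exact hq.2 (Finset.mem_image.2 ⟨⟨v, hv⟩, Finset.mem_attach _ _, rfl⟩) h
  choose m hm hmax using hmax
  refine ⟨Bary s, inferInstance, inferInstance, fun σ => p (m σ) (hex σ _ (hm σ)), h,
    Bary.rankLT s hK', ?_, ?_, ?_⟩
  · intro σ τ hστ
    exact hmax τ (m σ) (hστ (hm σ))
  · intro σ
    obtain ⟨z, hz⟩ := σ.2.2
    exact ⟨z, hp _ _ z (hz _ (hm σ))⟩
  · intro x σ hσ
    exact hp _ _ x (h1 x σ hσ _ (hm σ))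

/-! ### Connectivity tested on realizations of finite posets -/

/-- The subcomplex spanned by the subset `W` of the poset `P` is `(c - 2)`-connected, in the
following form: every map into it from the realization of a finite poset of dimension at most
`c - 2` is null-homotopic in it. The index is shifted so that it adds up under joins. -/
def Conn (c : ℕ) (W : Set P) : Prop :=
  ∀ d, d + 1 ≤ c → ∀ (K : Type) [PartialOrder K] [Fintype K], RankLT K d →
    ∀ f : C(PosetRealization K, PosetRealization P), MapsInto W f →
      ∃ q : PosetRealization P, (∀ p, q.wt p ≠ 0 → p ∈ W) ∧
        HomotopicIn W f (ContinuousMap.const _ q)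

theorem Conn.mono {c c' : ℕ} {W : Set P} (h : Conn c W) (hc : c' ≤ c) : Conn c' W :=
  fun d hd K _ _ hK f hf => h d (hd.trans hc) K hK f hf

theorem conn_zero (W : Set P) : Conn 0 W := fun d hd => absurd hd (by omega)

theorem RankLT.mono {K : Type*} [PartialOrder K] {d d' : ℕ} (h : RankLT K d) (hd : d ≤ d') :
    RankLT K d' :=
  h.imp fun _ hρ => ⟨hρ.1, fun k => (hρ.2 k).trans_le hd⟩

/-- The link of a vertex has smaller dimension. -/
theorem rankLT_link {K : Type*} [PartialOrder K] {ρ : K → ℕ} (hρ : StrictMono ρ) {x : K} {a : ℕ}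
    (hx : ρ x < a) {Y : Set K} (hY : ∀ y ∈ Y, (y < x ∨ x < y) ∧ ρ y < a) : RankLT Y (a - 1) := by
  have hne : ∀ y : Y, ρ y ≠ ρ x := fun y => by
    rcases (hY y y.2).1 with h | h
    · exact (hρ h).ne
    · exact (hρ h).ne'
  refine ⟨fun y => if ρ y < ρ x then ρ y else ρ y - 1, fun y y' h => ?_, fun y => ?_⟩
  · have h1 : ρ y < ρ y' := hρ h
    have h2 := hne y
    have h3 := hne y'
    dsimp only
    split_ifs <;> omega
  · have h1 := (hY y y.2).2
    have h2 := hne y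
    dsimp only
    split_ifs <;> omega

theorem Conn.exists_point {c : ℕ} {W : Set P} (h : Conn c W) (hc : 1 ≤ c) :
    ∃ q : PosetRealization P, ∀ p, q.wt p ≠ 0 → p ∈ W := by
  have hE : ∀ z : PosetRealization Empty, False := fun z => by
    obtain ⟨p, -⟩ := z.exists_wt_ne_zero
    exact p.elim
  obtain ⟨q, hq, -⟩ := h 0 hc Empty ⟨fun k => k.elim, fun k => k.elim, fun k => k.elim⟩
    ⟨fun z => (hE z).elim, continuous_of_wt _ ∅ (fun z => (hE z).elim)
      fun p => continuous_iff_continuousAt.2 fun z => (hE z).elim⟩ (fun z => (hE z).elim)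
  exact ⟨q, hq⟩

theorem exists_vertex (p : P) : ∃ x : PosetRealization P, ∀ q, x.wt q ≠ 0 → q = p := by
  classical
  obtain ⟨x, hx⟩ := PosetRealization.exists_point (fun q => if q = p then (1 : ℝ) else 0) {p}
    (by simp) (fun q => by split_ifs <;> norm_num) (by simp) (by
      intro q q' hq hq'
      have h1 : q = p := by by_contra h; simp [h] at hq
      have h2 : q' = p := by by_contra h; simp [h] at hq'
      exact Or.inl (h1.trans h2.symm).le)
  refine ⟨x, fun q hq => ?_⟩
  by_contra h
  rw [hx, if_neg h] at hq
  exact hq rfl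

/-- Connectivity passes from `W'` to `W` if `W` is a retract of `W'` up to a comparison of order
preserving maps. -/
theorem Conn.of_dominated {c : ℕ} {W : Set P} {W' : Set Q} (hW' : Conn c W') (u : P → Q)
    (v : Q → P) (hu : MonotoneOn u W) (hv : MonotoneOn v W') (huW : Set.MapsTo u W W')
    (hvW : Set.MapsTo v W' W) (h : (∀ p ∈ W, v (u p) ≤ p) ∨ ∀ p ∈ W, p ≤ v (u p)) :
    Conn c W := by
  intro d hd K _ _ hK f hf
  obtain ⟨g, hg⟩ := exists_push u hu f hf
  have hgW : MapsInto W' g := fun z q hq => by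
    obtain ⟨p, hp, rfl⟩ := exists_of_wt_mapDomain_ne_zero (hg z) hq
    exact huW (hf z p hp)
  obtain ⟨q, hq, H⟩ := hW' d hd K hK g hgW
  obtain ⟨g', hg'⟩ := exists_push v hv g hgW
  obtain ⟨q', hq'⟩ := exists_push v hv (ContinuousMap.const Unit q) (fun _ p hp => hq p hp)
  refine ⟨q' (), fun p hp => ?_, ContinuousMap.HomotopicWith.trans (g := g') ?_
    (H.push v hv hvW hg' fun _ => hq' ())⟩
  · obtain ⟨p', hp', rfl⟩ := exists_of_wt_mapDomain_ne_zero (hq' ()) hp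
    exact hvW (hq p' hp')
  · have h1 : ∀ z, (f z).wt = (f z).wt.mapDomain id := fun z => Finsupp.mapDomain_id.symm
    have h2 : ∀ z, (g' z).wt = (f z).wt.mapDomain fun p => v (u p) := fun z => by
      rw [hg', hg, ← Finsupp.mapDomain_comp]
      rfl
    have h3 : MonotoneOn (fun p => v (u p)) W := fun p hp p' hp' hpp =>
      hv (huW hp) (huW hp') (hu hp hp' hpp)
    have h4 : Set.MapsTo (fun p => v (u p)) W W := fun p hp => hvW (huW hp)
    rcases h with h | h
    · exact (homotopicIn_of_le hf _ id h3 monotoneOn_id h4 (Set.mapsTo_id _) h h2 h1).symm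
    · exact homotopicIn_of_le hf id _ monotoneOn_id h3 (Set.mapsTo_id _) h4 h h1 h2

/-- A conically contractible poset, in which `p ≤ u p ≥ p₀` for a monotone function `u`, is highly
connected. -/
theorem conn_of_cone (c : ℕ) {W : Set P} {p₀ : P} (hp₀ : p₀ ∈ W) (u : P → P)
    (hu : MonotoneOn u W) (huW : Set.MapsTo u W W) (h : ∀ p ∈ W, p ≤ u p)
    (h' : ∀ p ∈ W, p₀ ≤ u p) : Conn c W := by
  intro d hd K _ _ hK f hf
  obtain ⟨x, hx⟩ := exists_vertex p₀
  obtain ⟨g, hg⟩ := exists_push u hu f hf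
  have h1 : ∀ z, (f z).wt = (f z).wt.mapDomain id := fun z => Finsupp.mapDomain_id.symm
  have h2 : ∀ z, x.wt = (f z).wt.mapDomain fun _ => p₀ := fun z => by
    have hs : x.wt = Finsupp.single p₀ (x.wt p₀) := by
      ext q
      by_cases hq : q = p₀
      · rw [hq, Finsupp.single_eq_same]
      · rw [Finsupp.single_eq_of_ne hq]
        by_contra h
        exact hq (hx q h)
    have h1 : x.wt p₀ = 1 := by
      rw [← x.sum_wt {p₀} (fun p hp => Finset.mem_singleton.2 (hx p hp)), Finset.sum_singleton]
    rw [hs, h1]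
    have := (f z).sum_wt (f z).wt.support fun p hp => Finsupp.mem_support_iff.2 hp
    rw [Finsupp.mapDomain, Finsupp.sum, ← this]
    exact (Finsupp.single_finsetSum _ _ _)
  refine ⟨x, fun p hp => hx p hp ▸ hp₀, ?_⟩
  refine ContinuousMap.HomotopicWith.trans (g := g) ?_ (ContinuousMap.HomotopicWith.symm ?_)
  · exact homotopicIn_of_le hf id u monotoneOn_id hu (Set.mapsTo_id _) huW h h1 hg
  · exact homotopicIn_of_le hf (fun _ => p₀) u monotoneOn_const hu (fun _ _ => hp₀) huW h' h2 hg

/-! ### Extension of maps over subcomplexes -/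

/-- The full subcomplex of a realization that is spanned by a set of vertices. -/
def face (S : Set P) : Set (PosetRealization P) := {z | ∀ k, z.wt k ≠ 0 → k ∈ S}

theorem isClosed_face (S : Set P) : IsClosed (face S) := by
  have : face S = ⋂ k ∈ Sᶜ, {z | z.wt k = 0} := by
    ext z
    simp only [face, Set.mem_iInter, Set.mem_ofPred_eq, Set.mem_compl_iff]
    exact forall_congr' fun k => not_imp_comm
  rw [this]
  exact isClosed_biInter fun k _ => isClosed_eq (continuous_wt k) continuous_const

theorem exists_finset_of_continuousOn {Z : Type*} [TopologicalSpace Z] {C : Set Z}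
    (hC : IsCompact C) {f : Z → PosetRealization P} (hf : ContinuousOn f C) :
    ∃ S : Finset P, ∀ z ∈ C, ∀ p, (f z).wt p ≠ 0 → p ∈ S := by
  have := isCompact_iff_compactSpace.1 hC
  obtain ⟨S, hS⟩ := exists_finset_of_compact ⟨_, continuousOn_iff_continuous_domRestrict.1 hf⟩
  exact ⟨S, fun z hz p hp => hS ⟨z, hz⟩ p hp⟩

/-- The total weight of the vertices in `S`. -/
noncomputable def mass [Fintype P] (S : Set P) (z : PosetRealization P) : ℝ :=
  ∑ k, S.indicator (fun k => z.wt k) k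

theorem continuous_mass [Fintype P] (S : Set P) : Continuous (mass S) := by
  classical
  refine continuous_finsetSum _ fun k _ => ?_
  simp only [Set.indicator_apply]
  split_ifs
  · exact continuous_wt k
  · exact continuous_const

theorem mass_nonneg [Fintype P] (S : Set P) (z : PosetRealization P) : 0 ≤ mass S z :=
  Finset.sum_nonneg fun _ _ => Set.indicator_apply_nonneg fun _ => wt_nonneg _ _

theorem mass_compl [Fintype P] (S : Set P) (z : PosetRealization P) :
    mass Sᶜ z = 1 - mass S z := by
  rw [eq_sub_iff_add_eq, ← z.sum_wt_univ, mass, mass, ← Finset.sum_add_distrib]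
  exact Finset.sum_congr rfl fun k _ => Set.indicator_compl_add_self_apply S (fun k => z.wt k) k

theorem mass_le_one [Fintype P] (S : Set P) (z : PosetRealization P) : mass S z ≤ 1 := by
  have := mass_nonneg Sᶜ z
  rw [mass_compl] at this
  linarith

theorem wt_eq_zero_of_mass [Fintype P] {S : Set P} {z : PosetRealization P} (h : mass S z = 0)
    {k : P} (hk : k ∈ S) : z.wt k = 0 := by
  have := (Finset.sum_eq_zero_iff_of_nonneg
    fun k _ => Set.indicator_apply_nonneg fun _ => wt_nonneg z k).1 h k (Finset.mem_univ k)
  rwa [Set.indicator_of_mem hk] at this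

/-- The radial projection, defined where `S` has positive weight, to the subcomplex spanned by
`S`. -/
theorem exists_normalize [Fintype P] (S : Set P) :
    ∃ n : PosetRealization P → PosetRealization P, ContinuousOn n {z | 0 < mass S z} ∧
      ∀ z, 0 < mass S z → ∀ k, (n z).wt k = S.indicator (fun k => z.wt k) k / mass S z := by
  classical
  obtain ⟨g, hg⟩ := exists_continuousMap (Z := {z : PosetRealization P // 0 < mass S z})
    (fun z k => S.indicator (fun k => z.1.wt k) k / mass S z.1) Finset.univ
    (fun _ _ _ => Finset.mem_univ _)
    (fun z k => div_nonneg (Set.indicator_apply_nonneg fun _ => wt_nonneg _ _) z.2.le)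
    (fun z => by
      rw [← Finset.sum_div]
      exact div_self z.2.ne')
    (fun z k l hk hl => by
      refine z.1.wt_chain (p := k) (q := l) ?_ ?_
      · intro h
        simp [Set.indicator_apply, h] at hk
      · intro h
        simp [Set.indicator_apply, h] at hl)
    (fun k => by
      refine Continuous.div ?_ ((continuous_mass S).comp continuous_subtype_val)
        fun z => z.2.ne'
      simp only [Set.indicator_apply]
      split_ifs
      · exact (continuous_wt k).comp continuous_subtype_val
      · exact continuous_const)
  refine ⟨fun z => if h : 0 < mass S z then g ⟨z, h⟩ else z, ?_, ?_⟩
  · rw [continuousOn_iff_continuous_domRestrict]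
    exact g.continuous.congr fun z => by
      simp only [Set.domRestrict_apply, dif_pos (show 0 < mass S z.1 from z.2)]
  · intro z hz k
    dsimp only
    rw [dif_pos hz, hg]

theorem wt_ne_zero_of_normalize [Fintype P] {S : Set P} {z y : PosetRealization P}
    (h : ∀ k, y.wt k = S.indicator (fun k => z.wt k) k / mass S z) {k : P} (hk : y.wt k ≠ 0) :
    k ∈ S ∧ z.wt k ≠ 0 := by
  classical
  rw [h] at hk
  have h1 : S.indicator (fun k => z.wt k) k ≠ 0 := fun h0 => hk (by rw [h0, zero_div])
  exact ⟨Set.mem_of_indicator_ne_zero h1, fun h0 => h1 (by simp [Set.indicator_apply, h0])⟩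

/-- A map defined on the subcomplex spanned by `S` only is null-homotopic in `W` if `W` is highly
connected compared with the dimension of this subcomplex. -/
theorem exists_nullhomotopy_on {K : Type} [PartialOrder K] [Fintype K] {S : Set K} {c d : ℕ}
    (hd : d + 1 ≤ c) (hS : RankLT S d) {W : Set P} (hW : Conn c W)
    {f : PosetRealization K → PosetRealization P} (hf : ContinuousOn f (face S))
    (hfW : ∀ z ∈ face S, ∀ p, (f z).wt p ≠ 0 → p ∈ W) :
    ∃ (q : PosetRealization P) (H : unitInterval × PosetRealization K → PosetRealization P),
      (∀ p, q.wt p ≠ 0 → p ∈ W) ∧ ContinuousOn H (Set.univ ×ˢ face S) ∧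
      (∀ z ∈ face S, H (0, z) = f z) ∧ (∀ z ∈ face S, H (1, z) = q) ∧
      ∀ t, ∀ z ∈ face S, ∀ p, (H (t, z)).wt p ≠ 0 → p ∈ W := by
  classical
  obtain ⟨i, hi⟩ := exists_push (W := Set.univ) (Subtype.val : S → K)
    (fun _ _ _ _ h => h) (ContinuousMap.id _) (fun _ _ _ => Set.mem_univ _)
  have hiS : ∀ y, i y ∈ face S := fun y k hk => by
    obtain ⟨p, -, rfl⟩ := exists_of_wt_mapDomain_ne_zero (hi y) hk
    exact p.2
  obtain ⟨r, hr⟩ := exists_continuousMap (Z := face S) (P := S) (fun z k => z.1.wt k.1)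
    Finset.univ (fun _ _ _ => Finset.mem_univ _) (fun _ _ => wt_nonneg _ _)
    (fun z => by
      rw [← z.1.sum_wt S.toFinset (fun p hp => by simpa using z.2 p hp)]
      exact (Finset.sum_subtype S.toFinset (by simp) fun k => z.1.wt k).symm)
    (fun z k l hk hl => z.1.wt_chain hk hl)
    (fun k => (continuous_wt k.1).comp continuous_subtype_val)
  have hir : ∀ z : face S, i (r z) = z.1 := by
    intro z
    refine ext_wt fun k => ?_
    rw [hi]
    by_cases hk : k ∈ S
    · exact (Finsupp.mapDomain_apply Subtype.val_injective _ (⟨k, hk⟩ : S)).trans (hr _ _)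
    · rw [Finsupp.mapDomain_of_notMem_range]
      · by_contra h
        exact hk (z.2 k fun h' => h h'.symm)
      · rintro ⟨l, rfl⟩
        exact hk l.2
  have hfi : Continuous fun y => f (i y) := hf.comp_continuous i.continuous hiS
  obtain ⟨q, hq, ⟨H⟩⟩ := hW d hd S hS ⟨_, hfi⟩ (fun y p hp => hfW _ (hiS y) p hp)
  refine ⟨q, fun x => if h : x.2 ∈ face S then H (x.1, r ⟨x.2, h⟩) else q, hq, ?_, ?_, ?_, ?_⟩
  · rw [continuousOn_iff_continuous_domRestrict]
    have : Continuous fun x : ↥((Set.univ : Set unitInterval) ×ˢ face S) =>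
        H (x.1.1, r ⟨x.1.2, x.2.2⟩) := by
      refine H.continuous.comp (Continuous.prodMk (by fun_prop) (r.continuous.comp ?_))
      exact Continuous.subtype_mk (by fun_prop) _
    exact this.congr fun x => by
      simp only [Set.domRestrict_apply, dif_pos (show x.1.2 ∈ face S from x.2.2)]
  · intro z hz
    dsimp only
    rw [dif_pos hz, H.apply_zero]
    exact congrArg f (hir ⟨z, hz⟩)
  · intro z hz
    dsimp only
    rw [dif_pos hz, H.apply_one]
    rfl
  · intro t z hz p hp
    dsimp only at hp
    rw [dif_pos hz] at hp
    exact H.prop' t _ p hp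

/-- Extension of a map over the star of one additional vertex `x`: the star is the cone over the
link of `x`, and the map is null-homotopic on the link. -/
theorem exists_extension_vertex {K : Type} [PartialOrder K] [Fintype K] {S : Set K} {x : K}
    (hx : x ∉ S) {c d : ℕ} (hd : d + 1 ≤ c) {W : Set P} (hW : Conn c W)
    (hrank : RankLT {y | y ∈ S ∧ (y < x ∨ x < y)} d)
    {f : PosetRealization K → PosetRealization P} (hf : ContinuousOn f (face S))
    (hfW : ∀ z ∈ face {y | y ∈ S ∧ (y < x ∨ x < y)}, ∀ p, (f z).wt p ≠ 0 → p ∈ W) :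
    ∃ g : PosetRealization K → PosetRealization P, ContinuousOn g (face (insert x S)) ∧
      (∀ z, z.wt x = 0 → g z = f z) ∧
      ∀ z ∈ face (insert x S), z.wt x ≠ 0 → ∀ p, (g z).wt p ≠ 0 → p ∈ W := by
  classical
  set Lk : Set K := {y | y ∈ S ∧ (y < x ∨ x < y)} with hLk
  have hLkS : face Lk ⊆ face S := fun z hz k hk => (hz k hk).1
  obtain ⟨q, H, hq, hH, hH0, hH1, hHW⟩ := exists_nullhomotopy_on hd hrank hW (hf.mono hLkS) hfW
  obtain ⟨n, hn, hnw⟩ := exists_normalize ({x}ᶜ : Set K)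
  have hmass : ∀ z : PosetRealization K, mass ({x}ᶜ : Set K) z = 1 - z.wt x := by
    intro z
    rw [mass_compl, mass]
    simp [Set.indicator_apply]
  set C := face (insert x Lk) with hC
  have hnC : ∀ z ∈ C, z.wt x < 1 → n z ∈ face Lk := by
    intro z hz hzx k hk
    obtain ⟨h1, h2⟩ := wt_ne_zero_of_normalize (hnw z (by rw [hmass]; linarith)) hk
    exact (hz k h2).resolve_left h1
  let τ : PosetRealization K → unitInterval := fun z =>
    Set.projIcc (0 : ℝ) 1 zero_le_one (2 * z.wt x)
  have hτ : Continuous τ := continuous_projIcc.comp (continuous_const.mul (continuous_wt x))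
  let G : PosetRealization K → PosetRealization P := fun z =>
    if 1 / 2 ≤ z.wt x then q else H (τ z, n z)
  have hGA : ContinuousOn G (C ∩ {z | z.wt x ≤ 1 / 2}) := by
    have h1 : ContinuousOn (fun z => H (τ z, n z)) (C ∩ {z | z.wt x ≤ 1 / 2}) := by
      refine hH.comp (hτ.continuousOn.prodMk (hn.mono ?_)) ?_
      · rintro z ⟨-, hz⟩
        have hz' : z.wt x ≤ 1 / 2 := hz
        change 0 < mass _ z
        rw [hmass]
        linarith
      · rintro z ⟨hz, hz'⟩
        have hz' : z.wt x ≤ 1 / 2 := hz'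
        exact ⟨Set.mem_univ _, hnC z hz (by linarith)⟩
    refine h1.congr ?_
    rintro z ⟨hz, hz'⟩
    have hz' : z.wt x ≤ 1 / 2 := hz'
    change (if 1 / 2 ≤ z.wt x then q else H (τ z, n z)) = _
    split_ifs with h
    · have : τ z = 1 := Set.projIcc_of_right_le _ (by linarith)
      dsimp only
      rw [this, hH1 _ (hnC z hz (by linarith))]
    · rfl
  have hGB : ContinuousOn G (C ∩ {z | 1 / 2 ≤ z.wt x}) := by
    refine (continuousOn_const (c := q)).congr ?_
    rintro z ⟨-, hz⟩
    exact if_pos hz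
  have hGC : ContinuousOn G C := by
    have := hGA.union_of_isClosed hGB
      ((isClosed_face _).inter (isClosed_le (continuous_wt x) continuous_const))
      ((isClosed_face _).inter (isClosed_le continuous_const (continuous_wt x)))
    refine this.mono fun z hz => ?_
    rcases le_total (z.wt x) (1 / 2) with h | h
    · exact Or.inl ⟨hz, h⟩
    · exact Or.inr ⟨hz, h⟩
  have hstar : ∀ z ∈ face (insert x S), z.wt x ≠ 0 → z ∈ C := by
    intro z hz hzx k hk
    rcases eq_or_ne k x with h | h
    · exact Or.inl h
    · refine Or.inr ⟨(hz k hk).resolve_left h, ?_⟩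
      rcases z.wt_chain hk hzx with h' | h'
      · exact Or.inl (lt_of_le_of_ne h' h)
      · exact Or.inr (lt_of_le_of_ne h' h.symm)
  have hx0 : ∀ z ∈ face S, z.wt x = 0 := fun z hz => by
    by_contra h
    exact hx (hz x h)
  refine ⟨fun z => if z.wt x = 0 then f z else G z, ?_, fun z hz => if_pos hz, ?_⟩
  · have h1 : ContinuousOn (fun z => if z.wt x = 0 then f z else G z) (face S) :=
      hf.congr fun z hz => if_pos (hx0 z hz)
    have h2 : ContinuousOn (fun z => if z.wt x = 0 then f z else G z) C := by
      refine hGC.congr fun z hz => ?_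
      split_ifs with h
      · have hzL : z ∈ face Lk := fun k hk => (hz k hk).resolve_left fun hkx => hk (hkx ▸ h)
        have hnz : n z = z := by
          refine ext_wt fun k => ?_
          rw [hnw z (by rw [hmass, h]; norm_num), hmass, h, sub_zero, div_one]
          by_cases hk : k = x
          · rw [hk, h, Set.indicator_of_notMem (by simp)]
          · exact Set.indicator_of_mem (by simpa using hk) _
        have hτ0 : τ z = 0 := Set.projIcc_of_le_left _ (by rw [h, mul_zero])
        change _ = if 1 / 2 ≤ z.wt x then q else H (τ z, n z)
        rw [if_neg (by rw [h]; norm_num), hnz, hτ0, hH0 z hzL]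
      · rfl
    refine (h1.union_of_isClosed h2 (isClosed_face _) (isClosed_face _)).mono fun z hz => ?_
    by_cases h : z.wt x = 0
    · exact Or.inl fun k hk => (hz k hk).resolve_left fun hkx => hk (hkx ▸ h)
    · exact Or.inr (hstar z hz h)
  · intro z hz hzx p hp
    have hzC := hstar z hz hzx
    dsimp only at hp
    rw [if_neg hzx] at hp
    change (if 1 / 2 ≤ z.wt x then q else H (τ z, n z)).wt p ≠ 0 at hp
    split_ifs at hp with h
    · exact hq p hp
    · exact hHW _ _ (hnC z hzC (by linarith)) p hp

/-- Extension of a map from the subcomplex spanned by `L` over the vertices in `V`, where the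
simplices that contain `x ∈ V` are mapped to the highly connected carrier `Φ x`. -/
theorem exists_carried_extension {K : Type} [PartialOrder K] [Fintype K] {L : Set K}
    {V : Finset K} (hLV : ∀ x ∈ V, x ∉ L) {c : ℕ} (Φ : K → Set P)
    (hΦ : ∀ x ∈ V, ∀ y ∈ V, x ≤ y → Φ x = Φ y) (hconn : ∀ x ∈ V, Conn c (Φ x))
    (hrank : ∀ x ∈ V, ∃ d, d + 1 ≤ c ∧ RankLT {y | (y ∈ L ∨ y ∈ V) ∧ (y < x ∨ x < y)} d)
    {f : PosetRealization K → PosetRealization P} (hf : ContinuousOn f (face L))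
    (hcar : ∀ z ∈ face L, ∀ x ∈ V, (∀ k, z.wt k ≠ 0 → k ≤ x ∨ x ≤ k) →
      ∀ p, (f z).wt p ≠ 0 → p ∈ Φ x) :
    ∃ g : PosetRealization K → PosetRealization P, ContinuousOn g (face (L ∪ V)) ∧
      Set.EqOn g f (face L) ∧ ∀ z ∈ face (L ∪ V), ∀ x ∈ V,
        (∀ k, z.wt k ≠ 0 → k ≤ x ∨ x ≤ k) → ∀ p, (g z).wt p ≠ 0 → p ∈ Φ x := by
  classical
  suffices h : ∀ T : Finset K, T ⊆ V → ∃ g : PosetRealization K → PosetRealization P,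
      ContinuousOn g (face (L ∪ T)) ∧ Set.EqOn g f (face L) ∧ ∀ z ∈ face (L ∪ T), ∀ x ∈ V,
        (∀ k, z.wt k ≠ 0 → k ≤ x ∨ x ≤ k) → ∀ p, (g z).wt p ≠ 0 → p ∈ Φ x from
    h V (Finset.Subset.refl V)
  intro T
  induction T using Finset.induction_on with
  | empty =>
    intro _
    refine ⟨f, ?_, fun _ _ => rfl, ?_⟩
    · simpa using hf
    · simpa using hcar
  | insert x T hxT ih =>
    intro hT
    obtain ⟨g, hg, hgf, hgΦ⟩ := ih ((Finset.subset_insert x T).trans hT)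
    have hxV : x ∈ V := hT (Finset.mem_insert_self x T)
    have hTV : ∀ y ∈ T, y ∈ V := fun y hy => hT (Finset.mem_insert_of_mem hy)
    obtain ⟨d, hd, hr⟩ := hrank x hxV
    have hxS : x ∉ L ∪ (T : Set K) := by
      rintro (h | h)
      · exact hLV x hxV h
      · exact hxT h
    have hr' : RankLT {y | y ∈ L ∪ (T : Set K) ∧ (y < x ∨ x < y)} d := by
      obtain ⟨ρ, hρ, hρd⟩ := hr
      refine ⟨fun y => ρ ⟨y.1, y.2.1.imp id (hTV y.1), y.2.2⟩, fun y y' h => hρ h, fun y => hρd _⟩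
    obtain ⟨g', hg', hgg', hgW⟩ := exists_extension_vertex hxS hd (hconn x hxV) hr' hg (by
      intro z hz p hp
      refine hgΦ z (fun k hk => (hz k hk).1) x hxV (fun k hk => ?_) p hp
      exact (hz k hk).2.imp le_of_lt le_of_lt)
    have hins : L ∪ ((insert x T : Finset K) : Set K) = insert x (L ∪ (T : Set K)) := by
      rw [Finset.coe_insert, Set.union_insert]
    rw [hins]
    refine ⟨g', hg', fun z hz => ?_, fun z hz y hy hzy p hp => ?_⟩
    · rw [hgg' z (by by_contra h; exact hLV x hxV (hz x h)), hgf hz]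
    · by_cases hzx : z.wt x = 0
      · rw [hgg' z hzx] at hp
        exact hgΦ z (fun k hk => (hz k hk).resolve_left fun h => hk (h ▸ hzx)) y hy hzy p hp
      · have : Φ x = Φ y := by
          rcases hzy x hzx with h | h
          · exact hΦ x hxV y hy h
          · exact (hΦ y hy x hxV h).symm
        rw [← this]
        exact hgW z hz hzx p hp

/-! ### Replacing a map near a set of vertices -/

/-- Simplicial approximation inside a subcomplex. -/
theorem exists_simplicial_approximation_in {K : Type} [PartialOrder K] [Fintype K] {d : ℕ}
    (hK : RankLT K d) {W : Set P} (f : C(PosetRealization K, PosetRealization P))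
    (hf : MapsInto W f) :
    ∃ (K' : Type) (_ : PartialOrder K') (_ : Fintype K') (φ : K' → P)
      (h : C(PosetRealization K, PosetRealization K'))
      (g : C(PosetRealization K', PosetRealization P)), RankLT K' d ∧ Monotone φ ∧
      (∀ k, φ k ∈ W) ∧ (∀ z, (g z).wt = z.wt.mapDomain φ) ∧
      (∀ x k, (h x).wt k ≠ 0 → (f x).wt (φ k) ≠ 0) ∧ HomotopicIn W f (g.comp h) := by
  obtain ⟨K', _, _, φ, h, hK', hφ, hφW, hh⟩ := exists_simplicial_approximation hK f
  have hφW : ∀ k, φ k ∈ W := fun k => by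
    obtain ⟨x, hx⟩ := hφW k
    exact hf x _ hx
  obtain ⟨g, hg⟩ := exists_push φ (hφ.monotoneOn Set.univ) (ContinuousMap.id _)
    (fun _ _ _ => Set.mem_univ _)
  refine ⟨K', inferInstance, inferInstance, φ, h, g, hK', hφ, hφW, hg, hh, homotopicIn_of_chain _ _ hf ?_ ?_⟩
  · intro x p hp
    obtain ⟨k, -, rfl⟩ := exists_of_wt_mapDomain_ne_zero (hg (h x)) hp
    exact hφW k
  · intro x p q hp hq
    obtain ⟨k, hk, rfl⟩ := exists_of_wt_mapDomain_ne_zero (hg (h x)) hq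
    exact (f x).wt_chain hp (hh x k hk)

/-- A point is the combination of its radial projections to the subcomplexes spanned by two
complementary sets of vertices. -/
theorem wt_eq_normalize {K : Type*} [PartialOrder K] [Fintype K] {S : Set K}
    {n n' : PosetRealization K → PosetRealization K}
    (hn : ∀ z, 0 < mass S z → ∀ k, (n z).wt k = S.indicator (fun k => z.wt k) k / mass S z)
    (hn' : ∀ z, 0 < mass Sᶜ z → ∀ k, (n' z).wt k = Sᶜ.indicator (fun k => z.wt k) k / mass Sᶜ z)
    (z : PosetRealization K) :
    z.wt = mass S z • (n z).wt + (1 - mass S z) • (n' z).wt := by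
  ext k
  have key : ∀ (T : Set K) (y : PosetRealization K),
      (0 < mass T z → y.wt k = T.indicator (fun k => z.wt k) k / mass T z) →
      mass T z * y.wt k = T.indicator (fun k => z.wt k) k := by
    intro T y h
    rcases (mass_nonneg T z).lt_or_eq with h0 | h0
    · rw [h h0]
      field_simp
    · rw [← h0, zero_mul, Set.indicator_apply_eq_zero.2 fun hk => wt_eq_zero_of_mass h0.symm hk]
  rw [Finsupp.add_apply, Finsupp.smul_apply, Finsupp.smul_apply, smul_eq_mul, smul_eq_mul,
    ← mass_compl, key S _ (fun h => hn z h k), key Sᶜ _ (fun h => hn' z h k),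
    Set.indicator_self_add_compl_apply]

/-- Let `f` be induced by the monotone function `φ`, let `f'` agree with `f` away from the
vertices in `E`, and assume that the values of `f'` on the star of `k ∈ E` are compatible with the
vertex `φ k`. Then `f` and `f'` are homotopic. After a deformation that makes `f` and `f'` agree on
a neighbourhood of the complement of `E`, both are contiguous to a map that takes on the weights of
the images of the vertices in `E` outside this neighbourhood. -/
theorem homotopicIn_of_replacement {K : Type*} [PartialOrder K] [Fintype K] {φ : K → P}
    (hφ : Monotone φ) (E : Set K) {W : Set P} (hφW : ∀ k, φ k ∈ W)
    (f f' : C(PosetRealization K, PosetRealization P)) (hf : ∀ z, (f z).wt = z.wt.mapDomain φ)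
    (hf'W : MapsInto W f') (heq : ∀ z ∈ face Eᶜ, f' z = f z)
    (hc : ∀ z z' : PosetRealization K, (∀ k, z'.wt k ≠ 0 → z.wt k ≠ 0) → ∀ k ∈ E, z.wt k ≠ 0 →
      ∀ p, (f' z').wt p ≠ 0 → p ≤ φ k ∨ φ k ≤ p) : HomotopicIn W f f' := by
  classical
  have hfW : MapsInto W f := fun z p hp => by
    obtain ⟨k, -, rfl⟩ := exists_of_wt_mapDomain_ne_zero (hf z) hp
    exact hφW k
  obtain ⟨n, hn, hnw⟩ := exists_normalize E
  obtain ⟨n', hn', hnw'⟩ := exists_normalize Eᶜ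
  set m : PosetRealization K → ℝ := fun z => mass E z with hm
  have hmc : Continuous m := continuous_mass E
  have hm0 : ∀ z, 0 ≤ m z := mass_nonneg E
  have hm1 : ∀ z, m z ≤ 1 := mass_le_one E
  have hn'c : ContinuousOn n' {z | m z < 1} := hn'.mono fun z hz => by
    have hz : m z < 1 := hz
    change 0 < mass Eᶜ z
    rw [mass_compl]
    exact sub_pos.2 hz
  have hsn : ∀ z, 0 < m z → ∀ k, (n z).wt k ≠ 0 → k ∈ E ∧ z.wt k ≠ 0 :=
    fun z hz k hk => wt_ne_zero_of_normalize (hnw z hz) hk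
  have hsn' : ∀ z, m z < 1 → ∀ k, (n' z).wt k ≠ 0 → k ∈ Eᶜ ∧ z.wt k ≠ 0 := fun z hz k hk =>
    wt_ne_zero_of_normalize (hnw' z (by rw [mass_compl]; exact sub_pos.2 hz)) hk
  -- `lam` collapses the points whose `E`-weight is at most `1 / 2` to the complement of `E`
  obtain ⟨lam, hlam⟩ := exists_comb (fun z => max 0 (2 * m z - 1)) (by fun_prop)
    (fun z => le_max_left _ _) (fun z => max_le zero_le_one (by linarith [hm1 z])) n n'
    (hn.mono fun z hz => by
      have hz : 0 < max 0 (2 * m z - 1) := hz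
      have : 0 < 2 * m z - 1 := (lt_max_iff.1 hz).resolve_left (lt_irrefl _)
      change 0 < m z
      linarith)
    (hn'c.mono fun z hz => by
      have hz : max 0 (2 * m z - 1) < 1 := hz
      change m z < 1
      linarith [(max_lt_iff.1 hz).2])
    Finset.univ (fun _ _ _ _ => Finset.mem_univ _) (fun _ _ _ _ => Finset.mem_univ _)
    (fun z hz hz' k l hk hl => by
      have h1 : 0 < 2 * m z - 1 := (lt_max_iff.1 hz).resolve_left (lt_irrefl _)
      have h2 := (max_lt_iff.1 hz').2
      exact z.wt_chain (hsn z (by linarith) k hk).2 (hsn' z (by linarith) l hl).2)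
  have hlamz : ∀ z k, (lam z).wt k ≠ 0 → z.wt k ≠ 0 := by
    intro z k hk
    rw [hlam] at hk
    have hk' : max 0 (2 * m z - 1) * (n z).wt k ≠ 0 ∨
        (1 - max 0 (2 * m z - 1)) * (n' z).wt k ≠ 0 := by
      by_contra! h
      exact hk (by rw [h.1, h.2, add_zero])
    rcases hk' with h | h
    · have h1 := (lt_max_iff.1 ((le_max_left 0 (2 * m z - 1)).lt_of_ne'
        (left_ne_zero_of_mul h))).resolve_left (lt_irrefl _)
      exact (hsn z (by linarith) k (right_ne_zero_of_mul h)).2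
    · have h1 : m z < 1 := by
        refine (hm1 z).lt_of_ne fun h1 => left_ne_zero_of_mul h ?_
        rw [h1]
        norm_num
      exact (hsn' z h1 k (right_ne_zero_of_mul h)).2
  have hlamE : ∀ z, m z ≤ 1 / 2 → lam z ∈ face Eᶜ := by
    intro z hz k hk
    rw [hlam, max_eq_left (by linarith), zero_mul, zero_add, sub_zero, one_mul] at hk
    exact (hsn' z (by linarith) k hk).1
  have hlamid : (ContinuousMap.id _).Homotopic lam := by
    obtain ⟨H⟩ := homotopicIn_of_chain (W := Set.univ) (ContinuousMap.id _) lam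
      (fun _ _ _ => Set.mem_univ _) (fun _ _ _ => Set.mem_univ _)
      (fun z k l hk hl => z.wt_chain hk (hlamz z l hl))
    exact ⟨H.toHomotopy⟩
  have hsf : ∀ (z z' : PosetRealization K) (p : P), (∀ k, z'.wt k ≠ 0 → z.wt k ≠ 0) → (f z').wt p ≠ 0 →
      ∃ k, z.wt k ≠ 0 ∧ φ k = p := by
    intro z z' p h hp
    obtain ⟨k, hk, rfl⟩ := exists_of_wt_mapDomain_ne_zero (hf z') hp
    exact ⟨k, h k hk, rfl⟩
  obtain ⟨S, hS⟩ := exists_finset_of_compact f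
  obtain ⟨S', hS'⟩ := exists_finset_of_compact f'
  have hθ : ∀ z, 0 < min 1 (2 * m z) → 0 < m z := fun z hz => by
    linarith [(lt_min_iff.1 hz).2]
  have hfn : ∀ z, 0 < m z → ∀ p, (f (n z)).wt p ≠ 0 → ∃ k ∈ E, z.wt k ≠ 0 ∧ φ k = p := by
    intro z hz p hp
    obtain ⟨k, hk, rfl⟩ := exists_of_wt_mapDomain_ne_zero (hf (n z)) hp
    exact ⟨k, (hsn z hz k hk).1, (hsn z hz k hk).2, rfl⟩
  obtain ⟨F, hF⟩ := exists_comb (fun z => min 1 (2 * m z)) (by fun_prop)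
    (fun z => le_min zero_le_one (by linarith [hm0 z])) (fun z => min_le_left _ _)
    (fun z => f (n z)) (fun z => f' (lam z))
    (f.continuous.comp_continuousOn (hn.mono hθ)) (by fun_prop) (S ∪ S')
    (fun z p _ hp => Finset.mem_union_left _ (hS _ p hp))
    (fun z p _ hp => Finset.mem_union_right _ (hS' _ p hp))
    (fun z hz _ p q hp hq => by
      obtain ⟨k, hkE, hk, rfl⟩ := hfn z (hθ z hz) p hp
      exact (hc z (lam z) (hlamz z) k hkE hk q hq).symm)
  have hFs : ∀ z p, (F z).wt p ≠ 0 →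
      (∃ k ∈ E, z.wt k ≠ 0 ∧ φ k = p) ∨ (f' (lam z)).wt p ≠ 0 := by
    intro z p hp
    by_contra! h
    refine hp ?_
    rw [hF, h.2, mul_zero, add_zero]
    by_cases hz : 0 < m z
    · have : (f (n z)).wt p = 0 := by
        by_contra hp
        obtain ⟨k, hkE, hk, hkp⟩ := hfn z hz p hp
        exact h.1 k hkE hk hkp
      rw [this, mul_zero]
    · rw [le_antisymm (not_lt.1 hz) (hm0 z)]
      norm_num
  have hFW : MapsInto W F := by
    intro z p hp
    rcases hFs z p hp with ⟨k, -, -, rfl⟩ | h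
    · exact hφW k
    · exact hf'W _ p h
  have hFs' : ∀ z p, (F z).wt p ≠ 0 → ∃ k, z.wt k ≠ 0 ∧ φ k = p := by
    intro z p hp
    rcases hFs z p hp with ⟨k, -, hk, hkp⟩ | h
    · exact ⟨k, hk, hkp⟩
    rcases le_total (m z) (1 / 2) with hz | hz
    · rw [heq _ (hlamE z hz)] at h
      exact hsf z _ p (hlamz z) h
    · rw [hF, min_eq_left (by linarith), sub_self, zero_mul, add_zero, one_mul] at hp
      obtain ⟨k, -, hk, hkp⟩ := hfn z (by linarith) p hp
      exact ⟨k, hk, hkp⟩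
  have h1 : HomotopicIn W f (f.comp lam) := HomotopicIn.comp_left hlamid f hfW
  have h2 : HomotopicIn W (f.comp lam) F := by
    refine homotopicIn_of_chain _ _ (fun z p hp => hfW _ p hp) hFW fun z p q hp hq => ?_
    obtain ⟨k, hk, rfl⟩ := hsf z (lam z) p (hlamz z) hp
    obtain ⟨l, hl, rfl⟩ := hFs' z q hq
    exact (z.wt_chain hk hl).imp (fun h => hφ h) (fun h => hφ h)
  have h3 : HomotopicIn W F (f'.comp lam) := by
    refine homotopicIn_of_chain _ _ hFW (fun z p hp => hf'W _ p hp) fun z p q hp hq => ?_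
    rcases hFs z p hp with ⟨k, hkE, hk, rfl⟩ | h
    · exact (hc z (lam z) (hlamz z) k hkE hk q hq).symm
    · exact (f' (lam z)).wt_chain h hq
  have h4 : HomotopicIn W f' (f'.comp lam) := HomotopicIn.comp_left hlamid f' hf'W
  exact ((h1.trans h2).trans h3).trans h4.symm

/-! ### Adding and removing elements with highly connected links -/

/-- A map induced by a monotone function can be pushed off an antichain of vertices with highly
connected links. -/
theorem exists_push_off {A T : Set P} (hT : ∀ x ∈ T, ∀ y ∈ T, x ≤ y → x = y)
    (hAT : ∀ x ∈ T, x ∉ A) {c : ℕ} (hlk : ∀ t ∈ T, Conn c {p | p ∈ A ∧ (p < t ∨ t < p)})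
    {K : Type} [PartialOrder K] [Fintype K] (hK : RankLT K c) {φ : K → P} (hφ : Monotone φ)
    (hφW : ∀ k, φ k ∈ A ∪ T) (f : C(PosetRealization K, PosetRealization P))
    (hf : ∀ z, (f z).wt = z.wt.mapDomain φ) :
    ∃ f' : C(PosetRealization K, PosetRealization P), MapsInto A f' ∧
      (∀ z ∈ face {k | φ k ∈ A}, f' z = f z) ∧
      ∀ z x, φ x ∈ T → (∀ k, z.wt k ≠ 0 → k ≤ x ∨ x ≤ k) →
        ∀ p, (f' z).wt p ≠ 0 → p ∈ A ∧ (p < φ x ∨ φ x < p) := by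
  classical
  obtain ⟨ρ, hρ, hρc⟩ := hK
  let V : Finset K := Finset.univ.filter fun x => φ x ∈ T
  have hV : ∀ x, x ∈ V ↔ φ x ∈ T := fun x => by simp [V]
  obtain ⟨g, hg, hgf, hgΦ⟩ := exists_carried_extension (L := {k | φ k ∈ A}) (V := V)
    (fun x hx => hAT _ ((hV x).1 hx)) (c := c) (fun x => {p | p ∈ A ∧ (p < φ x ∨ φ x < p)})
    (fun x hx y hy hxy => by
      rw [hT _ ((hV x).1 hx) _ ((hV y).1 hy) (hφ hxy)])
    (fun x hx => hlk _ ((hV x).1 hx))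
    (fun x hx => ⟨c - 1, by have := hρc x; omega,
      rankLT_link hρ (hρc x) fun y hy => ⟨hy.2, hρc y⟩⟩)
    (f := f) f.continuous.continuousOn (by
      intro z hz x hx hzx p hp
      obtain ⟨k, hk, rfl⟩ := exists_of_wt_mapDomain_ne_zero (hf z) hp
      have hkA : φ k ∈ A := hz k hk
      have hne : φ k ≠ φ x := fun h => hAT _ ((hV x).1 hx) (h ▸ hkA)
      exact ⟨hkA, (hzx k hk).imp (fun h => (hφ h).lt_of_ne hne) fun h => (hφ h).lt_of_ne' hne⟩)
  have huniv : face ({k | φ k ∈ A} ∪ (V : Set K)) = Set.univ :=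
    Set.eq_univ_of_forall fun z k _ => (hφW k).imp id fun h => (hV k).2 h
  rw [huniv] at hg hgΦ
  rw [continuousOn_univ] at hg
  refine ⟨⟨g, hg⟩, fun z p hp => ?_, hgf, fun z x hx hzx p hp =>
    hgΦ z (Set.mem_univ _) x ((hV x).2 hx) hzx p hp⟩
  by_cases hz : z ∈ face {k | φ k ∈ A}
  · change (g z).wt p ≠ 0 at hp
    rw [hgf hz] at hp
    obtain ⟨k, hk, rfl⟩ := exists_of_wt_mapDomain_ne_zero (hf z) hp
    exact hz k hk
  · simp only [face, Set.mem_ofPred_eq, not_forall] at hz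
    obtain ⟨x, hx, hxA⟩ := hz
    exact (hgΦ z (Set.mem_univ _) x ((hV x).2 ((hφW x).resolve_left hxA))
      (fun k hk => z.wt_chain hk hx) p hp).1

/-- Attaching an antichain `T`: a map to the union is pushed off `T`, which changes it by a homotopy
by `homotopicIn_of_replacement`. -/
theorem Conn.union_antichain {A T : Set P} {c : ℕ} (hA : Conn (c + 1) A)
    (hT : ∀ x ∈ T, ∀ y ∈ T, x ≤ y → x = y) (hAT : ∀ x ∈ T, x ∉ A)
    (hlk : ∀ t ∈ T, Conn c {p | p ∈ A ∧ (p < t ∨ t < p)}) : Conn (c + 1) (A ∪ T) := by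
  intro d hd K _ _ hK f hf
  obtain ⟨K', _, _, φ, h, g, hK', hφ, hφW, hg, -, H⟩ :=
    exists_simplicial_approximation_in hK f hf
  obtain ⟨f', hf'A, hf'eq, hf'c⟩ :=
    exists_push_off hT hAT hlk (hK'.mono (by omega)) hφ hφW g hg
  obtain ⟨q, hq, H'⟩ := hA d hd K' hK' f' hf'A
  refine ⟨q, fun p hp => Or.inl (hq p hp), H.trans ?_⟩
  have H1 : HomotopicIn (A ∪ T) g f' := by
    refine homotopicIn_of_replacement hφ {k | φ k ∈ T} hφW g f' hg
      (fun z p hp => Or.inl (hf'A z p hp)) (fun z hz => ?_) ?_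
    · exact hf'eq z fun k hk => (hφW k).resolve_right (hz k hk)
    · intro z z' hzz k hk hkz p hp
      exact (hf'c z' k hk (fun l hl => z.wt_chain (hzz l hl) hkz) p hp).2.imp le_of_lt le_of_lt
  exact HomotopicIn.comp (H1.trans (H'.mono Set.subset_union_left)) h

/-- Removing an antichain `T`: a null-homotopy in the union is regarded as an extension over a cone,
which is pushed off `T`. -/
theorem Conn.of_union_antichain {A T : Set P} {c : ℕ} (hW : Conn c (A ∪ T))
    (hT : ∀ x ∈ T, ∀ y ∈ T, x ≤ y → x = y) (hAT : ∀ x ∈ T, x ∉ A)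
    (hlk : ∀ t ∈ T, Conn c {p | p ∈ A ∧ (p < t ∨ t < p)}) : Conn c A := by
  classical
  intro d hd K _ _ hK f hf
  -- extend `f` over the cone, with values in `A ∪ T`
  obtain ⟨ρ, hρ, hρd⟩ := hK
  let ρ' : WithTop K → ℕ := fun k => WithTop.recTopCoe d ρ k
  have hρ' : StrictMono ρ' := by
    intro k l hkl
    induction k using WithTop.recTopCoe with
    | top => exact absurd hkl not_top_lt
    | coe k =>
      induction l using WithTop.recTopCoe with
      | top => exact hρd k
      | coe l => exact hρ (WithTop.coe_lt_coe.1 hkl)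
  have hρ'd : ∀ k, ρ' k < d + 1 := by
    intro k
    induction k using WithTop.recTopCoe with
    | top => exact Nat.lt_succ_self d
    | coe k => exact (hρd k).trans (Nat.lt_succ_self d)
  let L : Set (WithTop K) := Set.range ((↑) : K → WithTop K)
  obtain ⟨j, hj⟩ := exists_push (W := Set.univ) ((↑) : K → WithTop K)
    (WithTop.coe_mono.monotoneOn _) (ContinuousMap.id _) (fun _ _ _ => Set.mem_univ _)
  have hjL : ∀ y, j y ∈ face L := fun y k hk => by
    obtain ⟨l, -, rfl⟩ := exists_of_wt_mapDomain_ne_zero (hj y) hk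
    exact ⟨l, rfl⟩
  have hLsum : ∀ z : face L, ∑ k : K, z.1.wt (k : WithTop K) = 1 := by
    intro z
    have h0 : z.1.wt ⊤ = 0 := by
      by_contra h
      obtain ⟨k, hk⟩ := z.2 ⊤ h
      exact WithTop.coe_ne_top hk
    rw [← z.1.sum_wt_univ]
    refine (Finset.sum_of_injOn ((↑) : K → WithTop K) (WithTop.coe_injective.injOn)
      (fun _ _ => Finset.mem_univ _) (fun k _ hk => ?_) fun _ _ => rfl)
    by_contra h
    obtain ⟨l, hl⟩ := z.2 k h
    exact hk ⟨l, Finset.mem_coe.2 (Finset.mem_univ l), hl⟩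
  obtain ⟨r, hr⟩ := exists_continuousMap (Z := face L) (P := K)
    (fun z k => z.1.wt (k : WithTop K)) Finset.univ (fun _ _ _ => Finset.mem_univ _)
    (fun _ _ => wt_nonneg _ _) hLsum
    (fun z k l hk hl => (z.1.wt_chain hk hl).imp WithTop.coe_le_coe.1 WithTop.coe_le_coe.1)
    (fun k => (continuous_wt _).comp continuous_subtype_val)
  have hrj : ∀ y, r ⟨j y, hjL y⟩ = y := by
    intro y
    refine ext_wt fun k => ?_
    rw [hr]
    change (j y).wt (k : WithTop K) = _
    rw [hj]
    exact Finsupp.mapDomain_apply WithTop.coe_injective _ k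
  obtain ⟨q₀, -⟩ := hW.exists_point (by omega)
  let f₁ : PosetRealization (WithTop K) → PosetRealization P := fun z =>
    if h : z ∈ face L then f (r ⟨z, h⟩) else q₀
  have hf₁ : ∀ z (hz : z ∈ face L), f₁ z = f (r ⟨z, hz⟩) := fun z hz => dif_pos hz
  have hf₁c : ContinuousOn f₁ (face L) := by
    rw [continuousOn_iff_continuous_domRestrict]
    exact (f.continuous.comp r.continuous).congr fun z => (hf₁ z.1 z.2).symm
  have htop : ∀ (z : PosetRealization (WithTop K)) k, z.wt k ≠ 0 → k ≤ ⊤ ∨ ⊤ ≤ k :=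
    fun _ _ _ => Or.inl le_top
  obtain ⟨g, hg, hgf, hgW⟩ := exists_carried_extension (L := L) (V := {⊤})
    (fun x hx => by
      rw [Finset.mem_singleton.1 hx]
      rintro ⟨k, hk⟩
      exact WithTop.coe_ne_top hk) (c := c) (fun _ => A ∪ T) (fun _ _ _ _ _ => rfl)
    (fun _ _ => hW) (fun x _ => ⟨d, hd, rankLT_link hρ' (hρ'd x) fun y hy => ⟨hy.2, hρ'd y⟩⟩)
    hf₁c (by
      intro z hz x _ _ p hp
      rw [hf₁ z hz] at hp
      exact Or.inl (hf _ p hp))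
  have huniv : face (L ∪ (({⊤} : Finset (WithTop K)) : Set (WithTop K))) = Set.univ := by
    refine Set.eq_univ_of_forall fun z k _ => ?_
    induction k using WithTop.recTopCoe with
    | top => exact Or.inr (by simp)
    | coe k => exact Or.inl ⟨k, rfl⟩
  rw [huniv] at hg hgW
  rw [continuousOn_univ] at hg
  -- push a simplicial approximation of the extension off `T`
  obtain ⟨K', _, _, φ, h, G, hK', hφ, hφW, hG, hh, -⟩ :=
    exists_simplicial_approximation_in ⟨ρ', hρ', hρ'd⟩ (W := A ∪ T) ⟨g, hg⟩
    (fun z p hp => hgW z (Set.mem_univ _) ⊤ (Finset.mem_singleton_self _) (htop z) p hp)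
  obtain ⟨f', hf'A, hf'eq, -⟩ := exists_push_off hT hAT hlk (hK'.mono hd) hφ hφW G hG
  have hgj : ∀ y, g (j y) = f y := fun y => by
    rw [hgf (hjL y), hf₁ _ (hjL y), hrj]
  have hhA : ∀ y k, (h (j y)).wt k ≠ 0 → (f y).wt (φ k) ≠ 0 := fun y k hk => by
    rw [← hgj]
    exact hh (j y) k hk
  have H1 : HomotopicIn A f ((f'.comp h).comp j) := by
    refine homotopicIn_of_chain _ _ hf (fun y p hp => hf'A _ p hp) fun y p q hp hq => ?_
    change (f' (h (j y))).wt q ≠ 0 at hq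
    rw [hf'eq _ fun k hk => hf y _ (hhA y k hk)] at hq
    obtain ⟨k, hk, rfl⟩ := exists_of_wt_mapDomain_ne_zero (hG _) hq
    exact (f y).wt_chain hp (hhA y k hk)
  obtain ⟨v, hv⟩ := exists_vertex (⊤ : WithTop K)
  have H2 : j.Homotopic (ContinuousMap.const _ v) := by
    obtain ⟨H⟩ := homotopicIn_of_chain (W := Set.univ) j (ContinuousMap.const _ v)
      (fun _ _ _ => Set.mem_univ _) (fun _ _ _ => Set.mem_univ _)
      (fun y k l _ hl => Or.inl (hv l hl ▸ le_top))
    exact ⟨H.toHomotopy⟩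
  refine ⟨f' (h v), hf'A _, H1.trans ?_⟩
  exact HomotopicIn.comp_left H2 (f'.comp h) (fun z p hp => hf'A _ p hp)

/-- Attaching elements, in the order given by the values of `h`, along highly connected links. -/
theorem Conn.attach {A W : Set P} {c : ℕ} (hA : Conn (c + 1) A) (hAW : A ⊆ W) (h : P → ℕ)
    (hh : ∀ x ∈ W, x ∉ A → ∀ y ∈ W, y ∉ A → h x = h y → x ≤ y → x = y)
    (hlk : ∀ t ∈ W, t ∉ A → Conn c {p | (p ∈ W ∧ (p ∈ A ∨ h p < h t)) ∧ (p < t ∨ t < p)}) :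
    Conn (c + 1) W := by
  have key : ∀ i, Conn (c + 1) {p | p ∈ W ∧ (p ∈ A ∨ h p < i)} := by
    intro i
    induction i with
    | zero =>
      convert hA using 1
      ext p
      simpa using fun hp => hAW hp
    | succ i ih =>
      have e : {p | p ∈ W ∧ (p ∈ A ∨ h p < i + 1)} =
          {p | p ∈ W ∧ (p ∈ A ∨ h p < i)} ∪ {p | p ∈ W ∧ p ∉ A ∧ h p = i} := by
        ext p
        simp only [Set.mem_ofPred_eq, Set.mem_union, Nat.lt_succ_iff_lt_or_eq]
        tauto
      rw [e]
      refine ih.union_antichain ?_ ?_ ?_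
      · rintro x ⟨hx, hxA, hxi⟩ y ⟨hy, hyA, hyi⟩ hxy
        exact hh x hx hxA y hy hyA (hxi.trans hyi.symm) hxy
      · rintro x ⟨hx, hxA, hxi⟩ ⟨-, h | h⟩
        · exact hxA h
        · omega
      · rintro t ⟨ht, htA, rfl⟩
        exact hlk t ht htA
  intro d hd K _ _ hK f hf
  obtain ⟨S, hS⟩ := exists_finset_of_compact f
  obtain ⟨q, hq, H⟩ := key (S.sup h + 1) d hd K hK f fun z p hp =>
    ⟨hf z p hp, Or.inr (Nat.lt_succ_of_le (Finset.le_sup (f := h) (hS z p hp)))⟩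
  exact ⟨q, fun p hp => (hq p hp).1, H.mono fun p hp => hp.1⟩

/-- Removing elements, in the order given by the values of `h`, along highly connected links. -/
theorem Conn.detach {A W : Set P} {c : ℕ} (hW : Conn c W) (hAW : A ⊆ W) (h : P → ℕ) (B : ℕ)
    (hB : ∀ x ∈ W, x ∉ A → h x < B)
    (hh : ∀ x ∈ W, x ∉ A → ∀ y ∈ W, y ∉ A → h x = h y → x ≤ y → x = y)
    (hlk : ∀ t ∈ W, t ∉ A → Conn c {p | (p ∈ W ∧ (p ∈ A ∨ h t < h p)) ∧ (p < t ∨ t < p)}) :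
    Conn c A := by
  have key : ∀ i, Conn c {p | p ∈ W ∧ (p ∈ A ∨ i ≤ h p)} := by
    intro i
    induction i with
    | zero =>
      convert hW using 1
      ext p
      simp
    | succ i ih =>
      have e : {p | p ∈ W ∧ (p ∈ A ∨ i ≤ h p)} =
          {p | p ∈ W ∧ (p ∈ A ∨ i + 1 ≤ h p)} ∪ {p | p ∈ W ∧ p ∉ A ∧ h p = i} := by
        ext p
        simp only [Set.mem_ofPred_eq, Set.mem_union, Nat.succ_le_iff, le_iff_lt_or_eq (a := i)]
        tauto
      rw [e] at ih
      refine ih.of_union_antichain ?_ ?_ ?_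
      · rintro x ⟨hx, hxA, hxi⟩ y ⟨hy, hyA, hyi⟩ hxy
        exact hh x hx hxA y hy hyA (hxi.trans hyi.symm) hxy
      · rintro x ⟨hx, hxA, hxi⟩ ⟨-, h | h⟩
        · exact hxA h
        · omega
      · rintro t ⟨ht, htA, rfl⟩
        exact hlk t ht htA
  convert key B using 1
  ext p
  refine ⟨fun hp => ⟨hAW hp, Or.inl hp⟩, fun hp => ?_⟩
  by_contra hpA
  have := hB p hp.1 hpA
  have := hp.2.resolve_left hpA
  omega

/-! ### Joins -/

/-- The join of highly connected posets is highly connected. Given a map from a complex of dimension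
at most `a + b - 2`, it is first deformed so that the full subcomplex on the vertices of rank less
than `a` is mapped to `A`; the remaining vertices span a complex of dimension at most `b - 2`, whose
image in `B` can be contracted. -/
theorem Conn.join {A B : Set P} (hAB : ∀ p ∈ A, ∀ q ∈ B, p < q) {a b : ℕ} (hA : Conn a A)
    (hB : Conn b B) : Conn (a + b) (A ∪ B) := by
  classical
  have hdisj : ∀ p ∈ A, p ∉ B := fun p hp hp' => lt_irrefl p (hAB p hp p hp')
  intro d hd K _ _ hK f hf
  obtain ⟨K', _, _, φ, h, G, ⟨ρ, hρ, hρd⟩, hφ, hφW, hG, -, H⟩ :=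
    exists_simplicial_approximation_in hK f hf
  suffices hs : ∃ q : PosetRealization P, (∀ p, q.wt p ≠ 0 → p ∈ A ∪ B) ∧
      HomotopicIn (A ∪ B) G (ContinuousMap.const _ q) by
    obtain ⟨q, hq, H'⟩ := hs
    exact ⟨q, hq, H.trans (H'.comp h)⟩
  -- extend `G` from the part over `A` over the vertices of rank less than `a` that lie over `B`
  let L : Set K' := {k | φ k ∈ A}
  let V : Finset K' := Finset.univ.filter fun k => φ k ∈ B ∧ ρ k < a
  have hV : ∀ k, k ∈ V ↔ φ k ∈ B ∧ ρ k < a := fun k => by simp [V]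
  have hGs : ∀ z p, (G z).wt p ≠ 0 → ∃ k, z.wt k ≠ 0 ∧ φ k = p := fun z p hp =>
    exists_of_wt_mapDomain_ne_zero (hG z) hp
  have hGL : ∀ z ∈ face L, ∀ p, (G z).wt p ≠ 0 → p ∈ A := by
    intro z hz p hp
    obtain ⟨k, hk, rfl⟩ := hGs z p hp
    exact hz k hk
  obtain ⟨gA, hgA, hgAG, hgAc⟩ := exists_carried_extension (L := L) (V := V)
    (fun x hx hxL => hdisj _ hxL ((hV x).1 hx).1) (fun _ => A) (fun _ _ _ _ _ => rfl)
    (fun _ _ => hA)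
    (fun x hx => by
      have hx' := (hV x).1 hx
      refine ⟨a - 1, by omega, rankLT_link hρ hx'.2 ?_⟩
      rintro y ⟨hy, hyx⟩
      refine ⟨hyx, ?_⟩
      rcases hyx with h | h
      · exact (hρ h).trans hx'.2
      · rcases hy with hy | hy
        · exact absurd (hφ h.le) (hAB _ hy _ hx'.1).not_ge
        · exact ((hV y).1 hy).2)
    (f := G) G.continuous.continuousOn (fun z hz _ _ _ p hp => hGL z hz p hp)
  set S : Set K' := L ∪ (V : Set K') with hS
  have hgAA : ∀ z ∈ face S, ∀ p, (gA z).wt p ≠ 0 → p ∈ A := by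
    intro z hz p hp
    by_cases hzL : z ∈ face L
    · rw [hgAG hzL] at hp
      exact hGL z hzL p hp
    · simp only [face, Set.mem_ofPred_eq, not_forall] at hzL
      obtain ⟨x, hx, hxL⟩ := hzL
      exact hgAc z hz x ((hz x hx).resolve_left hxL) (fun k hk => z.wt_chain hk hx) p hp
  have hSc : ∀ k, k ∉ S → φ k ∈ B ∧ a ≤ ρ k := by
    intro k hk
    have h1 : φ k ∈ B := (hφW k).resolve_left fun h => hk (Or.inl h)
    refine ⟨h1, ?_⟩
    by_contra! h2
    exact hk (Or.inr ((hV k).2 ⟨h1, h2⟩))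
  have hEL : ∀ z ∈ face (V : Set K')ᶜ, ∀ k ∈ S, z.wt k ≠ 0 → k ∈ L := fun z hz k hkS hk =>
    hkS.resolve_right (hz k hk)
  by_cases hda : d < a
  · -- all of the source has small dimension
    have hSu : face S = Set.univ := Set.eq_univ_of_forall fun z k _ => by
      by_contra hk
      have := (hSc k hk).2
      have := hρd k
      omega
    have hgAc : Continuous gA := by
      rw [hSu] at hgA
      exact continuousOn_univ.1 hgA
    have hmem : ∀ z, z ∈ face S := fun z => hSu ▸ Set.mem_univ z
    obtain ⟨q, hq, H'⟩ := hA d hda K' ⟨ρ, hρ, hρd⟩ ⟨gA, hgAc⟩ fun z => hgAA z (hmem z)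
    refine ⟨q, fun p hp => Or.inl (hq p hp), ?_⟩
    refine ContinuousMap.HomotopicWith.trans ?_ (H'.mono Set.subset_union_left)
    refine homotopicIn_of_replacement hφ (V : Set K') hφW G ⟨gA, hgAc⟩ hG
      (fun z p hp => Or.inl (hgAA z (hmem z) p hp)) ?_ ?_
    · intro z hz
      exact hgAG fun k hk => hEL z hz k (hmem z k hk) hk
    · intro z z' _ k hk _ p hp
      exact Or.inl (hAB p (hgAA z' (hmem z') p hp) _ ((hV k).1 hk).1).le
  · have hrB : RankLT (Sᶜ : Set K') (d - a) := by
      refine ⟨fun k => ρ k - a, fun k l hkl => ?_, fun k => ?_⟩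
      · have h1 := (hSc k k.2).2
        have h2 : ρ k < ρ l := hρ hkl
        dsimp only
        omega
      · have h1 := (hSc k k.2).2
        have h2 := hρd k
        dsimp only
        omega
    have hGB : ∀ z ∈ face Sᶜ, ∀ p, (G z).wt p ≠ 0 → p ∈ B := by
      intro z hz p hp
      obtain ⟨k, hk, rfl⟩ := hGs z p hp
      exact (hSc k (hz k hk)).1
    obtain ⟨q, N, hq, hN, hN0, hN1, hNB⟩ := exists_nullhomotopy_on (c := b) (by omega) hrB hB
      G.continuous.continuousOn hGB
    obtain ⟨n, hn, hnw⟩ := exists_normalize S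
    obtain ⟨n', hn', hnw'⟩ := exists_normalize Sᶜ
    have hnS : ∀ z, 0 < mass S z → n z ∈ face S := fun z hz k hk =>
      (wt_ne_zero_of_normalize (hnw z hz) hk).1
    have hpos : ∀ z : PosetRealization K', mass S z < 1 → 0 < mass Sᶜ z := fun z hz => by
      rw [mass_compl]
      exact sub_pos.2 hz
    have hnS' : ∀ z, mass S z < 1 → n' z ∈ face Sᶜ := fun z hz k hk =>
      (wt_ne_zero_of_normalize (hnw' z (hpos z hz)) hk).1
    obtain ⟨F₁, hF₁⟩ := exists_finset_of_continuousOn (isClosed_face S).isCompact hgA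
    obtain ⟨F₂, hF₂⟩ := exists_finset_of_continuousOn
      (isCompact_univ.prod (isClosed_face Sᶜ).isCompact) hN
    -- the homotopy that contracts the part in `B`
    obtain ⟨J, hJ⟩ := exists_comb (Z := unitInterval × PosetRealization K')
      (fun x => mass S x.2) ((continuous_mass S).comp continuous_snd)
      (fun x => mass_nonneg S x.2) (fun x => mass_le_one S x.2) (fun x => gA (n x.2))
      (fun x => N (x.1, n' x.2))
      (hgA.comp (hn.comp continuous_snd.continuousOn fun x hx => hx) fun x hx => hnS x.2 hx)
      (hN.comp (continuous_fst.continuousOn.prodMk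
        (hn'.comp continuous_snd.continuousOn fun x hx => hpos x.2 hx))
        fun x hx => ⟨Set.mem_univ _, hnS' x.2 hx⟩)
      (F₁ ∪ F₂) (fun x p hx hp => Finset.mem_union_left _ (hF₁ _ (hnS _ hx) p hp))
      (fun x p hx hp => Finset.mem_union_right _
        (hF₂ (x.1, n' x.2) ⟨Set.mem_univ _, hnS' _ hx⟩ p hp))
      (fun x hx hx' p p' hp hp' => Or.inl
        (hAB p (hgAA _ (hnS _ hx) p hp) p' (hNB _ _ (hnS' _ hx') p' hp')).le)
    have hJs : ∀ x p, (J x).wt p ≠ 0 → p ∈ A ∨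
        (mass S x.2 < 1 ∧ (N (x.1, n' x.2)).wt p ≠ 0) := by
      intro x p hp
      by_contra! hcon
      refine hp ?_
      have e1 : mass S x.2 * (gA (n x.2)).wt p = 0 := by
        rcases (mass_nonneg S x.2).lt_or_eq with h | h
        · rw [mul_eq_zero]
          right
          by_contra hp'
          exact hcon.1 (hgAA _ (hnS _ h) p hp')
        · rw [← h, zero_mul]
      have e2 : (1 - mass S x.2) * (N (x.1, n' x.2)).wt p = 0 := by
        rcases (mass_le_one S x.2).lt_or_eq with h | h
        · rw [hcon.2 h, mul_zero]
        · rw [h, sub_self, zero_mul]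
      rw [hJ, e1, e2, add_zero]
    have hJW : ∀ x p, (J x).wt p ≠ 0 → p ∈ A ∪ B := by
      intro x p hp
      rcases hJs x p hp with h | ⟨h1, h2⟩
      · exact Or.inl h
      · exact Or.inr (hNB _ _ (hnS' _ h1) p h2)
    let f' : C(PosetRealization K', PosetRealization P) := ⟨fun z => J (0, z), by fun_prop⟩
    let f'' : C(PosetRealization K', PosetRealization P) := ⟨fun z => J (1, z), by fun_prop⟩
    have H1 : HomotopicIn (A ∪ B) G f' := by
      refine homotopicIn_of_replacement hφ (V : Set K') hφW G f' hG (fun z => hJW (0, z)) ?_ ?_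
      · intro z hz
        refine ext_wt fun p => ?_
        have e := wt_eq_normalize hnw hnw' z
        have e' : (G z).wt = mass S z • (G (n z)).wt + (1 - mass S z) • (G (n' z)).wt := by
          rw [hG, hG, hG, ← Finsupp.mapDomain_smul, ← Finsupp.mapDomain_smul,
            ← Finsupp.mapDomain_add, ← e]
        change (J (0, z)).wt p = _
        rw [hJ, e']
        simp only [Finsupp.add_apply, Finsupp.smul_apply, smul_eq_mul]
        congr 1
        · rcases (mass_nonneg S z).lt_or_eq with h | h
          · rw [hgAG (x := n z) fun k hk => hEL z hz k ?_ ?_]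
            · exact (wt_ne_zero_of_normalize (hnw z h) hk).1
            · exact (wt_ne_zero_of_normalize (hnw z h) hk).2
          · rw [← h, zero_mul, zero_mul]
        · rcases (mass_le_one S z).lt_or_eq with h | h
          · rw [hN0 _ (hnS' z h)]
          · rw [h, sub_self, zero_mul, zero_mul]
      · intro z z' hzz k hk hkz p hp
        rcases hJs (0, z') p hp with h | ⟨h1, h2⟩
        · exact Or.inl (hAB p h _ ((hV k).1 hk).1).le
        · change (N (0, n' z')).wt p ≠ 0 at h2
          rw [hN0 _ (hnS' z' h1)] at h2
          obtain ⟨l, hl, rfl⟩ := hGs _ p h2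
          have hl' := (wt_ne_zero_of_normalize (hnw' z' (hpos z' h1)) hl).2
          exact (z.wt_chain (hzz l hl') hkz).imp (fun h => hφ h) fun h => hφ h
    have H2 : HomotopicIn (A ∪ B) f' f'' :=
      ⟨⟨⟨J, fun _ => rfl, fun _ => rfl⟩, fun t z => hJW (t, z)⟩⟩
    have H3 : HomotopicIn (A ∪ B) f'' (ContinuousMap.const _ q) := by
      refine homotopicIn_of_chain _ _ (fun z => hJW (1, z)) (fun z p hp => Or.inr (hq p hp)) ?_
      intro z p p' hp hp'
      rcases hJs (1, z) p hp with h | ⟨h1, h2⟩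
      · exact Or.inl (hAB p h p' (hq p' hp')).le
      · change (N (1, n' z)).wt p ≠ 0 at h2
        rw [hN1 _ (hnS' z h1)] at h2
        exact q.wt_chain h2 hp'
    exact ⟨q, fun p hp => Or.inr (hq p hp), (H1.trans H2).trans H3⟩

/-- A non-empty set is `(-1)`-connected. -/
theorem conn_one {W : Set P} (hW : W.Nonempty) : Conn 1 W := by
  obtain ⟨p, hp⟩ := hW
  obtain ⟨q, hq⟩ := exists_vertex p
  rintro d hd K _ _ ⟨ρ, -, hρ⟩ f hf
  have hK : ∀ z : PosetRealization K, False := fun z => by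
    obtain ⟨k, -⟩ := z.exists_wt_ne_zero
    have := hρ k
    omega
  exact ⟨q, fun r hr => hq r hr ▸ hp,
    homotopicIn_of_chain _ _ (fun z => (hK z).elim) (fun z => (hK z).elim) fun z => (hK z).elim⟩

/-! ### Spheres -/

/-- The vertices `± eᵢ` of the cross-polytope in `ℝʲ`, ordered so that the chains are the sets of
vertices of its proper faces: its realization is the boundary of the cross-polytope. -/
structure CrossPolytope (j : ℕ) : Type where
  axis : Fin j
  sign : Bool

/-- A vertex is determined by its axis and its sign. -/
def CrossPolytope.equivProd (j : ℕ) : Fin j × Bool ≃ CrossPolytope j where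
  toFun k := ⟨k.1, k.2⟩
  invFun k := (k.axis, k.sign)

instance (j : ℕ) : Fintype (CrossPolytope j) := Fintype.ofEquiv _ (CrossPolytope.equivProd j)

instance (j : ℕ) : PartialOrder (CrossPolytope j) where
  le k l := k = l ∨ k.axis < l.axis
  le_refl k := Or.inl rfl
  le_trans k l m h₁ h₂ := by
    rcases h₁ with rfl | h₁
    · exact h₂
    · rcases h₂ with rfl | h₂
      · exact Or.inr h₁
      · exact Or.inr (h₁.trans h₂)
  le_antisymm k l h₁ h₂ := by
    rcases h₁ with rfl | h₁
    · rfl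
    · rcases h₂ with h₂ | h₂
      · exact h₂.symm
      · exact absurd (h₁.trans h₂) (lt_irrefl _)

theorem CrossPolytope.rankLT (j : ℕ) : RankLT (CrossPolytope j) j := by
  refine ⟨fun k => k.axis, fun k l h => ?_, fun k => k.axis.2⟩
  exact (h.le.resolve_left h.ne)

theorem CrossPolytope.sum (j : ℕ) (F : CrossPolytope j → ℝ) :
    ∑ k, F k = ∑ i : Fin j, (F ⟨i, true⟩ + F ⟨i, false⟩) := by
  rw [← (CrossPolytope.equivProd j).sum_comp, Fintype.sum_prod_type]
  exact Finset.sum_congr rfl fun i _ => Fintype.sum_bool _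

/-- The unit sphere is a retract of the boundary of the cross-polytope. -/
theorem exists_sphere_retract (j : ℕ) :
    ∃ (u : C(Metric.sphere (0 : EuclideanSpace ℝ (Fin j)) 1, PosetRealization (CrossPolytope j)))
      (r : C(PosetRealization (CrossPolytope j), Metric.sphere (0 : EuclideanSpace ℝ (Fin j)) 1)),
      ∀ y, r (u y) = y := by
  have hN : ∀ y : Metric.sphere (0 : EuclideanSpace ℝ (Fin j)) 1, 0 < ∑ i, |y.1 i| := by
    intro y
    refine lt_of_le_of_ne (Finset.sum_nonneg fun i _ => abs_nonneg _) fun h => ?_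
    have h0 := (Finset.sum_eq_zero_iff_of_nonneg fun i _ => abs_nonneg (y.1 i)).1 h.symm
    have : y.1 = 0 := by
      ext i
      exact abs_eq_zero.1 (h0 i (Finset.mem_univ i))
    have hy := y.2
    rw [mem_sphere_zero_iff_norm, this, norm_zero] at hy
    exact zero_ne_one hy
  let w : Metric.sphere (0 : EuclideanSpace ℝ (Fin j)) 1 → CrossPolytope j → ℝ := fun y k =>
    (if k.sign then max (y.1 k.axis) 0 else max (-y.1 k.axis) 0) / ∑ i, |y.1 i|
  obtain ⟨u, hu⟩ := exists_continuousMap (P := CrossPolytope j) w Finset.univ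
    (fun _ _ _ => Finset.mem_univ _)
    (fun y k => by
      refine div_nonneg ?_ (hN y).le
      split_ifs <;> exact le_max_right _ _)
    (fun y => by
      rw [CrossPolytope.sum]
      simp only [w, if_true, Bool.false_eq_true, if_false, ← add_div, ← Finset.sum_div]
      rw [div_eq_one_iff_eq (hN y).ne']
      refine Finset.sum_congr rfl fun i _ => ?_
      rcases le_total 0 (y.1 i) with h | h
      · rw [max_eq_left h, max_eq_right (by linarith), abs_of_nonneg h, add_zero]
      · rw [max_eq_right h, max_eq_left (by linarith), abs_of_nonpos h, zero_add])
    (by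
      rintro y ⟨i, s⟩ ⟨i', s'⟩ hk hl
      rcases lt_trichotomy i i' with h | rfl | h
      · exact Or.inl (Or.inr h)
      · rcases s with _ | _ <;> rcases s' with _ | _
        · exact Or.inl le_rfl
        · exfalso
          rcases le_total 0 (y.1 i) with h | h
          · exact hk (by simp [w, h])
          · exact hl (by simp [w, h])
        · exfalso
          rcases le_total 0 (y.1 i) with h | h
          · exact hl (by simp [w, h])
          · exact hk (by simp [w, h])
        · exact Or.inl le_rfl
      · exact Or.inr (Or.inr h))
    (by
      intro k
      have hc : ∀ i, Continuous fun y : Metric.sphere (0 : EuclideanSpace ℝ (Fin j)) 1 =>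
          y.1 i := fun i => by fun_prop
      refine Continuous.div ?_ (continuous_finsetSum _ fun i _ => (hc i).abs) fun y => (hN y).ne'
      split_ifs
      · exact (hc _).max continuous_const
      · exact (hc _).neg.max continuous_const)
  let v : PosetRealization (CrossPolytope j) → EuclideanSpace ℝ (Fin j) := fun x =>
    WithLp.toLp 2 fun i => x.wt ⟨i, true⟩ - x.wt ⟨i, false⟩
  have hv : Continuous v := (PiLp.continuous_toLp 2 _).comp
    (continuous_pi fun i => (continuous_wt _).sub (continuous_wt _))
  have hv0 : ∀ x, v x ≠ 0 := by
    intro x h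
    have hi : ∀ i, x.wt ⟨i, true⟩ = x.wt ⟨i, false⟩ := fun i => by
      have := congrArg (fun z : EuclideanSpace ℝ (Fin j) => z i) h
      simpa [v, sub_eq_zero] using this
    obtain ⟨⟨i, s⟩, hk⟩ := x.exists_wt_ne_zero
    have h1 : x.wt ⟨i, true⟩ ≠ 0 ∧ x.wt ⟨i, false⟩ ≠ 0 := by
      rcases s with _ | _
      · exact ⟨hi i ▸ hk, hk⟩
      · exact ⟨hk, hi i ▸ hk⟩
    rcases x.wt_chain h1.1 h1.2 with (h | h) | (h | h)
    · exact absurd (congrArg CrossPolytope.sign h) (by simp)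
    · exact absurd h (lt_irrefl i)
    · exact absurd (congrArg CrossPolytope.sign h) (by simp)
    · exact absurd h (lt_irrefl i)
  refine ⟨u, ⟨fun x => ⟨‖v x‖⁻¹ • v x, ?_⟩, ?_⟩, fun y => Subtype.ext ?_⟩
  · rw [mem_sphere_zero_iff_norm]
    exact norm_smul_inv_norm (𝕜 := ℝ) (hv0 x)
  · refine Continuous.subtype_mk (Continuous.smul (Continuous.inv₀ hv.norm fun x => ?_) hv) _
    exact norm_ne_zero_iff.2 (hv0 x)
  · have e : v (u y) = (∑ i, |y.1 i|)⁻¹ • y.1 := by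
      ext i
      change (u y).wt ⟨i, true⟩ - (u y).wt ⟨i, false⟩ = (∑ i, |y.1 i|)⁻¹ * y.1 i
      rw [hu, hu]
      simp only [w, if_true, Bool.false_eq_true, if_false]
      rcases le_total 0 (y.1 i) with h | h
      · rw [max_eq_left h, max_eq_right (by linarith)]
        ring
      · rw [max_eq_right h, max_eq_left (by linarith)]
        ring
    change ‖v (u y)‖⁻¹ • v (u y) = y.1
    have hy : ‖y.1‖ = 1 := mem_sphere_zero_iff_norm.1 y.2
    rw [e, norm_smul, hy, mul_one, Real.norm_of_nonneg (inv_nonneg.2 (hN y).le), smul_smul,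
      inv_inv, mul_inv_cancel₀ (hN y).ne', one_smul]

/-- A map from the sphere is null-homotopic, since the sphere is a retract of a realization, and hence
extends to the ball: the outer shell is mapped by the null-homotopy and the ball of radius `1 / 2`
to a point. -/
theorem Conn.isNConnectedPoset {c : ℕ} (h : Conn c (Set.univ : Set P)) {n : ℤ}
    (hn : n + 2 ≤ c) : IsNConnectedPoset n P := by
  intro j hj f
  obtain ⟨u, r, hru⟩ := exists_sphere_retract j
  obtain ⟨q, -, ⟨H⟩⟩ := h j (by omega) _ (CrossPolytope.rankLT j) (f.comp r)
    (fun _ _ _ => Set.mem_univ _)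
  let B : Type := Metric.closedBall (0 : EuclideanSpace ℝ (Fin j)) 1
  let ν : {x : B // (1 / 2 : ℝ) ≤ ‖x.1‖} → Metric.sphere (0 : EuclideanSpace ℝ (Fin j)) 1 :=
    fun x => ⟨‖x.1.1‖⁻¹ • x.1.1, by
      rw [mem_sphere_zero_iff_norm]
      exact norm_smul_inv_norm (𝕜 := ℝ) (norm_pos_iff.1 (by linarith [x.2]))⟩
  have hνc : Continuous ν := by
    have hx : Continuous fun x : {x : B // (1 / 2 : ℝ) ≤ ‖x.1‖} => x.1.1 :=
      continuous_subtype_val.comp continuous_subtype_val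
    exact Continuous.subtype_mk ((hx.norm.inv₀ fun x => by linarith [x.2]).smul hx) _
  let τ : B → unitInterval := fun x => Set.projIcc (0 : ℝ) 1 zero_le_one (2 - 2 * ‖x.1‖)
  have hτ : Continuous τ := continuous_projIcc.comp
    (show Continuous fun x : B => 2 - 2 * ‖x.1‖ by fun_prop)
  let G : B → PosetRealization P := fun x =>
    if hx : (1 / 2 : ℝ) ≤ ‖x.1‖ then H (τ x, u (ν ⟨x, hx⟩)) else q
  have hG : ∀ x (hx : (1 / 2 : ℝ) ≤ ‖x.1‖), G x = H (τ x, u (ν ⟨x, hx⟩)) := fun x hx => dif_pos hx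
  have h1 : ContinuousOn G {x : B | (1 / 2 : ℝ) ≤ ‖x.1‖} := by
    rw [continuousOn_iff_continuous_domRestrict]
    have : Continuous fun x : {x : B // (1 / 2 : ℝ) ≤ ‖x.1‖} => H (τ x.1, u (ν x)) := by
      fun_prop
    exact this.congr fun x => (hG x.1 x.2).symm
  have h2 : ContinuousOn G {x : B | ‖x.1‖ ≤ (1 / 2 : ℝ)} := by
    refine (continuousOn_const (c := q)).congr fun x hx => ?_
    have hx : ‖x.1‖ ≤ (1 / 2 : ℝ) := hx
    by_cases hx' : (1 / 2 : ℝ) ≤ ‖x.1‖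
    · have : τ x = 1 := Set.projIcc_of_right_le _ (by linarith)
      rw [hG x hx', this, H.apply_one]
      rfl
    · exact dif_neg hx'
  have h3 := h1.union_of_isClosed h2
    (isClosed_le continuous_const (by fun_prop)) (isClosed_le (by fun_prop) continuous_const)
  have h4 : {x : B | (1 / 2 : ℝ) ≤ ‖x.1‖} ∪ {x : B | ‖x.1‖ ≤ (1 / 2 : ℝ)} = Set.univ :=
    Set.eq_univ_of_forall fun x => le_total (1 / 2 : ℝ) ‖x.1‖
  rw [h4, continuousOn_univ] at h3
  refine ⟨⟨G, h3⟩, fun x => ?_⟩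
  have hx : ‖x.1‖ = 1 := mem_sphere_zero_iff_norm.1 x.2
  have hτx : τ ⟨x.1, Metric.sphere_subset_closedBall x.2⟩ = 0 :=
    Set.projIcc_of_le_left _ (by rw [hx]; norm_num)
  have hνx : ν ⟨⟨x.1, Metric.sphere_subset_closedBall x.2⟩, by rw [hx]; norm_num⟩ = x := by
    refine Subtype.ext ?_
    change ‖x.1‖⁻¹ • x.1 = x.1
    rw [hx, inv_one, one_smul]
  change G _ = _
  rw [hG _ (by rw [hx]; norm_num), hτx, hνx, H.apply_zero]
  exact congrArg f (hru x)

/-! ### Attaching and detaching elements with joins as links -/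

theorem link_eq_union {W : Set P} {t : P} (D : P → Prop) :
    {p | (p ∈ W ∧ D p) ∧ (p < t ∨ t < p)} =
      {p | (p ∈ W ∧ D p) ∧ p < t} ∪ {p | (p ∈ W ∧ D p) ∧ t < p} := by
  ext p
  exact and_or_left

/-- `Conn.attach` for elements whose link is split into the parts below and above. -/
theorem Conn.attach_join {A W : Set P} {c : ℕ} (hA : Conn c A) (hAW : A ⊆ W) (h : P → ℕ)
    (hh : ∀ x ∈ W, x ∉ A → ∀ y ∈ W, y ∉ A → h x = h y → x ≤ y → x = y)
    (hlk : ∀ t ∈ W, t ∉ A → ∃ a b, c ≤ a + b + 1 ∧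
      Conn a {p | (p ∈ W ∧ (p ∈ A ∨ h p < h t)) ∧ p < t} ∧
      Conn b {p | (p ∈ W ∧ (p ∈ A ∨ h p < h t)) ∧ t < p}) : Conn c W := by
  obtain _ | c := c
  · exact conn_zero W
  refine hA.attach hAW h hh fun t ht htA => ?_
  obtain ⟨a, b, hab, h₁, h₂⟩ := hlk t ht htA
  rw [link_eq_union]
  exact (Conn.join (fun p hp q hq => hp.2.trans hq.2) h₁ h₂).mono (by omega)

/-- `Conn.detach` for elements whose link is split into the parts below and above. -/
theorem Conn.detach_join {A W : Set P} {c : ℕ} (hW : Conn c W) (hAW : A ⊆ W) (h : P → ℕ) (B : ℕ)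
    (hB : ∀ x ∈ W, x ∉ A → h x < B)
    (hh : ∀ x ∈ W, x ∉ A → ∀ y ∈ W, y ∉ A → h x = h y → x ≤ y → x = y)
    (hlk : ∀ t ∈ W, t ∉ A → ∃ a b, c ≤ a + b ∧
      Conn a {p | (p ∈ W ∧ (p ∈ A ∨ h t < h p)) ∧ p < t} ∧
      Conn b {p | (p ∈ W ∧ (p ∈ A ∨ h t < h p)) ∧ t < p}) : Conn c A := by
  refine hW.detach hAW h B hB hh fun t ht htA => ?_
  obtain ⟨a, b, hab, h₁, h₂⟩ := hlk t ht htA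
  rw [link_eq_union]
  exact (Conn.join (fun p hp q hq => hp.2.trans hq.2) h₁ h₂).mono hab

end Posets

/-! ### Simplicial complexes -/

section Complexes

variable {V : Type*}

/-- The boundary of a simplex with `n + 1` vertices is the suspension of the boundary of a facet,
hence is `(n - 2)`-connected. -/
theorem conn_boundary (τ : Finset V) :
    Conn (τ.card - 1) {σ : Finset V | σ.Nonempty ∧ σ ⊂ τ} := by
  classical
  suffices H : ∀ (n : ℕ) (τ : Finset V), τ.card = n + 1 →
      Conn n {σ : Finset V | σ.Nonempty ∧ σ ⊂ τ} by
    rcases h : τ.card with _ | n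
    · exact conn_zero _
    · exact H n τ h
  intro n
  induction n with
  | zero => exact fun _ _ => conn_zero _
  | succ n ih =>
    intro τ hτ
    obtain ⟨a, ha⟩ : τ.Nonempty := Finset.card_pos.1 (by omega)
    have hea : (τ.erase a).card = n + 1 := by rw [Finset.card_erase_of_mem ha]; omega
    refine Conn.attach_join (A := {σ : Finset V | (σ.Nonempty ∧ σ ⊂ τ) ∧ σ ≠ τ.erase a})
      ?_ (fun σ hσ => hσ.1) (fun _ => 0) ?_ ?_
    · refine conn_of_cone _ (p₀ := {a}) ⟨⟨Finset.singleton_nonempty a, ?_⟩, ?_⟩ (fun σ => insert a σ)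
        ?_ ?_ ?_ ?_
      · refine Finset.ssubset_iff_subset_ne.2 ⟨Finset.singleton_subset_iff.2 ha, ?_⟩
        rintro rfl
        simp at hτ
      · intro h
        have := h ▸ Finset.mem_singleton_self a
        simp at this
      · exact fun σ _ ρ _ h => Finset.insert_subset_insert a h
      · rintro σ ⟨⟨-, h₁⟩, h₂⟩
        refine ⟨⟨Finset.insert_nonempty a σ, ?_⟩, ?_⟩
        · refine Finset.ssubset_iff_subset_ne.2 ⟨Finset.insert_subset ha h₁.subset, fun h => ?_⟩
          change insert a σ = τ at h
          by_cases haσ : a ∈ σ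
          · rw [Finset.insert_eq_of_mem haσ] at h
            exact h₁.ne h
          · exact h₂ (by rw [← h, Finset.erase_insert haσ])
        · exact fun h => Finset.notMem_erase a τ (h ▸ Finset.mem_insert_self a σ)
      · exact fun σ _ => Finset.subset_insert a σ
      · exact fun σ _ => Finset.singleton_subset_iff.2 (Finset.mem_insert_self a σ)
    · intro x hx hxA y hy hyA _ _
      have e : ∀ z ∈ {σ : Finset V | σ.Nonempty ∧ σ ⊂ τ},
          z ∉ {σ : Finset V | (σ.Nonempty ∧ σ ⊂ τ) ∧ σ ≠ τ.erase a} → z = τ.erase a :=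
        fun z hz hzA => by
          by_contra h
          exact hzA ⟨hz, h⟩
      rw [e x hx hxA, e y hy hyA]
    · intro t ht htA
      have e : t = τ.erase a := by
        by_contra h
        exact htA ⟨ht, h⟩
      subst e
      refine ⟨n, 0, by omega, ?_, conn_zero _⟩
      convert ih _ hea using 1
      ext p
      constructor
      · exact fun h => ⟨h.1.1.1, h.2⟩
      · intro h
        have h' : p ⊂ τ := h.2.trans_subset (Finset.erase_subset a τ)
        exact ⟨⟨⟨h.1, h'⟩, Or.inl ⟨⟨h.1, h'⟩, h.2.ne⟩⟩, h.2⟩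

variable [DecidableEq V]

/-- The non-empty faces `ρ` with vertices in `X` of the link of `τ`, for `X` disjoint from `τ`. -/
def link (𝒦 : Set (Finset V)) (X : Set V) (τ : Finset V) : Set (Finset V) :=
  {ρ | ρ.Nonempty ∧ (ρ : Set V) ⊆ X ∧ ρ ∪ τ ∈ 𝒦}

/-- The non-empty faces of a complex. -/
def faces (𝒦 : Set (Finset V)) : Set (Finset V) :=
  {σ | σ.Nonempty ∧ σ ∈ 𝒦}

variable {𝒦 : Set (Finset V)} {X : Set V} {c : ℕ}

open Classical in
/-- The faces that contain `τ` and meet `X` retract to the part in `X` of the link of `τ`. -/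
theorem conn_above (h𝒦 : ∀ σ ∈ 𝒦, ∀ ρ ⊆ σ, ρ ∈ 𝒦) {τ : Finset V}
    (h : Conn c (link 𝒦 X τ)) : Conn c {σ : Finset V | σ ∈ 𝒦 ∧ τ ⊆ σ ∧ ∃ x ∈ σ, x ∈ X} := by
  refine h.of_dominated (fun σ => σ.filter (· ∈ X)) (fun ρ => ρ ∪ τ) ?_ ?_ ?_ ?_ (Or.inl ?_)
  · exact fun σ _ ρ _ h => Finset.filter_subset_filter _ h
  · exact fun σ _ ρ _ h => Finset.union_subset_union_left h
  · rintro σ ⟨h₁, h₂, x, hx, hxX⟩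
    refine ⟨⟨x, Finset.mem_filter.2 ⟨hx, hxX⟩⟩, fun y hy => (Finset.mem_filter.1 hy).2,
      h𝒦 σ h₁ _ (Finset.union_subset (Finset.filter_subset _ _) h₂)⟩
  · rintro ρ ⟨⟨x, hx⟩, h₁, h₂⟩
    exact ⟨h₂, Finset.subset_union_right, x, Finset.mem_union_left _ hx, h₁ hx⟩
  · exact fun σ hσ => Finset.union_subset (Finset.filter_subset _ _) hσ.2.1

/-- Attaching to a family of faces, which contains those that meet `X`, the remaining ones in the
order of increasing dimension. -/
theorem conn_faces_of_start (h𝒦 : ∀ σ ∈ 𝒦, ∀ ρ ⊆ σ, ρ ∈ 𝒦) (E : Set (Finset V))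
    (hE : ∀ σ ∈ E, σ.card ≤ 1)
    (hstart : Conn c {σ | σ ∈ faces 𝒦 ∧ ((∃ x ∈ σ, x ∈ X) ∨ σ ∈ E)})
    (hlk : ∀ τ ∈ faces 𝒦, (∀ x ∈ τ, x ∉ X) → τ ∉ E → Conn (c - τ.card) (link 𝒦 X τ)) :
    Conn c (faces 𝒦) := by
  refine hstart.attach_join (fun σ hσ => hσ.1) (fun σ => σ.card) ?_ ?_
  · exact fun x _ _ y _ _ h hxy => Finset.eq_of_subset_of_card_le hxy h.ge
  · intro τ hτ hτA
    have h₁ : ∀ x ∈ τ, x ∉ X := fun x hx hxX => hτA ⟨hτ, Or.inl ⟨x, hx, hxX⟩⟩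
    have h₂ : τ ∉ E := fun h => hτA ⟨hτ, Or.inr h⟩
    have hpos := Finset.card_pos.2 hτ.1
    refine ⟨τ.card - 1, c - τ.card, by omega, ?_, ?_⟩
    · -- all proper faces of `τ` are present
      convert conn_boundary τ using 1
      ext p
      constructor
      · exact fun h => ⟨h.1.1.1, h.2⟩
      · exact fun h => ⟨⟨⟨h.1, h𝒦 τ hτ.2 p h.2.subset⟩, Or.inr (Finset.card_lt_card h.2)⟩, h.2⟩
    · -- a larger face that is present already meets `X`
      convert conn_above h𝒦 (hlk τ hτ h₁ h₂) using 1
      ext p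
      constructor
      · rintro ⟨⟨hp, h⟩, hlt⟩
        refine ⟨hp.2, hlt.le, ?_⟩
        have hlt' := Finset.card_lt_card hlt
        rcases h with ⟨-, h | h⟩ | h
        · exact h
        · have := hE p h
          omega
        · exact absurd h hlt'.le.not_gt
      · rintro ⟨hp, hle, x, hx, hxX⟩
        have hp' : p ∈ faces 𝒦 := ⟨⟨x, hx⟩, hp⟩
        exact ⟨⟨hp', Or.inl ⟨hp', Or.inl ⟨x, hx, hxX⟩⟩⟩,
          Finset.ssubset_iff_subset_ne.2 ⟨hle, fun h => h₁ x (h ▸ hx) hxX⟩⟩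

/-- A complex is highly connected if a full subcomplex is, together with its intersections with the
links of the simplices that are disjoint from it. -/
theorem conn_faces (h𝒦 : ∀ σ ∈ 𝒦, ∀ ρ ⊆ σ, ρ ∈ 𝒦) (hX : Conn c (link 𝒦 X ∅))
    (hlk : ∀ τ ∈ faces 𝒦, (∀ x ∈ τ, x ∉ X) → Conn (c - τ.card) (link 𝒦 X τ)) :
    Conn c (faces 𝒦) := by
  refine conn_faces_of_start h𝒦 (X := X) ∅ (fun _ h => h.elim) ?_ fun τ h h' _ => hlk τ h h'
  convert conn_above h𝒦 hX using 1
  ext σ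
  constructor
  · rintro ⟨h, h' | h'⟩
    · exact ⟨h.2, Finset.empty_subset σ, h'⟩
    · exact h'.elim
  · rintro ⟨h, -, x, hx, hxX⟩
    exact ⟨⟨⟨x, hx⟩, h⟩, Or.inl ⟨x, hx, hxX⟩⟩

open Classical in
/-- A variant of `conn_faces` in which the cone on the full subcomplex with vertices in `X` is
contained in the complex. -/
theorem conn_faces_of_cone (h𝒦 : ∀ σ ∈ 𝒦, ∀ ρ ⊆ σ, ρ ∈ 𝒦) {y : V} (hy : ∅ ∈ 𝒦)
    (hcone : ∀ ρ ∈ 𝒦, (ρ : Set V) ⊆ X → insert y ρ ∈ 𝒦)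
    (hlk : ∀ τ ∈ faces 𝒦, (∀ x ∈ τ, x ∉ X) → τ ≠ {y} → Conn (c - τ.card) (link 𝒦 X τ)) :
    Conn c (faces 𝒦) := by
  have hy' : {y} ∈ 𝒦 := hcone ∅ hy (by simp)
  refine conn_faces_of_start h𝒦 (X := X) {{y}} ?_ ?_ hlk
  · rintro σ rfl
    simp
  · have hc : Conn c {σ | σ ∈ faces 𝒦 ∧ ∀ x ∈ σ, x ∈ X ∨ x = y} := by
      refine conn_of_cone c (p₀ := {y}) ⟨⟨Finset.singleton_nonempty y, hy'⟩, by simp⟩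
        (fun σ => insert y σ) ?_ ?_ ?_ ?_
      · exact fun σ _ ρ _ h => Finset.insert_subset_insert y h
      · rintro σ ⟨⟨-, h₁⟩, h₂⟩
        refine ⟨⟨Finset.insert_nonempty y σ, ?_⟩, fun x hx => ?_⟩
        · have e : insert y σ = insert y (σ.filter (· ∈ X)) := by
            ext x
            simp only [Finset.mem_insert, Finset.mem_filter]
            constructor
            · rintro (h | h)
              · exact Or.inl h
              · exact (h₂ x h).symm.imp_right fun h' => ⟨h, h'⟩
            · exact Or.imp_right And.left
          change insert y σ ∈ 𝒦
          rw [e]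
          exact hcone _ (h𝒦 σ h₁ _ (Finset.filter_subset _ _)) fun x hx =>
            (Finset.mem_filter.1 hx).2
        · rcases Finset.mem_insert.1 hx with h | h
          · exact Or.inr h
          · exact h₂ x h
      · exact fun σ _ => Finset.subset_insert y σ
      · exact fun σ _ => Finset.singleton_subset_iff.2 (Finset.mem_insert_self y σ)
    refine hc.of_dominated (fun σ => σ.filter fun x => x ∈ X ∨ x = y) id ?_ ?_ ?_ ?_ (Or.inl ?_)
    · exact fun σ _ ρ _ h => Finset.filter_subset_filter _ h
    · exact fun _ _ _ _ h => h
    · rintro σ ⟨⟨-, h₁⟩, h₂⟩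
      refine ⟨⟨?_, h𝒦 σ h₁ _ (Finset.filter_subset _ _)⟩, fun x hx => (Finset.mem_filter.1 hx).2⟩
      rcases h₂ with ⟨x, hx, hxX⟩ | h₂
      · exact ⟨x, Finset.mem_filter.2 ⟨hx, Or.inl hxX⟩⟩
      · refine ⟨y, Finset.mem_filter.2 ⟨?_, Or.inr rfl⟩⟩
        rw [h₂]
        exact Finset.mem_singleton_self y
    · rintro σ ⟨h₁, h₂⟩
      refine ⟨h₁, ?_⟩
      by_cases h : ∃ x ∈ σ, x ∈ X
      · exact Or.inl h
      · push Not at h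
        refine Or.inr (Finset.eq_singleton_iff_nonempty_unique_mem.2 ⟨h₁.1, fun x hx => ?_⟩)
        exact (h₂ x hx).resolve_left (h x hx)
    · exact fun σ _ => Finset.filter_subset _ _

end Complexes

/-! ### Injective words -/

section Words

variable {V : Type*}

/-- The non-empty finite sequences in `V`. -/
abbrev Word (V : Type*) : Type _ := SeqPoset (Set.univ : Set (List V))

/-- The word with the given letters. -/
def Word.mk (l : List V) (hl : l ≠ []) : Word V := ⟨l, hl, trivial⟩

theorem Word.le_def {v w : Word V} : v ≤ w ↔ v.seq.Sublist w.seq := Iff.rfl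

theorem Word.lt_length {v w : Word V} (h : v < w) : v.seq.length < w.seq.length := by
  refine lt_of_le_of_ne h.le.length_le fun h' => h.not_ge ?_
  rw [Word.le_def, (show v.seq.Sublist w.seq from h.le).eq_of_length h']

/-- The non-empty words without repetitions whose letters belong to `S`. -/
def injWords (S : Finset V) : Set (Word V) := {w | w.seq.Nodup ∧ ∀ x ∈ w.seq, x ∈ S}

theorem mem_injWords_of_le {S : Finset V} {v w : Word V} (hw : w ∈ injWords S) (h : v ≤ w) :
    v ∈ injWords S :=
  ⟨hw.1.sublist h, fun x hx => hw.2 x ((Word.le_def.1 h).subset hx)⟩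

theorem exists_append_of_mem_tail {a : V} {l : List V} (h : a ∈ l.tail) :
    ∃ u v, u ≠ [] ∧ l = u ++ a :: v := by
  rcases l with _ | ⟨b, l⟩
  · simp at h
  · obtain ⟨u, v, e⟩ := List.append_of_mem h
    exact ⟨b :: u, v, by simp, by rw [List.tail_cons] at e; rw [e]; rfl⟩

theorem mem_tail_append_cons {a : V} {u v : List V} (hu : u ≠ []) : a ∈ (u ++ a :: v).tail := by
  rw [List.tail_append_of_ne_nil hu]
  exact List.mem_append_right _ List.mem_cons_self

variable [DecidableEq V]

theorem sublist_filter_mem {l w : List V} (hw : w.Nodup) (h : l.Sublist w) :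
    w.filter (· ∈ l) = l := by
  induction h with
  | slnil => rfl
  | @cons l w a h ih =>
    have := List.nodup_cons.1 hw
    rw [List.filter_cons_of_neg, ih this.2]
    simpa using fun h' => this.1 (h.subset h')
  | @cons_cons l w a h ih =>
    have := List.nodup_cons.1 hw
    rw [List.filter_cons_of_pos (by simp)]
    congr 1
    refine Eq.trans (List.filter_congr fun x hx => ?_) (ih this.2)
    have hxa : x ≠ a := fun e => this.1 (e ▸ hx)
    simp [hxa]

/-- The subwords of a word without repetitions correspond to the sets of its letters. -/
theorem conn_subwords {t : Word V} (ht : t.seq.Nodup) {D : Set (Finset V)} {c : ℕ}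
    (h : Conn c {σ : Finset V | (σ.Nonempty ∧ σ ⊆ t.seq.toFinset) ∧ σ ∈ D}) :
    Conn c {p : Word V | p ≤ t ∧ p.seq.toFinset ∈ D} := by
  have hne : ∀ σ : Finset V, σ.Nonempty → σ ⊆ t.seq.toFinset → t.seq.filter (· ∈ σ) ≠ [] := by
    rintro σ ⟨x, hx⟩ hσ h
    have : x ∈ t.seq.filter (· ∈ σ) := List.mem_filter.2 ⟨List.mem_toFinset.1 (hσ hx), by simpa⟩
    simp [h] at this
  let v : Finset V → Word V := fun σ =>
    if hσ : t.seq.filter (· ∈ σ) ≠ [] then Word.mk _ hσ else t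
  have hv : ∀ σ : Finset V, σ.Nonempty → σ ⊆ t.seq.toFinset →
      (v σ).seq = t.seq.filter (· ∈ σ) := fun σ h₁ h₂ => by
    simp only [v]
    rw [dif_pos (hne σ h₁ h₂)]
    rfl
  refine h.of_dominated (fun p => p.seq.toFinset) v ?_ ?_ ?_ ?_ (Or.inl ?_)
  · exact fun p _ q _ h => fun x hx =>
      List.mem_toFinset.2 ((show p.seq.Sublist q.seq from h).subset (List.mem_toFinset.1 hx))
  · intro σ hσ ρ hρ hle
    rw [Word.le_def, hv σ hσ.1.1 hσ.1.2, hv ρ hρ.1.1 hρ.1.2]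
    exact List.monotone_filter_right _ fun x hx => by
      simp only [decide_eq_true_eq] at hx ⊢
      exact hle hx
  · rintro p ⟨h₁, h₂⟩
    exact ⟨⟨(List.toFinset_nonempty_iff _).2 p.ne_nil, fun x hx =>
      List.mem_toFinset.2 ((Word.le_def.1 h₁).subset (List.mem_toFinset.1 hx))⟩, h₂⟩
  · intro σ hσ
    refine ⟨?_, ?_⟩
    · rw [Word.le_def, hv σ hσ.1.1 hσ.1.2]
      exact List.filter_sublist
    · convert hσ.2 using 1
      ext x
      rw [hv σ hσ.1.1 hσ.1.2, List.mem_toFinset, List.mem_filter]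
      simp only [decide_eq_true_eq]
      exact ⟨And.right, fun hx => ⟨List.mem_toFinset.1 (hσ.1.2 hx), hx⟩⟩
  · rintro p ⟨h₁, h₂⟩
    rw [Word.le_def, hv _ ((List.toFinset_nonempty_iff _).2 p.ne_nil) fun x hx =>
      List.mem_toFinset.2 ((Word.le_def.1 h₁).subset (List.mem_toFinset.1 hx))]
    simp only [List.mem_toFinset]
    rw [sublist_filter_mem ht h₁]

/-- The words that extend a given word `t` to the right. -/
theorem conn_prefixed {S : Finset V} {t : List V} {c : ℕ} (ht : t.Nodup)
    (h : Conn c (injWords (S \ t.toFinset))) (hS : ∀ x ∈ t, x ∈ S) :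
    Conn c {p : Word V | p ∈ injWords S ∧ ∃ q, q ≠ [] ∧ p.seq = t ++ q} := by
  let u : Word V → Word V := fun p =>
    if hp : p.seq.drop t.length ≠ [] then Word.mk _ hp else p
  have hu : ∀ (p : Word V) q, q ≠ [] → p.seq = t ++ q → (u p).seq = q := fun p q h h' => by
    have e : p.seq.drop t.length = q := by rw [h', List.drop_left]
    simp only [u]
    rw [dif_pos (e ▸ h)]
    exact e
  refine h.of_dominated u (fun q => Word.mk (t ++ q.seq) (by simp [q.ne_nil])) ?_ ?_ ?_ ?_
    (Or.inl ?_)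
  · rintro p ⟨-, q, hq, hpq⟩ p' ⟨-, q', hq', hpq'⟩ hle
    rw [Word.le_def, hpq, hpq', List.append_sublist_append_left] at hle
    rw [Word.le_def, hu p q hq hpq, hu p' q' hq' hpq']
    exact hle
  · intro q _ q' _ hle
    exact (List.append_sublist_append_left t).2 hle
  · rintro p ⟨⟨h₁, h₂⟩, q, hq, hpq⟩
    rw [hpq] at h₁ h₂
    rw [List.nodup_append'] at h₁
    refine ⟨?_, fun x hx => ?_⟩
    · rw [hu p q hq hpq]
      exact h₁.2.1
    · rw [hu p q hq hpq] at hx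
      rw [Finset.mem_sdiff, List.mem_toFinset]
      exact ⟨h₂ x (List.mem_append_right _ hx), fun h => h₁.2.2 h hx⟩
  · rintro q ⟨h₁, h₂⟩
    refine ⟨⟨?_, ?_⟩, q.seq, q.ne_nil, rfl⟩
    · refine List.nodup_append'.2 ⟨ht, h₁, fun x hx hx' => ?_⟩
      exact (Finset.mem_sdiff.1 (h₂ x hx')).2 (List.mem_toFinset.2 hx)
    · intro x hx
      rcases List.mem_append.1 hx with hx | hx
      · exact hS x hx
      · exact (Finset.mem_sdiff.1 (h₂ x hx)).1
  · rintro p ⟨-, q, hq, hpq⟩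
    rw [Word.le_def]
    change (t ++ (u p).seq).Sublist p.seq
    rw [hu p q hq hpq, hpq]

theorem idxOf_append_cons {a : V} {u v : List V} (h : a ∉ u) :
    (u ++ a :: v).idxOf a = u.length := by
  rw [List.idxOf_append_of_notMem h, List.idxOf_cons_self, add_zero]

/-- If `u' a v'` is a subword of the injective word `u a v` then `u'` consists of letters of `u`. -/
theorem eq_filter_of_append_cons {a : V} {u v u' v' : List V} (hn : (u ++ a :: v).Nodup)
    (h : (u' ++ a :: v').Sublist (u ++ a :: v)) :
    u' = u.filter (· ∈ u' ++ a :: v') := by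
  have e := sublist_filter_mem hn h
  have hn' := List.nodup_append'.1 (hn.sublist h)
  rw [List.filter_append, List.filter_cons_of_pos (by simp)] at e
  exact ((List.append_cons_inj_of_notMem (fun ha => hn'.2.2 ha List.mem_cons_self)
    (List.nodup_cons.1 hn'.2.1).1).1 e.symm).1

theorem length_le_of_mem_injWords {S : Finset V} {w : Word V} (hw : w ∈ injWords S) :
    w.seq.length ≤ S.card := by
  rw [← List.toFinset_card_of_nodup hw.1]
  exact Finset.card_le_card fun x hx => hw.2 x (List.mem_toFinset.1 hx)

/-- The words in which `a` occurs at most as the first letter form a cone. -/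
theorem conn_injWords_start {S : Finset V} {a : V} (ha : a ∈ S) (c : ℕ) :
    Conn c {w : Word V | w ∈ injWords S ∧ a ∉ w.seq.tail} := by
  refine conn_of_cone c (p₀ := Word.mk [a] (by simp)) ⟨⟨by simp [Word.mk], ?_⟩, by simp [Word.mk]⟩
    (fun w => Word.mk (a :: w.seq.erase a) (by simp)) ?_ ?_ ?_ ?_
  · simpa [Word.mk] using ha
  · exact fun w _ w' _ h => List.Sublist.cons_cons a (List.Sublist.erase a h)
  · rintro w ⟨⟨h₁, h₂⟩, -⟩
    have h₃ : a ∉ w.seq.erase a := h₁.not_mem_erase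
    refine ⟨⟨List.nodup_cons.2 ⟨h₃, h₁.erase a⟩, fun x hx => ?_⟩, h₃⟩
    rcases List.mem_cons.1 hx with rfl | hx
    · exact ha
    · exact h₂ x (List.mem_of_mem_erase hx)
  · rintro ⟨l, hl, _⟩ ⟨-, h⟩
    rw [Word.le_def]
    change l.Sublist (a :: l.erase a)
    rcases l with _ | ⟨b, l⟩
    · exact absurd rfl hl
    · by_cases e : b = a
      · subst e
        simp
      · have h' : a ∉ b :: l := by
          rw [List.mem_cons, not_or]
          exact ⟨Ne.symm e, h⟩
        rw [List.erase_of_not_mem h']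
        exact List.sublist_cons_self a _
  · intro w _
    exact List.Sublist.cons_cons a (List.nil_sublist _)

/-- The poset of injective words on a set with `n` elements is `(n - 2)`-connected (Farmer). A letter
`a` is fixed; to the cone of the words in which `a` occurs at most as the first letter, the words
`u a v` with `u` non-empty are attached by increasing length of `u` and, for given length of `u`,
by decreasing length. -/
theorem conn_injWords (S : Finset V) : Conn S.card (injWords S) := by
  induction hn : S.card using Nat.strong_induction_on generalizing S with
  | _ n ih =>
  subst hn
  rcases S.eq_empty_or_nonempty with rfl | ⟨a, ha⟩
  · exact conn_zero _
  let B := S.card + 1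
  refine (conn_injWords_start ha S.card).attach_join (fun w hw => hw.1)
    (fun w => w.seq.idxOf a * B + (B - w.seq.length)) ?_ ?_
  · intro x hx hxA y hy hyA hxy hle
    by_contra hne
    have hlen := Word.lt_length (lt_of_le_of_ne hle hne)
    obtain ⟨u, v, -, e⟩ := exists_append_of_mem_tail (not_not.1 fun h => hxA ⟨hx, h⟩)
    obtain ⟨u', v', -, e'⟩ := exists_append_of_mem_tail (not_not.1 fun h => hyA ⟨hy, h⟩)
    have hx1 := hx.1
    have hy1 := hy.1
    have hyB := length_le_of_mem_injWords hy
    have hxl := List.length_pos_iff.2 x.ne_nil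
    rw [e] at hx1
    rw [e'] at hy1
    have hle' := Word.le_def.1 hle
    rw [e, e'] at hle'
    have hsub : u.Sublist u' := eq_filter_of_append_cons hy1 hle' ▸ List.filter_sublist
    rw [e, e', idxOf_append_cons fun h => (List.nodup_append'.1 hx1).2.2 h List.mem_cons_self,
      idxOf_append_cons fun h => (List.nodup_append'.1 hy1).2.2 h List.mem_cons_self,
      ← e, ← e'] at hxy
    rcases hsub.length_le.eq_or_lt with h | h
    · rw [h] at hxy
      omega
    · have hmul := Nat.mul_le_mul_right B (Nat.succ_le_of_lt h)
      rw [Nat.succ_mul] at hmul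
      omega
  · intro t ht htA
    obtain ⟨u, v, hu, e⟩ : ∃ u v, u ≠ [] ∧ t.seq = u ++ a :: v :=
      exists_append_of_mem_tail (not_not.1 fun h => htA ⟨ht, h⟩)
    have hnd := ht.1
    rw [e] at hnd
    have hau : a ∉ u := fun h => (List.nodup_append'.1 hnd).2.2 h List.mem_cons_self
    have htB := length_le_of_mem_injWords ht
    have htl : t.seq.length = u.length + (v.length + 1) := by simp [e]
    have hti : t.seq.idxOf a = u.length := by rw [e, idxOf_append_cons hau]
    have hnda : ∀ {u' v' : List V}, (u' ++ a :: v').Nodup → a ∉ u' := fun h h' =>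
      (List.nodup_append'.1 h).2.2 h' List.mem_cons_self
    -- the subwords of `u a v` that are present are those that omit a letter of `u` or `a`
    have hbelow : {p : Word V | (p ∈ injWords S ∧
        (p ∈ {w : Word V | w ∈ injWords S ∧ a ∉ w.seq.tail} ∨
          p.seq.idxOf a * B + (B - p.seq.length) < t.seq.idxOf a * B + (B - t.seq.length))) ∧
        p < t} = {p : Word V | p ≤ t ∧
          p.seq.toFinset ∈ {σ : Finset V | ¬ insert a u.toFinset ⊆ σ}} := by
      ext p
      constructor
      · rintro ⟨⟨hp, h⟩, hlt⟩
        refine ⟨hlt.le, fun hU => ?_⟩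
        have hap : a ∈ p.seq := List.mem_toFinset.1 (hU (Finset.mem_insert_self _ _))
        obtain ⟨u', v', e'⟩ := List.append_of_mem hap
        have hle := Word.le_def.1 hlt.le
        have hp1 := hp.1
        rw [e, e'] at hle
        rw [e'] at hp1
        have hf := eq_filter_of_append_cons hnd hle
        rw [← e', List.filter_eq_self.2 fun x hx => by
          simpa using hU (Finset.mem_insert_of_mem (List.mem_toFinset.2 hx))] at hf
        subst hf
        have hlen := Word.lt_length hlt
        rcases h with h | h
        · exact h.2 (e' ▸ mem_tail_append_cons hu)
        · rw [hti, e', idxOf_append_cons hau, ← e'] at h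
          omega
      · rintro ⟨hle, hU⟩
        have hp := mem_injWords_of_le ht hle
        have hne : p ≠ t := by
          rintro rfl
          refine hU fun x hx => ?_
          rw [e, List.mem_toFinset]
          rcases Finset.mem_insert.1 hx with rfl | hx
          · simp
          · exact List.mem_append_left _ (List.mem_toFinset.1 hx)
        refine ⟨⟨hp, ?_⟩, lt_of_le_of_ne hle hne⟩
        by_cases hA : a ∈ p.seq.tail
        · right
          obtain ⟨u', v', -, e'⟩ := exists_append_of_mem_tail hA
          have hp1 := hp.1
          have hle' := Word.le_def.1 hle
          rw [e, e'] at hle'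
          rw [e'] at hp1
          have hf := eq_filter_of_append_cons hnd hle'
          rw [← e'] at hf
          have hsub : u'.Sublist u := hf ▸ List.filter_sublist
          have hlt : u'.length < u.length := by
            refine lt_of_le_of_ne hsub.length_le fun h => hU fun x hx => ?_
            rw [e', List.mem_toFinset]
            rcases Finset.mem_insert.1 hx with rfl | hx
            · simp
            · rw [hsub.eq_of_length h]
              exact List.mem_append_left _ (List.mem_toFinset.1 hx)
          have hpl := List.length_pos_iff.2 p.ne_nil
          have hmul := Nat.mul_le_mul_right B (Nat.succ_le_of_lt hlt)
          rw [Nat.succ_mul] at hmul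
          rw [hti, e', idxOf_append_cons (hnda hp1), ← e']
          omega
        · exact Or.inl ⟨hp, hA⟩
    have haT : t.seq.toFinset = insert a u.toFinset ∪ v.toFinset := by
      rw [e]
      ext x
      simp
    rcases v with _ | ⟨x, v⟩
    · refine ⟨u.length, S.card - 1 - u.length, by omega, ?_, ?_⟩
      · rw [hbelow]
        refine conn_subwords ht.1 ?_
        have hb := conn_boundary (insert a u.toFinset)
        rw [Finset.card_insert_of_notMem (by simpa using hau), List.toFinset_card_of_nodup
          (List.nodup_append'.1 hnd).1, Nat.add_sub_cancel] at hb
        convert hb using 1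
        rw [haT]
        ext σ
        simp only [List.toFinset_nil, Finset.union_empty]
        exact and_assoc
      · have hcard : (S \ (u ++ [a]).toFinset).card = S.card - 1 - u.length := by
          rw [Finset.card_sdiff_of_subset, List.toFinset_card_of_nodup hnd, List.length_append,
            List.length_singleton]
          · omega
          · exact fun y hy => ht.2 y (e ▸ List.mem_toFinset.1 hy)
        have hlt : (S \ (u ++ [a]).toFinset).card < S.card := by
          have := Finset.card_pos.2 ⟨a, ha⟩
          have := List.length_pos_iff.2 hu
          omega
        have hab := conn_prefixed hnd (ih _ hlt _ rfl) fun y hy => ht.2 y (e ▸ hy)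
        rw [hcard] at hab
        -- the words above `u a` that are present are those that extend it to the right
        convert hab using 1
        ext p
        constructor
        · rintro ⟨⟨hp, h⟩, hlt⟩
          refine ⟨hp, ?_⟩
          have hle := Word.le_def.1 hlt.le
          rw [e] at hle
          have hap : a ∈ p.seq := hle.subset (by simp)
          obtain ⟨p₁, p₂, e'⟩ := List.append_of_mem hap
          have hp1 := hp.1
          rw [e'] at hle hp1
          have hsub : u.Sublist p₁ := eq_filter_of_append_cons hp1 hle ▸ List.filter_sublist
          have hp₁ : p₁ ≠ [] := by
            rintro rfl
            exact hu (List.sublist_nil.1 hsub)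
          have hlen := Word.lt_length hlt
          have hpB := length_le_of_mem_injWords hp
          rcases h with h | h
          · exact absurd (e' ▸ mem_tail_append_cons hp₁) h.2
          · rw [hti, e', idxOf_append_cons (hnda hp1), ← e'] at h
            have hul : u.length = p₁.length := by
              refine le_antisymm hsub.length_le (not_lt.1 fun hlt => ?_)
              have hmul := Nat.mul_le_mul_right B (Nat.succ_le_of_lt hlt)
              rw [Nat.succ_mul] at hmul
              omega
            obtain rfl := hsub.eq_of_length hul
            refine ⟨p₂, ?_, by rw [e']; simp⟩
            rintro rfl
            rw [e, e'] at hlen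
            exact lt_irrefl _ hlen
        · rintro ⟨hp, q, hq, e'⟩
          have hpB := length_le_of_mem_injWords hp
          have hql := List.length_pos_iff.2 hq
          have hpl : p.seq.length = t.seq.length + q.length := by
            rw [e', e, List.length_append]
          have e'' : p.seq = u ++ a :: q := by rw [e']; simp
          refine ⟨⟨hp, Or.inr ?_⟩, lt_of_le_of_ne ?_ ?_⟩
          · rw [hti, e'', idxOf_append_cons hau, ← e'']
            omega
          · rw [Word.le_def, e, e']
            exact List.sublist_append_left _ _
          · rintro rfl
            omega
    · -- if `v` starts with `x` then inserting `x` contracts the part of the link below `u a v`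
      refine ⟨S.card, 0, by omega, ?_, conn_zero _⟩
      rw [hbelow]
      refine conn_subwords ht.1 ?_
      have hx : x ∉ insert a u.toFinset := by
        have h1 := List.nodup_append'.1 hnd
        rw [Finset.mem_insert, not_or, List.mem_toFinset]
        refine ⟨?_, fun h => h1.2.2 h (by simp)⟩
        rintro rfl
        simp at h1
      have hxt : x ∈ t.seq.toFinset := by rw [e]; simp
      refine conn_of_cone _ (p₀ := {x}) ⟨⟨Finset.singleton_nonempty x, by simpa using hxt⟩, ?_⟩
        (fun σ => insert x σ) ?_ ?_ ?_ ?_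
      · intro h
        have := h (Finset.mem_insert_self a _)
        rw [Finset.mem_singleton] at this
        exact hx (this ▸ Finset.mem_insert_self _ _)
      · exact fun σ _ ρ _ h => Finset.insert_subset_insert x h
      · rintro σ ⟨⟨-, h₁⟩, h₂⟩
        refine ⟨⟨Finset.insert_nonempty x σ, Finset.insert_subset hxt h₁⟩, fun h => h₂ ?_⟩
        exact (Finset.subset_insert_iff_of_notMem hx).1 h
      · exact fun σ _ => Finset.subset_insert x σ
      · exact fun σ _ => Finset.singleton_subset_iff.2 (Finset.mem_insert_self x σ)

end Words

/-! ### Ordered complexes -/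

section Ordered

variable {V : Type*} [DecidableEq V]

/-- The ordered simplices of a complex: the words without repetitions whose letters span a
simplex. -/
def orderedFaces (𝒦 : Set (Finset V)) : Set (Word V) :=
  {w | w.seq.Nodup ∧ w.seq.toFinset ∈ 𝒦}

theorem toFinset_mono_of_le {v w : Word V} (h : v ≤ w) : v.seq.toFinset ⊆ w.seq.toFinset :=
  fun _ hx => List.mem_toFinset.2 ((Word.le_def.1 h).subset (List.mem_toFinset.1 hx))

/-- The mapping cylinder of the map which forgets the order of the vertices of an ordered simplex:
the elements `(w, set of letters of w)` correspond to ordered simplices and the elements `(⊤, σ)`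
to simplices. -/
def cylinder (𝒦 : Set (Finset V)) : Set (WithTop (Word V) × Finset V) :=
  {x | (∃ w ∈ orderedFaces 𝒦, x = (↑w, w.seq.toFinset)) ∨ ∃ σ ∈ faces 𝒦, x = (⊤, σ)}

/-- If the link of each simplex `σ` of a complex (with the complex itself as the link of the empty
simplex) is `(c - |σ| - 2)`-connected then the poset of ordered simplices is `(c - 2)`-connected:
the mapping cylinder retracts to the complex, and the simplices can be removed from it in the order
of increasing dimension, since the link of `σ` is the join of the injective words on `σ` with the
link of `σ` in the complex. -/
theorem conn_orderedFaces {𝒦 : Set (Finset V)} (h𝒦 : ∀ σ ∈ 𝒦, ∀ ρ ⊆ σ, ρ ∈ 𝒦) {c B : ℕ}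
    (hB : ∀ σ ∈ 𝒦, σ.card < B) (hc : Conn c (faces 𝒦))
    (hlk : ∀ σ ∈ faces 𝒦, Conn (c - σ.card) (link 𝒦 (σ : Set V)ᶜ σ)) :
    Conn c (orderedFaces 𝒦) := by
  have hne : ∀ w : Word V, w.seq.toFinset.Nonempty := fun w =>
    (List.toFinset_nonempty_iff _).2 w.ne_nil
  have hcyl : Conn c (cylinder 𝒦) := by
    refine hc.of_dominated (fun x => x.2) (fun σ => (⊤, σ)) (fun x _ y _ h => h.2)
      (fun σ _ ρ _ h => ⟨le_rfl, h⟩) ?_ (fun σ hσ => Or.inr ⟨σ, hσ, rfl⟩)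
      (Or.inr fun x _ => ⟨le_top, le_rfl⟩)
    rintro _ (⟨w, hw, rfl⟩ | ⟨σ, hσ, rfl⟩)
    · exact ⟨hne w, hw.2⟩
    · exact hσ
  let A : Set (WithTop (Word V) × Finset V) := {x | ∃ w ∈ orderedFaces 𝒦, x = (↑w, w.seq.toFinset)}
  have hA : Conn c A := by
    refine hcyl.detach_join (fun x hx => Or.inl hx) (fun x => x.2.card) B ?_ ?_ ?_
    · rintro _ (⟨w, hw, rfl⟩ | ⟨σ, hσ, rfl⟩) _
      · exact hB _ hw.2
      · exact hB σ hσ.2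
    · rintro _ (hx | ⟨σ, hσ, rfl⟩) hxA _ (hy | ⟨ρ, hρ, rfl⟩) hyA h hle
      · exact absurd hx hxA
      · exact absurd hx hxA
      · exact absurd hy hyA
      · exact congrArg (Prod.mk ⊤) (Finset.eq_of_subset_of_card_le hle.2 h.ge)
    · rintro _ (ht | ⟨σ, hσ, rfl⟩) htA
      · exact absurd ht htA
      -- below `σ` there are the injective words on `σ`, above it the larger simplices
      refine ⟨σ.card, c - σ.card, by omega, ?_, ?_⟩
      · refine (conn_injWords σ).of_dominated (fun x => x.1.untopD (Word.mk [hσ.1.choose] (by simp)))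
          (fun w => (↑w, w.seq.toFinset)) ?_ ?_ ?_ ?_ (Or.inl ?_)
        · rintro x ⟨⟨-, hx⟩, hxσ⟩ y ⟨⟨-, hy⟩, hyσ⟩ hle
          rcases hx with ⟨w, hw, rfl⟩ | hx
          · rcases hy with ⟨w', hw', rfl⟩ | hy
            · exact WithTop.coe_le_coe.1 hle.1
            · exact absurd (Finset.card_le_card hyσ.le.2) hy.not_ge
          · exact absurd (Finset.card_le_card hxσ.le.2) hx.not_ge
        · exact fun w _ w' _ h => ⟨WithTop.coe_le_coe.2 h, toFinset_mono_of_le h⟩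
        · rintro x ⟨⟨-, hx⟩, hxσ⟩
          rcases hx with ⟨w, hw, rfl⟩ | hx
          · exact ⟨hw.1, fun y hy => hxσ.le.2 (List.mem_toFinset.2 hy)⟩
          · exact absurd (Finset.card_le_card hxσ.le.2) hx.not_ge
        · rintro w ⟨hw, hwσ⟩
          have hsub : w.seq.toFinset ⊆ σ := fun y hy => hwσ y (List.mem_toFinset.1 hy)
          have hwA : ((w : WithTop (Word V)), w.seq.toFinset) ∈ A := ⟨w, ⟨hw, h𝒦 σ hσ.2 _ hsub⟩, rfl⟩
          refine ⟨⟨Or.inl hwA, Or.inl hwA⟩, lt_of_le_of_ne ⟨le_top, hsub⟩ fun h => ?_⟩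
          exact WithTop.coe_ne_top (congrArg Prod.fst h)
        · rintro x ⟨⟨-, hx⟩, hxσ⟩
          rcases hx with ⟨w, hw, rfl⟩ | hx
          · exact le_rfl
          · exact absurd (Finset.card_le_card hxσ.le.2) hx.not_ge
      · refine (hlk σ hσ).of_dominated (fun x => x.2 \ σ) (fun ρ => (⊤, ρ ∪ σ)) ?_ ?_ ?_ ?_
          (Or.inr ?_)
        · exact fun x _ y _ h => Finset.sdiff_subset_sdiff h.2 le_rfl
        · exact fun ρ _ ρ' _ h => ⟨le_rfl, Finset.union_subset_union_left h⟩
        · rintro x ⟨⟨hx, hx'⟩, hlt⟩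
          have hx2 : x.2 ∈ 𝒦 := by
            rcases hx with ⟨w, hw, rfl⟩ | ⟨ρ, hρ, rfl⟩
            · exact hw.2
            · exact hρ.2
          have hx1 : x.1 = ⊤ := top_le_iff.1 hlt.le.1
          refine ⟨?_, fun y hy => by simpa using (Finset.mem_sdiff.1 hy).2, ?_⟩
          · rw [Finset.sdiff_nonempty]
            intro hle
            exact hlt.not_ge ⟨le_top, hle⟩
          · rw [Finset.sdiff_union_of_subset hlt.le.2]
            exact hx2
        · rintro ρ ⟨⟨y, hy⟩, hρ, hρσ⟩
          have hyσ : y ∉ σ := fun h => hρ hy h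
          have hss : σ ⊂ ρ ∪ σ := Finset.ssubset_iff_subset_ne.2 ⟨Finset.subset_union_right,
            fun h => hyσ (h ▸ Finset.mem_union_left σ hy)⟩
          refine ⟨⟨Or.inr ⟨_, ⟨⟨y, Finset.mem_union_left _ hy⟩, hρσ⟩, rfl⟩,
            Or.inr (Finset.card_lt_card hss)⟩, ?_⟩
          exact lt_of_le_of_ne ⟨le_rfl, hss.subset⟩ fun h => hss.ne (congrArg Prod.snd h)
        · rintro x ⟨⟨hx, hx'⟩, hlt⟩
          refine ⟨le_top, ?_⟩
          rw [Finset.sdiff_union_of_subset hlt.le.2]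
  obtain rfl | hpos := Nat.eq_zero_or_pos c
  · exact conn_zero _
  obtain ⟨q, hq⟩ := hA.exists_point hpos
  obtain ⟨x, hx⟩ := q.exists_wt_ne_zero
  obtain ⟨w₀, -, -⟩ := hq x hx
  refine hA.of_dominated (fun w => (↑w, w.seq.toFinset)) (fun x => x.1.untopD w₀) ?_ ?_ ?_ ?_
    (Or.inl fun w _ => le_rfl)
  · exact fun w _ w' _ h => ⟨WithTop.coe_le_coe.2 h, toFinset_mono_of_le h⟩
  · rintro _ ⟨w, hw, rfl⟩ _ ⟨w', hw', rfl⟩ h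
    exact WithTop.coe_le_coe.1 h.1
  · exact fun w hw => ⟨w, hw, rfl⟩
  · rintro _ ⟨w, hw, rfl⟩
    exact hw

end Ordered

end PosetRealization

open PosetRealization

/-! ### Unimodular sequences, unimodular sets and the stable range condition -/

section Unimodular

variable {R M : Type*} [CommRing R] [AddCommGroup M] [Module R M]

theorem isUnimodularSeq_iff {s : List M} : IsUnimodularSeq R s ↔
    ∃ g : Fin s.length → M →ₗ[R] R, ∀ i j, g i (s.get j) = if i = j then 1 else 0 := by
  constructor
  · rintro ⟨g, hg⟩
    refine ⟨fun i => LinearMap.proj i ∘ₗ g, fun i j => ?_⟩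
    have h := congrFun (LinearMap.congr_fun hg (Pi.single j 1)) i
    simpa [Fintype.linearCombination_apply, Pi.single_apply, ite_smul] using h
  · rintro ⟨g, hg⟩
    refine ⟨LinearMap.pi g, LinearMap.ext fun c => funext fun i => ?_⟩
    have : g i (∑ x, c x • s.get x) = c i := by
      simp only [map_sum, map_smul, hg, smul_eq_mul]
      simp
    simpa [Fintype.linearCombination_apply] using this

theorem isUnimodularVector_iff {x : M} :
    IsUnimodularVector R x ↔ ∃ g : M →ₗ[R] R, g x = 1 := by
  refine isUnimodularSeq_iff.trans ⟨fun ⟨g, hg⟩ => ⟨g 0, by simpa using hg 0 0⟩, fun ⟨g, hg⟩ => ?_⟩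
  refine ⟨fun _ => g, fun i j => ?_⟩
  obtain rfl : i = 0 := Subsingleton.elim (α := Fin 1) _ _
  obtain rfl : j = 0 := Subsingleton.elim (α := Fin 1) _ _
  simpa using hg

theorem isUnimodularVector_pi_iff {n : ℕ} {r : Fin n → R} :
    IsUnimodularVector R r ↔ ∃ c : Fin n → R, ∑ i, c i * r i = 1 := by
  rw [isUnimodularVector_iff]
  constructor
  · rintro ⟨g, hg⟩
    refine ⟨fun i => g (Pi.single i 1), ?_⟩
    refine Eq.trans ?_ hg
    conv_rhs => rw [pi_eq_sum_univ' r]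
    simp only [map_sum, map_smul, smul_eq_mul, mul_comm]
  · rintro ⟨c, hc⟩
    exact ⟨∑ i, c i • LinearMap.proj i, by simpa using hc⟩

/-- Coordinates for the stable range condition. -/
theorem StableRangeCondition.exists_shortening {n : ℕ} (h : StableRangeCondition R n)
    (r : Fin n → R) (a : R) (c : Fin n → R) (d : R) (hc : ∑ i, c i * r i + d * a = 1) :
    ∃ t c' : Fin n → R, ∑ i, c' i * (r i + t i * a) = 1 := by
  obtain ⟨t, ht⟩ := h (Fin.snoc r a) (isUnimodularVector_pi_iff.2 ⟨Fin.snoc c d, by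
    rw [Fin.sum_univ_castSucc]
    simpa using hc⟩)
  obtain ⟨c', hc'⟩ := isUnimodularVector_pi_iff.1 ht
  exact ⟨t, c', by simpa using hc'⟩

/-- To shorten `(r₀, …, rₙ₊₁)`, shorten `(r₀, …, rₙ₋₁, b)` for the combination `b` of the last two
entries that occurs in a representation of `1`; this changes `rᵢ` by a multiple of `rₙ₊₁`, up to a
multiple of `rₙ`. -/
theorem StableRangeCondition.succ {n : ℕ} (h : StableRangeCondition R n) :
    StableRangeCondition R (n + 1) := by
  intro r hr
  obtain ⟨c, hc⟩ := isUnimodularVector_pi_iff.1 hr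
  set l := Fin.last (n + 1)
  set k : Fin (n + 2) := (Fin.last n).castSucc
  rw [Fin.sum_univ_castSucc, Fin.sum_univ_castSucc] at hc
  obtain ⟨t, c', h'⟩ := h.exists_shortening (fun i => r i.castSucc.castSucc)
    (c k * r k + c l * r l) (fun i => c i.castSucc.castSucc) 1 (by
      rw [one_mul, ← add_assoc]
      exact hc)
  refine ⟨Fin.snoc (fun i => t i * c l) 0, isUnimodularVector_pi_iff.2
    ⟨Fin.snoc c' (∑ i, c' i * t i * c k), ?_⟩⟩
  rw [Fin.sum_univ_castSucc]
  simp only [Fin.snoc_castSucc, Fin.snoc_last, zero_mul, add_zero]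
  rw [← h', Finset.sum_mul, ← Finset.sum_add_distrib]
  refine Finset.sum_congr rfl fun i _ => ?_
  ring

theorem StableRangeCondition.mono {n n' : ℕ} (h : StableRangeCondition R n) (hn : n ≤ n') :
    StableRangeCondition R n' := by
  induction hn with
  | refl => exact h
  | step _ ih => exact ih.succ

/-- The infimum in the definition of the stable rank is attained if it is finite. -/
theorem stableRangeCondition_of_stableRank_eq {s : ℕ} (hs : stableRank R = (s : ℕ∞)) :
    StableRangeCondition R s := by
  by_contra hcon
  have h : ((s + 1 : ℕ) : ℕ∞) ≤ stableRank R := le_iInf₂ fun n hn => by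
    rw [Nat.cast_le]
    by_contra hlt
    exact hcon (hn.mono (by omega))
  rw [hs, Nat.cast_le] at h
  omega

theorem StableRangeCondition.pos [Nontrivial R] {n : ℕ} (h : StableRangeCondition R n) :
    0 < n := by
  rcases Nat.eq_zero_or_pos n with rfl | hn
  · obtain ⟨t, c, hc⟩ := h.exists_shortening Fin.elim0 1 Fin.elim0 1 (by simp)
    simp at hc
  · exact hn

variable (R) in
/-- A set of vectors is unimodular if its elements can be separated by linear forms. For a finite
set this says that its elements, in any order, form a unimodular sequence. -/
def IsUnimodularSet (S : Set M) : Prop :=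
  ∀ x ∈ S, ∃ g : M →ₗ[R] R, g x = 1 ∧ ∀ y ∈ S, y ≠ x → g y = 0

theorem IsUnimodularSet.mono {S T : Set M} (hT : IsUnimodularSet R T) (h : S ⊆ T) :
    IsUnimodularSet R S := fun x hx =>
  (hT x (h hx)).imp fun _ hg => ⟨hg.1, fun y hy => hg.2 y (h hy)⟩

theorem isUnimodularSeq_iff_nodup [Nontrivial R] {s : List M} :
    IsUnimodularSeq R s ↔ s.Nodup ∧ IsUnimodularSet R {x | x ∈ s} := by
  rw [isUnimodularSeq_iff]
  constructor
  · rintro ⟨g, hg⟩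
    refine ⟨List.nodup_iff_injective_get.2 fun i j hij => ?_, fun x hx => ?_⟩
    · by_contra hne
      have h₁ := hg i i
      have h₂ := hg i j
      rw [if_pos rfl, hij] at h₁
      rw [if_neg hne, h₁] at h₂
      exact one_ne_zero h₂
    · obtain ⟨i, rfl⟩ := List.mem_iff_get.1 hx
      refine ⟨g i, (hg i i).trans (if_pos rfl), fun y hy hne => ?_⟩
      obtain ⟨j, rfl⟩ := List.mem_iff_get.1 hy
      exact (hg i j).trans (if_neg fun h => hne (congrArg s.get h.symm))
  · rintro ⟨hn, h⟩
    choose! g hg hg' using h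
    refine ⟨fun i => g (s.get i), fun i j => ?_⟩
    split_ifs with hij
    · rw [hij]
      exact hg _ (s.get_mem j)
    · exact hg' _ (s.get_mem i) _ (s.get_mem j) fun h =>
        hij (List.nodup_iff_injective_get.1 hn h).symm

theorem IsUnimodularSet.card_le [Nontrivial R] [Module.Finite R M] {σ : Finset M}
    (h : IsUnimodularSet R (σ : Set M)) : σ.card ≤ Module.finrank R M := by
  refine LinearIndependent.finset_card_le_finrank (b := σ) ?_
  rw [Fintype.linearIndependent_iff]
  intro c hc i
  obtain ⟨g, hg, hg'⟩ := h i i.2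
  have := congrArg g hc
  rw [map_sum, Finset.sum_eq_single i] at this
  · simpa [hg] using this
  · intro j _ hj
    rw [map_smul, hg' j j.2 fun h => hj (Subtype.ext h), smul_zero]
  · exact fun h => absurd (Finset.mem_univ i) h

/-! ### Systems of vectors with dual linear forms -/

/-- The vectors `e i` and the linear forms `f i` are dual to each other. -/
def IsDualSystem {n : ℕ} (e : Fin n → M) (f : Fin n → M →ₗ[R] R) : Prop :=
  ∀ i j, f i (e j) = if i = j then 1 else 0

/-- For `n ≥ sr(R)`, the linear forms dual to `n` given vectors can be modified so that they generate
the unit ideal on a given unimodular vector. -/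
theorem IsDualSystem.exists_sum_eq_one {n : ℕ} {e : Fin n → M} {f : Fin n → M →ₗ[R] R}
    (hef : IsDualSystem e f) (hS : StableRangeCondition R n) {x : M} {g : M →ₗ[R] R}
    (hg : g x = 1) :
    ∃ f' : Fin n → M →ₗ[R] R, IsDualSystem e f' ∧ ∃ c : Fin n → R, ∑ i, c i * f' i x = 1 := by
  -- the part of `g` that vanishes on all `e i`
  set φ : M →ₗ[R] R := g - ∑ i, g (e i) • f i with hφ
  have hφe : ∀ j, φ (e j) = 0 := fun j => by
    simp [hφ, LinearMap.sum_apply, hef _ j]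
  obtain ⟨t, c, hc⟩ := hS.exists_shortening (fun i => f i x) (φ x) (fun i => g (e i)) 1 (by
    simp [hφ, LinearMap.sum_apply, hg])
  refine ⟨fun i => f i + t i • φ, fun i j => ?_, c, by simpa using hc⟩
  simp [hef i j, hφe]

/-- For `n ≥ sr(R)`, in a system of `n + 1` vectors with dual linear forms one of the forms can be
made to take the value `1` at a given unimodular vector. -/
theorem IsDualSystem.exists_eq_one {n : ℕ} {e : Fin (n + 1) → M} {f : Fin (n + 1) → M →ₗ[R] R}
    (hef : IsDualSystem e f) (hS : StableRangeCondition R n) {E : Submodule R M}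
    (he : ∀ i, e i ∈ E) {x : M} {g : M →ₗ[R] R} (hg : g x = 1) :
    ∃ (e' : Fin n → M) (f' : Fin n → M →ₗ[R] R) (ε : M) (φ : M →ₗ[R] R), IsDualSystem e' f' ∧
      (∀ i, e' i ∈ E) ∧ ε ∈ E ∧ φ x = 1 ∧ φ ε = 1 ∧ ∀ i, φ (e' i) = 0 := by
  -- first make the forms generate the unit ideal at `x`, then shorten to the first `n` of them
  obtain ⟨f, hef, c₀, hc₀⟩ := hef.exists_sum_eq_one hS.succ hg
  set l := Fin.last n
  rw [Fin.sum_univ_castSucc] at hc₀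
  obtain ⟨t, c, hc⟩ := hS.exists_shortening (fun i => f i.castSucc x) (f l x) _ _ hc₀
  have h₁ : ∀ i j : Fin n, f i.castSucc (e j.castSucc) = if i = j then 1 else 0 := fun i j => by
    simp [hef i.castSucc j.castSucc]
  have h₂ : ∀ i : Fin n, f i.castSucc (e l) = 0 := fun i => by
    rw [hef, if_neg (Fin.castSucc_lt_last i).ne]
  have h₃ : ∀ i : Fin n, f l (e i.castSucc) = 0 := fun i => by
    rw [hef, if_neg (Fin.castSucc_lt_last i).ne']
  have h₄ : f l (e l) = 1 := by rw [hef, if_pos rfl]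
  set ε : M := e l - ∑ j, t j • e j.castSucc with hε
  set f' : Fin n → M →ₗ[R] R := fun i => f i.castSucc + t i • f l with hf'
  set d : Fin n → R := fun i => (1 - f l x) * c i with hd
  have hf'ε : ∀ i, f' i ε = 0 := fun i => by simp [hf', hε, h₁, h₂, h₃, h₄]
  have hf'e : ∀ i j, f' i (e j.castSucc) = if i = j then 1 else 0 := fun i j => by
    simp [hf', h₁, h₃]
  have hfε : f l ε = 1 := by simp [hε, h₃, h₄]
  have hεE : ε ∈ E := E.sub_mem (he l) (E.sum_mem fun j _ => E.smul_mem _ (he _))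
  refine ⟨fun i => e i.castSucc - d i • ε, f', ε, f l + ∑ j, d j • f' j, fun i j => ?_,
    fun i => E.sub_mem (he _) (E.smul_mem _ hεE), hεE, ?_, ?_, fun i => ?_⟩
  · simp [hf'ε, hf'e]
  · have : ∑ j, d j * f' j x = 1 - f l x := by
      simp only [hd, mul_assoc, ← Finset.mul_sum]
      have : ∑ j, c j * f' j x = 1 := by simpa [hf'] using hc
      rw [this, mul_one]
    simp [LinearMap.sum_apply, this]
  · simp [LinearMap.sum_apply, hf'ε, hfε]
  · simp [LinearMap.sum_apply, hf'ε, hf'e, hfε, h₃]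

end Unimodular

/-! ### Complexes of unimodular sets -/

section UnimodularComplex

variable {R M : Type*} [CommRing R] [AddCommGroup M] [Module R M] [DecidableEq M]

variable (R) in
/-- The finite subsets of `X` which, together with the vectors in `v` and without meeting `v`, form
a unimodular set. -/
def unimodularComplex (X : Set M) (v : Finset M) : Set (Finset M) :=
  {σ | (σ : Set M) ⊆ X ∧ Disjoint σ v ∧ IsUnimodularSet R (↑(σ ∪ v) : Set M)}

theorem unimodularComplex_down {X : Set M} {v : Finset M} :
    ∀ σ ∈ unimodularComplex R X v, ∀ ρ ⊆ σ, ρ ∈ unimodularComplex R X v :=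
  fun _ hσ _ hρ => ⟨(Finset.coe_subset.2 hρ).trans hσ.1, hσ.2.1.mono_left hρ,
    hσ.2.2.mono (Finset.coe_subset.2 (Finset.union_subset_union_left hρ))⟩

/-- The links in a complex of unimodular sets are complexes of the same kind. -/
theorem link_unimodularComplex {X Y : Set M} {v τ : Finset M} (hYX : Y ⊆ X)
    (hτ : τ ∈ unimodularComplex R X v) (hYτ : ∀ x ∈ τ, x ∉ Y) :
    link (unimodularComplex R X v) Y τ = faces (unimodularComplex R Y (τ ∪ v)) := by
  ext ρ
  constructor
  · rintro ⟨hne, hρ, h₁, h₂, h₃⟩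
    rw [Finset.disjoint_union_left] at h₂
    refine ⟨hne, hρ, ?_, ?_⟩
    · rw [Finset.disjoint_union_right]
      exact ⟨Finset.disjoint_left.2 fun x hx hxτ => hYτ x hxτ (hρ hx), h₂.1⟩
    · rwa [← Finset.union_assoc]
  · rintro ⟨hne, hρ, h₁, h₂⟩
    rw [Finset.disjoint_union_right] at h₁
    refine ⟨hne, hρ, ?_, ?_, ?_⟩
    · rw [Finset.coe_union]
      exact Set.union_subset (hρ.trans hYX) hτ.1
    · exact Finset.disjoint_union_left.2 ⟨h₁.2, hτ.2.1⟩
    · rwa [Finset.union_assoc]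

theorem link_compl_unimodularComplex {X : Set M} {v σ : Finset M}
    (hσ : σ ∈ unimodularComplex R X v) :
    link (unimodularComplex R X v) (σ : Set M)ᶜ σ = faces (unimodularComplex R X (σ ∪ v)) := by
  ext ρ
  constructor
  · rintro ⟨hne, hρ, h₁, h₂, h₃⟩
    rw [Finset.disjoint_union_left] at h₂
    rw [Finset.coe_union, Set.union_subset_iff] at h₁
    refine ⟨hne, h₁.1, ?_, ?_⟩
    · rw [Finset.disjoint_union_right]
      exact ⟨Finset.disjoint_left.2 fun x hx hxτ => hρ hx hxτ, h₂.1⟩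
    · rwa [← Finset.union_assoc]
  · rintro ⟨hne, hρ, h₁, h₂⟩
    rw [Finset.disjoint_union_right] at h₁
    refine ⟨hne, fun x hx hxσ => Finset.disjoint_left.1 h₁.1 hx hxσ, ?_, ?_, ?_⟩
    · rw [Finset.coe_union]
      exact Set.union_subset hρ hσ.1
    · exact Finset.disjoint_union_left.2 ⟨h₁.2, hσ.2.1⟩
    · rwa [Finset.union_assoc]

variable [Nontrivial R]

/-- If a linear form `φ` vanishes on `X` and takes the value `1` at a vector `x ∈ v`, then the
vectors of `v` other than `x` can be moved into the kernel of `φ`, and `x` can be dropped. -/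
theorem exists_reduction {X : Set M} {v : Finset M} (hv : IsUnimodularSet R (v : Set M))
    {φ : M →ₗ[R] R} {x : M} (hx : x ∈ v) (hφx : φ x = 1) (hφX : ∀ y ∈ X, φ y = 0) :
    ∃ v' : Finset M, IsUnimodularSet R (v' : Set M) ∧ v'.card + 1 ≤ v.card ∧
      faces (unimodularComplex R X v) = faces (unimodularComplex R X v') := by
  let p : M → M := fun y => y - φ y • x
  set v' : Finset M := (v.erase x).image p with hv'
  have hmem : ∀ z, z ∈ v' ↔ ∃ y ∈ v, y ≠ x ∧ p y = z := fun z => by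
    simp [hv', and_assoc, and_left_comm]
  have hgp : ∀ (g : M →ₗ[R] R) y, g (p y) = g y - φ y * g x := fun g y => by simp [p]
  have hinj : ∀ y ∈ v, y ≠ x → ∀ z ∈ v, z ≠ x → p y = p z → y = z := by
    intro y hy hyx z hz hzx h
    obtain ⟨g, hg, hg'⟩ := hv y hy
    by_contra hne
    have h₁ := congrArg g h
    rw [hgp, hgp, hg, hg' x hx hyx.symm, hg' z hz (Ne.symm hne)] at h₁
    simp at h₁
  have key : ∀ ρ : Finset M, (ρ : Set M) ⊆ X →
      ((Disjoint ρ v ∧ IsUnimodularSet R (↑(ρ ∪ v) : Set M)) ↔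
        (Disjoint ρ v' ∧ IsUnimodularSet R (↑(ρ ∪ v') : Set M))) := by
    intro ρ hρ
    have hφρ : ∀ y ∈ ρ, φ y = 0 := fun y hy => hφX y (hρ hy)
    have hxρ : x ∉ ρ := fun h => by
      have := hφρ x h
      rw [hφx] at this
      exact one_ne_zero this
    constructor
    · rintro ⟨hd, hU⟩
      have hd' := Finset.disjoint_left.1 hd
      have hxU : x ∈ (↑(ρ ∪ v) : Set M) := Finset.mem_union_right _ hx
      have hd₁ : ∀ z ∈ ρ, z ∉ v' := by
        intro z hz hz'
        obtain ⟨y, hy, hyx, rfl⟩ := (hmem z).1 hz'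
        obtain ⟨g, hg, hg'⟩ := hU _ (Finset.mem_coe.2 (Finset.mem_union_left v hz))
        rw [hgp, hg' y (Finset.mem_union_right _ hy) fun h => hd' hz (h ▸ hy),
          hg' x hxU fun h => hd' hz (h ▸ hx)] at hg
        simp at hg
      refine ⟨Finset.disjoint_left.2 hd₁, fun z hz => ?_⟩
      rcases Finset.mem_union.1 (Finset.mem_coe.1 hz) with hz | hz
      · obtain ⟨g, hg, hg'⟩ := hU z (Finset.mem_union_left _ hz)
        refine ⟨g, hg, fun w hw hwz => ?_⟩
        rcases Finset.mem_union.1 (Finset.mem_coe.1 hw) with hw | hw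
        · exact hg' w (Finset.mem_union_left _ hw) hwz
        · obtain ⟨y, hy, hyx, rfl⟩ := (hmem w).1 hw
          rw [hgp, hg' y (Finset.mem_union_right _ hy) fun h => hd' hz (h ▸ hy),
            hg' x hxU fun h => hd' hz (h ▸ hx)]
          simp
      · obtain ⟨y, hy, hyx, rfl⟩ := (hmem z).1 hz
        obtain ⟨g, hg, hg'⟩ := hU y (Finset.mem_union_right _ hy)
        have hgx := hg' x hxU hyx.symm
        refine ⟨g, by rw [hgp, hg, hgx]; simp, fun w hw hwz => ?_⟩
        rcases Finset.mem_union.1 (Finset.mem_coe.1 hw) with hw | hw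
        · exact hg' w (Finset.mem_union_left _ hw) fun h => hd' hw (h ▸ hy)
        · obtain ⟨u, hu, hux, rfl⟩ := (hmem w).1 hw
          rw [hgp, hg' u (Finset.mem_union_right _ hu) fun h => hwz (h ▸ rfl), hgx]
          simp
    · rintro ⟨hd, hU⟩
      have hd' := Finset.disjoint_left.1 hd
      have hd₁ : ∀ z ∈ ρ, z ∉ v := by
        intro z hz hzv
        have hzx : z ≠ x := fun h => hxρ (h ▸ hz)
        refine hd' hz ((hmem z).2 ⟨z, hzv, hzx, ?_⟩)
        simp [p, hφρ z hz]
      -- a linear form on the kernel of `φ`, extended by zero on `x`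
      have hext : ∀ g : M →ₗ[R] R, ∃ g' : M →ₗ[R] R, ∀ y, g' y = g (p y) := fun g =>
        ⟨g - g x • φ, fun y => by rw [hgp]; simp [mul_comm]⟩
      have hpx : p x = 0 := by simp [p, hφx]
      have hpρ : ∀ y ∈ ρ, p y = y := fun y hy => by simp [p, hφρ y hy]
      refine ⟨Finset.disjoint_left.2 hd₁, fun z hz => ?_⟩
      by_cases hzx : z = x
      · -- correct `φ` by the forms dual to the other vectors of `v`
        subst hzx
        have h₁ : ∀ y ∈ v.erase z, ∃ g : M →ₗ[R] R, g (p y) = 1 ∧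
            ∀ w ∈ (↑(ρ ∪ v') : Set M), w ≠ p y → g w = 0 := fun y hy =>
          hU (p y) (Finset.mem_union_right _ (Finset.mem_image_of_mem p hy))
        choose! g hg hg' using h₁
        choose g' hg'' using fun y => hext (g y)
        refine ⟨φ - ∑ y ∈ v.erase z, φ y • g' y, ?_, fun w hw hwz => ?_⟩
        · simp [LinearMap.sum_apply, hg'', hpx, hφx]
        · rw [LinearMap.sub_apply, LinearMap.sum_apply, sub_eq_zero]
          simp only [LinearMap.smul_apply, smul_eq_mul, hg'']
          by_cases hwρ : w ∈ ρ
          · rw [hφρ w hwρ, Finset.sum_eq_zero]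
            intro y hy
            rw [hpρ w hwρ, hg' y hy w (Finset.mem_union_left _ hwρ), mul_zero]
            rintro rfl
            exact hd' hwρ (Finset.mem_image_of_mem p hy)
          · have hwv : w ∈ v := (Finset.mem_union.1 (Finset.mem_coe.1 hw)).resolve_left hwρ
            have hwe : w ∈ v.erase z := Finset.mem_erase.2 ⟨hwz, hwv⟩
            rw [Finset.sum_eq_single w, hg w hwe, mul_one]
            · intro y hy hyw
              have hy' := Finset.mem_erase.1 hy
              rw [hg' y hy (p w) (Finset.mem_union_right _ (Finset.mem_image_of_mem p hwe)),
                mul_zero]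
              exact fun h => hyw (hinj w hwv hwz y hy'.2 hy'.1 h).symm
            · exact fun h => absurd hwe h
      · have hpz : p z ∈ (↑(ρ ∪ v') : Set M) := by
          rcases Finset.mem_union.1 (Finset.mem_coe.1 hz) with hz | hz
          · rw [hpρ z hz]
            exact Finset.mem_union_left _ hz
          · exact Finset.mem_union_right _ ((hmem _).2 ⟨z, hz, hzx, rfl⟩)
        obtain ⟨g, hg, hg'⟩ := hU _ hpz
        obtain ⟨g', hg''⟩ := hext g
        refine ⟨g', by rw [hg'', hg], fun w hw hwz => ?_⟩
        rw [hg'']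
        by_cases hwx : w = x
        · rw [hwx, hpx, map_zero]
        have hpw : p w ∈ (↑(ρ ∪ v') : Set M) := by
          rcases Finset.mem_union.1 (Finset.mem_coe.1 hw) with hw | hw
          · rw [hpρ w hw]
            exact Finset.mem_union_left _ hw
          · exact Finset.mem_union_right _ ((hmem _).2 ⟨w, hw, hwx, rfl⟩)
        refine hg' _ hpw fun h => hwz ?_
        rcases Finset.mem_union.1 (Finset.mem_coe.1 hw) with hw | hw
        · rw [hpρ w hw] at h
          rcases Finset.mem_union.1 (Finset.mem_coe.1 hz) with hz | hz
          · rw [hpρ z hz] at h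
            exact h
          · exact absurd ((hmem w).2 ⟨z, hz, hzx, h.symm⟩) (hd' hw)
        · rcases Finset.mem_union.1 (Finset.mem_coe.1 hz) with hz | hz
          · rw [hpρ z hz] at h
            exact absurd ((hmem z).2 ⟨w, hw, hwx, h⟩) (hd' hz)
          · exact hinj w hw hwx z hz hzx h
  refine ⟨v', ?_, ?_, ?_⟩
  · have := ((key ∅ (by simp)).1 ⟨Finset.disjoint_empty_left _, by simpa using hv⟩).2
    simpa using this
  · have h₁ : v'.card ≤ (v.erase x).card := Finset.card_image_le
    have h₂ := Finset.card_erase_add_one hx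
    omega
  · ext ρ
    exact and_congr_right fun _ => and_congr_right fun hρ => key ρ hρ

end UnimodularComplex

/-! ### Connectivity of the complexes of unimodular sets -/

section Connectivity

variable {R M : Type*} [CommRing R] [AddCommGroup M] [Module R M]

theorem apply_eq_zero_of_invariant {X : Set M} {E : Submodule R M} (hX : X.Nonempty)
    (hXE : ∀ x ∈ X, ∀ u ∈ E, x + u ∈ X) {φ : M →ₗ[R] R} (hφ : ∀ x ∈ X, φ x = 0) {u : M}
    (hu : u ∈ E) : φ u = 0 := by
  obtain ⟨x, hx⟩ := hX
  have := hφ _ (hXE x hx u hu)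
  rwa [map_add, hφ x hx, zero_add] at this

variable [DecidableEq M]

variable (R) in
/-- For each finite unimodular set `v` the complex of the sets of vectors in `X` that extend it to a
unimodular set is `(m - s - |v| - 2)`-connected. -/
def HighlyConnected (s m : ℕ) (X : Set M) : Prop :=
  ∀ v : Finset M, IsUnimodularSet R (v : Set M) →
    Conn (m - (s + v.card)) (faces (unimodularComplex R X v))

/-- The vectors of `X` together with their translates by `a`. -/
def withTranslate (X : Set M) (a : M) : Set M := {y | y ∈ X ∨ ∃ x ∈ X, y = x + a}

variable {s m n : ℕ} {X : Set M} {v : Finset M}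

theorem HighlyConnected.conn_of_eq_one [Nontrivial R] (h : HighlyConnected R s m X)
    (hv : IsUnimodularSet R (v : Set M)) {φ : M →ₗ[R] R} {x : M} (hx : x ∈ v) (hφx : φ x = 1)
    (hφX : ∀ y ∈ X, φ y = 0) :
    Conn (m + 1 - (s + v.card)) (faces (unimodularComplex R X v)) := by
  obtain ⟨v', hv', hcard, e⟩ := exists_reduction hv hx hφx hφX
  rw [e]
  exact (h v' hv').mono (by omega)

/-- It suffices to consider vectors in a subset of `X`, for all unimodular sets containing `v`. -/
theorem conn_of_subset {Y : Set M} (hYX : Y ⊆ X) (hv : IsUnimodularSet R (v : Set M))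
    (h : ∀ w : Finset M, v ⊆ w → IsUnimodularSet R (w : Set M) →
      Conn (m - (s + w.card)) (faces (unimodularComplex R Y w))) :
    Conn (m - (s + v.card)) (faces (unimodularComplex R X v)) := by
  have hlk : ∀ τ ∈ unimodularComplex R X v, (∀ x ∈ τ, x ∉ Y) →
      Conn (m - (s + v.card) - τ.card) (link (unimodularComplex R X v) Y τ) := by
    intro τ hτ hτY
    rw [link_unimodularComplex hYX hτ hτY]
    refine (h (τ ∪ v) Finset.subset_union_right hτ.2.2).mono ?_
    rw [Finset.card_union_of_disjoint hτ.2.1]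
    omega
  refine conn_faces (X := Y) unimodularComplex_down ?_ fun τ hτ => hlk τ hτ.2
  exact hlk ∅ ⟨by simp, Finset.disjoint_empty_left _, by simpa using hv⟩ (by simp)

/-- If a linear form `φ` takes the value `1` at some `x ∈ v` then the connectivity for the vectors of
`X` in the kernel of `φ` gives that for `X`, improved by one since `x` can be dropped from `v`. -/
theorem conn_slice [Nontrivial R] {Y : Set M} (hYX : Y ⊆ X) (h : HighlyConnected R s m Y)
    (hv : IsUnimodularSet R (v : Set M)) {φ : M →ₗ[R] R} {x : M} (hx : x ∈ v) (hφx : φ x = 1)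
    (hφY : ∀ y ∈ Y, φ y = 0) :
    Conn (m + 1 - (s + v.card)) (faces (unimodularComplex R X v)) :=
  conn_of_subset hYX hv fun _ hvw hw => h.conn_of_eq_one hw (hvw hx) hφx hφY

/-- If `φ` vanishes on `X` and takes the value `1` at `a`, then adding the translate of `X` by `a`
raises the connectivity by one, in the absence of vectors to be extended: the sets of vectors in
`X` together with some `x + a` form a cone. -/
theorem HighlyConnected.conn_withTranslate [Nontrivial R] (h : HighlyConnected R s m X)
    (hX : X.Nonempty) {φ : M →ₗ[R] R} {a : M} (hφa : φ a = 1) (hφX : ∀ y ∈ X, φ y = 0) :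
    Conn (m + 1 - s) (faces (unimodularComplex R (withTranslate X a) ∅)) := by
  obtain ⟨x, hx⟩ := hX
  have hφy : φ (x + a) = 1 := by rw [map_add, hφX x hx, hφa, zero_add]
  refine conn_faces_of_cone (X := X) unimodularComplex_down (y := x + a) ?_ ?_ ?_
  · exact ⟨by simp, Finset.disjoint_empty_left _, fun y hy => by simp at hy⟩
  · rintro ρ ⟨h₁, -, h₂⟩ hρX
    rw [Finset.union_empty] at h₂
    have hρ : ∀ z ∈ ρ, φ z = 0 := fun z hz => hφX z (hρX hz)
    refine ⟨?_, Finset.disjoint_empty_right _, ?_⟩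
    · rw [Finset.coe_insert]
      exact Set.insert_subset (Or.inr ⟨x, hx, rfl⟩) h₁
    · rw [Finset.union_empty]
      intro z hz
      rcases Finset.mem_insert.1 (Finset.mem_coe.1 hz) with rfl | hz
      · refine ⟨φ, hφy, fun w hw hwz => hρ w ?_⟩
        exact (Finset.mem_insert.1 (Finset.mem_coe.1 hw)).resolve_left hwz
      · obtain ⟨g, hg, hg'⟩ := h₂ z hz
        refine ⟨g - g (x + a) • φ, by simp [hg, hρ z hz], fun w hw hwz => ?_⟩
        rcases Finset.mem_insert.1 (Finset.mem_coe.1 hw) with rfl | hw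
        · rw [LinearMap.sub_apply, LinearMap.smul_apply, hφy, smul_eq_mul, mul_one, sub_self]
        · simp [hg' w hw hwz, hρ w hw]
  · intro τ hτ hτX _
    have hsub : X ⊆ withTranslate X a := fun y hy => Or.inl hy
    have hU := hτ.2.2.2
    rw [Finset.union_empty] at hU
    rw [link_unimodularComplex hsub hτ.2 hτX, Finset.union_empty]
    obtain ⟨z, hz⟩ := hτ.1
    obtain ⟨y, hy, rfl⟩ := (hτ.2.1 hz).resolve_left (hτX z hz)
    refine (h.conn_of_eq_one hU hz (φ := φ) ?_ hφX).mono (by omega)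
    rw [map_add, hφX y hy, hφa, zero_add]

variable (R) in
/-- The connectivity of the complexes of unimodular sets in a set `X` which is invariant under
translation by `n` vectors that have dual linear forms. -/
def ConnInvariant (s n : ℕ) (M : Type*) [AddCommGroup M] [Module R M] [DecidableEq M] : Prop :=
  ∀ (E : Submodule R M) (e : Fin n → M) (f : Fin n → M →ₗ[R] R), IsDualSystem e f →
    (∀ i, e i ∈ E) → ∀ X : Set M, X.Nonempty → (∀ x ∈ X, ∀ u ∈ E, x + u ∈ X) →
      HighlyConnected R s (n + 1) X

variable (R) in
/-- The connectivity of the complexes of unimodular sets in the union of a set `X` as in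
`ConnInvariant` and its translate by a vector `a`, where `X` lies in the kernel of a linear form that
takes the value `1` at `a`. -/
def ConnTranslate (s n : ℕ) (M : Type*) [AddCommGroup M] [Module R M] [DecidableEq M] : Prop :=
  ∀ (E : Submodule R M) (e : Fin n → M) (f : Fin n → M →ₗ[R] R), IsDualSystem e f →
    (∀ i, e i ∈ E) → ∀ X : Set M, X.Nonempty → (∀ x ∈ X, ∀ u ∈ E, x + u ∈ X) →
      ∀ (a : M) (φ : M →ₗ[R] R), φ a = 1 → (∀ x ∈ X, φ x = 0) →
        HighlyConnected R s (n + 2) (withTranslate X a)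

variable [Nontrivial R]

/-- For empty `v`, a slice of `X` and its translate by the last vector give a start; otherwise the
dual system is adapted to an element of `v`, which is then dropped. -/
theorem ConnInvariant.succ (hS : StableRangeCondition R s) (hA : ConnInvariant R s n M)
    (hB : ConnTranslate R s n M) : ConnInvariant R s (n + 1) M := by
  intro E e f hef he X hX hXE v hv
  rcases v.eq_empty_or_nonempty with rfl | ⟨x, hx⟩
  · -- a slice of `X` and its translate by the last vector
    set l := Fin.last n
    have hll : f l (e l) = 1 := by rw [hef, if_pos rfl]
    obtain ⟨x, hx⟩ := hX
    have hY := hB (E ⊓ LinearMap.ker (f l)) (fun i => e i.castSucc) (fun i => f i.castSucc)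
      (fun i j => by simp [hef i.castSucc j.castSucc])
      (fun i => ⟨he _, (hef _ _).trans (if_neg (Fin.castSucc_lt_last i).ne')⟩)
      {y | y ∈ X ∧ f l y = 0}
      ⟨x + -f l x • e l, hXE x hx _ (E.smul_mem _ (he l)), by simp [hll]⟩
      (fun y hy u hu => ⟨hXE y hy.1 u hu.1, by rw [map_add, hy.2, hu.2, add_zero]⟩)
      (e l) (f l) hll (fun y hy => hy.2)
    refine conn_of_subset (Y := withTranslate {y | y ∈ X ∧ f l y = 0} (e l)) ?_ hv
      fun w _ hw => hY w hw
    rintro _ (hy | ⟨y, hy, rfl⟩)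
    · exact hy.1
    · exact hXE y hy.1 _ (he l)
  · have hpos := Finset.card_pos.2 ⟨x, hx⟩
    -- if `n < s` then nothing is claimed
    rcases lt_or_ge n s with hns | hns
    · exact (conn_zero _).mono (by omega)
    obtain ⟨g, hg, -⟩ := hv x hx
    obtain ⟨e', f', ε, φ, hef', he', hε, hφx, hφε, hφe⟩ := hef.exists_eq_one (hS.mono hns) he hg
    obtain ⟨x₀, hx₀⟩ := hX
    refine conn_slice (Y := {y | y ∈ X ∧ φ y = 0}) (fun y hy => hy.1) ?_ hv hx hφx fun y hy => hy.2
    exact hA (E ⊓ LinearMap.ker φ) e' f' hef' (fun i => ⟨he' i, hφe i⟩) _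
      ⟨x₀ + -φ x₀ • ε, hXE x₀ hx₀ _ (E.smul_mem _ hε), by simp [hφε]⟩
      (fun y hy u hu => ⟨hXE y hy.1 u hu.1, by rw [map_add, hy.2, hu.2, add_zero]⟩)

theorem ConnInvariant.connTranslate_empty (hA : ConnInvariant R s n M) {E : Submodule R M}
    {e : Fin n → M} {f : Fin n → M →ₗ[R] R} (hef : IsDualSystem e f) (he : ∀ i, e i ∈ E)
    (hX : X.Nonempty) (hXE : ∀ x ∈ X, ∀ u ∈ E, x + u ∈ X) {a : M} {φ : M →ₗ[R] R} (hφa : φ a = 1)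
    (hφ : ∀ x ∈ X, φ x = 0) :
    Conn (n + 2 - s) (faces (unimodularComplex R (withTranslate X a) ∅)) :=
  (hA E e f hef he X hX hXE).conn_withTranslate hX hφa hφ

/-- For empty `v` this is a cone construction; otherwise the dual system and the translation vector are
adapted to an element of `v`, which is then dropped. -/
theorem ConnTranslate.succ (hS : StableRangeCondition R s) (hA : ConnInvariant R s (n + 1) M)
    (hB : ConnTranslate R s n M) : ConnTranslate R s (n + 1) M := by
  intro E e f hef he X hX hXE a ψ hψa hψ v hv
  rcases v.eq_empty_or_nonempty with rfl | ⟨x, hx⟩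
  · exact hA.connTranslate_empty hef he hX hXE hψa hψ
  have hpos := Finset.card_pos.2 ⟨x, hx⟩
  have hψE : ∀ u ∈ E, ψ u = 0 := fun u hu => apply_eq_zero_of_invariant hX hXE hψ hu
  obtain ⟨g, hg, -⟩ := hv x hx
  obtain ⟨x₀, hx₀⟩ := hX
  rcases lt_or_ge n s with hns | hns
  · -- the dual system is too small to be adapted, but at most non-emptiness is claimed
    by_cases hc : n + 1 = s ∧ v.card = 1
    · obtain ⟨hns, hc⟩ := hc
      obtain ⟨x', rfl⟩ := Finset.card_eq_one.1 hc
      obtain rfl := Finset.mem_singleton.1 hx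
      refine Conn.mono (conn_one ?_) (by omega)
      obtain ⟨f', hef', c, hcx⟩ := hef.exists_sum_eq_one (hS.mono hns.ge) hg
      -- a linear form that separates `x` from a vector on which all `f' i` vanish
      set θ : M →ₗ[R] R := ∑ i, c i • f' i with hθ
      have hθx : θ x = 1 := by simpa [hθ] using hcx
      set u : M := -∑ i, f' i (x₀ + a) • e i with hu
      have huE : u ∈ E := E.neg_mem (E.sum_mem fun i _ => E.smul_mem _ (he i))
      have hw : ∀ i, f' i (x₀ + u + a) = 0 := fun i => by
        simp [hu, hef' i _]
      have hθw : θ (x₀ + u + a) = 0 := by simp [hθ, LinearMap.sum_apply, hw]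
      have hψw : ψ (x₀ + u + a) = 1 := by rw [map_add, hψ _ (hXE x₀ hx₀ u huE), hψa, zero_add]
      have hne : x₀ + u + a ≠ x := fun h => by
        rw [h, hθx] at hθw
        exact one_ne_zero hθw
      refine ⟨{x₀ + u + a}, Finset.singleton_nonempty _, ?_, by simpa using hne, ?_⟩
      · rw [Finset.coe_singleton, Set.singleton_subset_iff]
        exact Or.inr ⟨x₀ + u, hXE x₀ hx₀ u huE, rfl⟩
      · intro z hz
        rcases Finset.mem_union.1 (Finset.mem_coe.1 hz) with hz | hz
        · obtain rfl := Finset.mem_singleton.1 hz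
          refine ⟨ψ - ψ x • θ, by simp [hψw, hθw], fun y hy hyz => ?_⟩
          rcases Finset.mem_union.1 (Finset.mem_coe.1 hy) with hy | hy
          · exact absurd (Finset.mem_singleton.1 hy) hyz
          · obtain rfl := Finset.mem_singleton.1 hy
            simp [hθx]
        · obtain rfl := Finset.mem_singleton.1 hz
          refine ⟨θ, hθx, fun y hy hyz => ?_⟩
          rcases Finset.mem_union.1 (Finset.mem_coe.1 hy) with hy | hy
          · obtain rfl := Finset.mem_singleton.1 hy
            exact hθw
          · exact absurd (Finset.mem_singleton.1 hy) hyz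
    · exact (conn_zero _).mono (by omega)
  · obtain ⟨e', f', ε, φ, hef', he', hε, hφx, hφε, hφe⟩ := hef.exists_eq_one (hS.mono hns) he hg
    -- the translation vector is moved into the kernel of `φ`
    set a' : M := a - φ a • ε with ha'
    have hφa' : φ a' = 0 := by simp [ha', hφε]
    have hψa' : ψ a' = 1 := by simp [ha', hψa, hψE ε hε]
    have hY := hB (E ⊓ LinearMap.ker φ) e' f' hef' (fun i => ⟨he' i, hφe i⟩)
      {y | y ∈ X ∧ φ y = 0}
      ⟨x₀ + -φ x₀ • ε, hXE x₀ hx₀ _ (E.smul_mem _ hε), by simp [hφε]⟩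
      (fun y hy u hu => ⟨hXE y hy.1 u hu.1, by rw [map_add, hy.2, hu.2, add_zero]⟩)
      a' ψ hψa' (fun y hy => hψ y hy.1)
    refine conn_slice (Y := withTranslate {y | y ∈ X ∧ φ y = 0} a') ?_ hY hv hx hφx ?_
    · rintro _ (hy | ⟨y, hy, rfl⟩)
      · exact Or.inl hy.1
      · refine Or.inr ⟨y + -φ a • ε, hXE y hy.1 _ (E.smul_mem _ hε), ?_⟩
        rw [ha', neg_smul]
        abel
    · rintro _ (hy | ⟨y, hy, rfl⟩)
      · exact hy.2
      · rw [map_add, hy.2, hφa', add_zero]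

theorem connInvariant_zero (hS : StableRangeCondition R s) : ConnInvariant R s 0 M :=
  fun _ _ _ _ _ _ _ _ _ _ => (conn_zero _).mono (by have := hS.pos; omega)

theorem connTranslate_zero (hS : StableRangeCondition R s) : ConnTranslate R s 0 M := by
  intro E e f hef he X hX hXE a φ hφa hφ v hv
  rcases v.eq_empty_or_nonempty with rfl | hne
  · exact (connInvariant_zero hS).connTranslate_empty hef he hX hXE hφa hφ
  · have := Finset.card_pos.2 hne
    exact (conn_zero _).mono (by have := hS.pos; omega)

theorem connInvariant_and_connTranslate (hS : StableRangeCondition R s) (n : ℕ) :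
    ConnInvariant R s n M ∧ ConnTranslate R s n M := by
  induction n with
  | zero => exact ⟨connInvariant_zero hS, connTranslate_zero hS⟩
  | succ n ih =>
    have hA := ih.1.succ hS ih.2
    exact ⟨hA, ConnTranslate.succ hS hA ih.2⟩

end Connectivity

/-! ### Posets of unimodular sequences -/

/-- Connectivity of a poset of sequences, if its elements are the ordered simplices of a complex. -/
theorem PosetRealization.Conn.seqPoset {V : Type*} [DecidableEq V] {F : Set (List V)}
    {𝒦 : Set (Finset V)} (h : ∀ l : List V, l ∈ F ↔ l.Nodup ∧ l.toFinset ∈ 𝒦) {c : ℕ}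
    (hc : Conn c (orderedFaces 𝒦)) : Conn c (Set.univ : Set (SeqPoset F)) := by
  classical
  obtain rfl | hpos := Nat.eq_zero_or_pos c
  · exact conn_zero _
  obtain ⟨q, hq⟩ := hc.exists_point hpos
  obtain ⟨w₀, hw₀⟩ := q.exists_wt_ne_zero
  have h₀ := hq w₀ hw₀
  let g : Word V → SeqPoset F := fun w =>
    if hw : w.seq ∈ F then ⟨w.seq, w.ne_nil, hw⟩ else ⟨w₀.seq, w₀.ne_nil, (h _).2 h₀⟩
  have hg : ∀ w : Word V, w.seq ∈ F → (g w).seq = w.seq := fun w hw => by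
    simp only [g]
    rw [dif_pos hw]
  refine hc.of_dominated (fun p => Word.mk p.seq p.ne_nil) g (fun _ _ _ _ h => h) ?_
    (fun p _ => (h _).1 p.mem) (fun _ _ => Set.mem_univ _) (Or.inl fun p _ => ?_)
  · intro w hw w' hw' hle
    change (g w).seq.Sublist (g w').seq
    rw [hg w ((h _).2 hw), hg w' ((h _).2 hw')]
    exact hle
  · change (g (Word.mk p.seq p.ne_nil)).seq.Sublist p.seq
    rw [hg _ p.mem]
    exact List.Sublist.refl _

section Main

variable {R M : Type*} [CommRing R] [Nontrivial R] [AddCommGroup M] [Module R M]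

theorem append_mem_unimodularSeqs_iff [DecidableEq M] {m : M} {N : Submodule R M} {v : List M}
    (hv : v.Nodup) (hvN : ∀ x ∈ v, ∃ n ∈ N, x = m + n) (l : List M) :
    l ++ v ∈ unimodularSeqs R m N ↔
      l.Nodup ∧ l.toFinset ∈ unimodularComplex R {x | ∃ n ∈ N, x = m + n} v.toFinset := by
  have e : (↑(l.toFinset ∪ v.toFinset) : Set M) = {x | x ∈ l ++ v} := by
    ext x
    simp
  have hd : Disjoint l.toFinset v.toFinset ↔ l.Disjoint v := by
    rw [Finset.disjoint_left]
    simp [List.Disjoint]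
  simp only [unimodularSeqs, unimodularComplex, Set.mem_ofPred_eq, isUnimodularSeq_iff_nodup,
    List.nodup_append', e, hd, List.mem_append, Set.subset_def, List.coe_toFinset]
  constructor
  · rintro ⟨⟨⟨h₁, -, h₂⟩, h₃⟩, h₄⟩
    exact ⟨h₁, fun x hx => h₄ x (Or.inl hx), h₂, h₃⟩
  · rintro ⟨h₁, h₂, h₃, h₄⟩
    exact ⟨⟨⟨h₁, hv, h₃⟩, h₄⟩, fun x hx => hx.elim (h₂ x) (hvN x)⟩

/-- A basis of a free direct summand, with the coordinate forms extended by the projection. -/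
theorem exists_dualSystem_of_relativeRank [Module.Finite R M] (N : Submodule R M) :
    ∃ (e : Fin (relativeRank R N) → M) (f : Fin (relativeRank R N) → M →ₗ[R] R),
      IsDualSystem e f ∧ ∀ i, e i ∈ N := by
  obtain ⟨⟨L, hLN, ⟨L', hL⟩, hfree, hrank⟩, -⟩ := relativeRank_isGreatest N
  have hfin : Module.Finite R L :=
    Module.Finite.of_surjective (L.projectionOnto L' hL)
      (Submodule.projectionOnto_surjective hL)
  let b := Module.finBasisOfFinrankEq R L hrank
  refine ⟨fun i => b i, fun i => b.coord i ∘ₗ L.projectionOnto L' hL, fun i j => ?_,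
    fun i => hLN (b i).2⟩
  simp [Submodule.projectionOnto_apply_left, Finsupp.single_apply, eq_comm]

theorem conn_orderedFaces_unimodular [DecidableEq M] [Module.Finite R M] {s : ℕ}
    (hS : StableRangeCondition R s) (m : M) (N : Submodule R M) {v : Finset M}
    (hv : IsUnimodularSet R (v : Set M)) :
    Conn (relativeRank R N + 1 - (s + v.card))
      (orderedFaces (unimodularComplex R {x | ∃ n ∈ N, x = m + n} v)) := by
  obtain ⟨e, f, hef, he⟩ := exists_dualSystem_of_relativeRank N
  have H := (connInvariant_and_connTranslate hS _).1 N e f hef he {x | ∃ n ∈ N, x = m + n}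
    ⟨m, 0, N.zero_mem, (add_zero m).symm⟩ (by
      rintro _ ⟨n, hn, rfl⟩ u hu
      exact ⟨n + u, N.add_mem hn hu, add_assoc m n u⟩)
  refine conn_orderedFaces unimodularComplex_down (B := Module.finrank R M + 1) ?_ (H v hv) ?_
  · intro σ hσ
    have := (hσ.2.2.mono (Finset.coe_subset.2 Finset.subset_union_left)).card_le
    omega
  · intro σ hσ
    rw [link_compl_unimodularComplex hσ.2]
    refine (H (σ ∪ v) hσ.2.2.2).mono ?_
    rw [Finset.card_union_of_disjoint hσ.2.2.1]
    omega

end Main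

theorem mainTheorem8 {R M : Type*} [CommRing R] [Nontrivial R] [AddCommGroup M] [Module R M]
    [Module.Free R M] [Module.Finite R M] (m : M) (N : Submodule R M)
    (s : ℕ) (hs : stableRank R = (s : ℕ∞)) :
    IsNConnectedPoset ((relativeRank R N : ℤ) - (s : ℤ) - 1) (UnimodularPoset R m N) ∧
    ∀ v : UnimodularPoset R m N,
      IsNConnectedPoset ((relativeRank R N : ℤ) - (s : ℤ) - (v.seq.length : ℤ) - 1)
        (UnimodularPosetEnding R m N v.seq) := by
  classical
  have hS := stableRangeCondition_of_stableRank_eq hs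
  constructor
  · have h := conn_orderedFaces_unimodular hS m N (v := ∅) (by simp [IsUnimodularSet])
    refine (h.seqPoset fun l => ?_).isNConnectedPoset (by rw [Finset.card_empty]; omega)
    simpa using append_mem_unimodularSeqs_iff (m := m) (N := N) List.nodup_nil (by simp) l
  · intro v
    obtain ⟨hn, hU⟩ := isUnimodularSeq_iff_nodup.1 v.mem.1
    have h := conn_orderedFaces_unimodular hS m N (v := v.seq.toFinset) (by simpa using hU)
    refine (h.seqPoset (F := {w | w ++ v.seq ∈ unimodularSeqs R m N}) fun l =>
      append_mem_unimodularSeqs_iff hn v.mem.2 l).isNConnectedPoset ?_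
    rw [List.toFinset_card_of_nodup hn]
    omega
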